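/- Let $G=(V,E)$ be a finite undirected graph (loops and multiple edges allowed) that is cellularly embedded on the torus $T$, i.e. the complement of $G$ in $T$ is a disjoint union of open disks, the faces; such an embedding is given by a rotation system on the connected graph $G$ with $|V|-|E|+|F|=0$, where $F$ is the set of faces. Let $w:E\to\mathbb{R}$ be a weight function with $w(e)>0$ for all $e\in E$. The length $w(c)$ of a closed walk $c$ is the sum of the weights of its edges, counted with multiplicity; $[c]$ denotes its class in $H_1(T;\mathbb{Z})=\ker\partial_1/\operatorname{im}\partial_2$, computed in the cell complex of vertices, edges and faces. The marked length spectrum of $(G,w)$ assigns to each free homotopy class of closed walks the length of a shortest closed walk in the class. A simple cycle is a closed walk with at least one edge that repeats neither a vertex nor an edge. Then $H_1(T;\mathbb{Z})$ is free of rank two and is a lattice in $H_1(T;\mathbb{R})\cong\mathbb{R}^2$, and $c\mapsto[c]$ induces a bijection from the free homotopy classes of closed walks of $G$ to $H_1(T;\mathbb{Z})$. There is a norm $N_{G,w}$ on $H_1(T;\mathbb{R})$ that extends the marked length spectrum: for every closed walk $c$, $N_{G,w}([c])$ is the minimum of $w(c')$ over the closed walks $c'$ of $G$ freely homotopic to $c$.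 For every $\alpha\in H_1(T;\mathbb{Z})$, $$N_{G,w}(\alpha)=\min\Big\{\sum_{e\in E}|x_e|\,w(e)\ :\ \sum_{e\in E}x_e e\in Z_1(G;\mathbb{Z}),\ \Big[\sum_{e\in E}x_e e\Big]=\alpha\Big\}.$$ The norm is polyhedral: its unit ball $B=\{p\in H_1(T;\mathbb{R}) : N_{G,w}(p)\le 1\}$ is the polygon $$B=\operatorname{conv}\Big\{\frac{[c]}{w(c)}\ :\ c \text{ a simple cycle of } G\Big\},$$ the convex hull of a finite set. The polygon $B$ has at most $4|V|+5$ extremal points, and in the coordinates with respect to any basis of $H_1(T;\mathbb{Z})$, the ratio of the two coordinates of each extremal point is rational or infinite. -/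

import Mathlib

/-- An undirected graph with vertex set `V` and edge set `E`, loops and multiple edges allowed.
Every edge carries a reference orientation (from `src` to `tgt`), used only to write chains. -/
structure Multigraph (V E : Type*) where
  src : E → V
  tgt : E → V

/-- Oriented edges: `(e, true)` is `e` with its reference orientation, `(e, false)` is `e` with the
opposite orientation. -/
abbrev Dart (E : Type*) := E × Bool

/-- The same edge with the opposite orientation. -/
def Dart.rev {E : Type*} (d : Dart E) : Dart E := (d.1, !d.2)

open Classical in
/-- The 1-chain of an oriented edge. A 1-chain is a formal linear combination of the edges, written
as the function of its coefficients. -/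
noncomputable def Dart.chain {E : Type*} (A : Type*) [CommRing A] (d : Dart E) : E → A :=
  Pi.single d.1 (if d.2 then 1 else -1)

namespace Multigraph

variable {V E : Type*} (G : Multigraph V E)

/-- The source of an oriented edge. -/
def source (d : Dart E) : V := if d.2 then G.src d.1 else G.tgt d.1

/-- The target of an oriented edge. -/
def target (d : Dart E) : V := G.source d.rev

/-- `G.IsWalk u v l`: the oriented edges of `l` form a walk from `u` to `v`. -/
def IsWalk : V → V → List (Dart E) → Prop
  | u, v, [] => u = v
  | u, v, d :: l => G.source d = u ∧ IsWalk (G.target d) v l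

/-- Any two vertices are joined by a walk, and there is a vertex. -/
def IsConnected : Prop := Nonempty V ∧ ∀ u v : V, ∃ l, G.IsWalk u v l

/-- A closed walk with its basepoint (it may be reduced to a vertex). -/
structure ClosedWalk where
  base : V
  darts : List (Dart E)
  isWalk : G.IsWalk base base darts

/-- A simple cycle: a closed walk with at least one edge, without repeated vertices and without
repeated edges (so `e` followed by its reverse is not a simple cycle). -/
def ClosedWalk.IsSimpleCycle {G : Multigraph V E} (c : G.ClosedWalk) : Prop :=
  c.darts ≠ [] ∧ (c.darts.map G.source).Nodup ∧ (c.darts.map Prod.fst).Nodup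

/-- The length of a closed walk: the sum of the weights of its edges, with multiplicity. -/
def ClosedWalk.length {G : Multigraph V E} (w : E → ℝ) (c : G.ClosedWalk) : ℝ :=
  (c.darts.map fun d => w d.1).sum

section Chains

variable [Fintype E] (A : Type*) [CommRing A]

open Classical in
/-- The boundary operator `∂₁ : C₁ → C₀`. -/
noncomputable def boundary₁ : (E → A) →ₗ[A] (V → A) :=
  Fintype.linearCombination A fun e => Pi.single (G.tgt e) (1 : A) - Pi.single (G.src e) 1

/-- The 1-cycles `Z₁(G; A)`. -/
noncomputable abbrev cycles : Submodule A (E → A) := LinearMap.ker (G.boundary₁ A)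

open Classical in
lemma boundary₁_dart (d : Dart E) :
    G.boundary₁ A (d.chain A) = Pi.single (G.target d) (1 : A) - Pi.single (G.source d) 1 := by
  obtain ⟨e, b⟩ := d
  cases b <;>
    simp [boundary₁, Dart.chain, target, source, Dart.rev, Fintype.linearCombination_apply_single]

open Classical in
lemma boundary₁_walk (l : List (Dart E)) : ∀ u v : V, G.IsWalk u v l →
    G.boundary₁ A ((l.map (Dart.chain A)).sum) = Pi.single v (1 : A) - Pi.single u 1 := by
  induction l with
  | nil =>
    intro u v h
    have h' : u = v := h
    simp [h']
  | cons d l ih =>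
    intro u v h
    have h1 : G.source d = u := h.1
    have h2 : G.IsWalk (G.target d) v l := h.2
    rw [List.map_cons, List.sum_cons, map_add, boundary₁_dart, ih _ _ h2, h1]
    abel

/-- The 1-cycle of a closed walk: the sum of its oriented edges. -/
noncomputable def ClosedWalk.cycle {G : Multigraph V E} (A : Type*) [CommRing A]
    (c : G.ClosedWalk) : G.cycles A :=
  ⟨(c.darts.map (Dart.chain A)).sum, by
    rw [LinearMap.mem_ker, G.boundary₁_walk A _ _ _ c.isWalk, sub_self]⟩

end Chains

/-- A rotation system: a permutation of the oriented edges whose orbits are exactly the sets of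
oriented edges with a common source. It gives the cyclic order of the oriented edges around each
vertex, and so encodes a cellular embedding of the graph in a closed oriented surface. -/
structure RotationSystem where
  rot : Equiv.Perm (Dart E)
  sameCycle_iff : ∀ d d' : Dart E, rot.SameCycle d d' ↔ G.source d = G.source d'

namespace RotationSystem

variable {G} (R : G.RotationSystem)

/-- Walking along a face: after `d`, take the oriented edge that follows the reverse of `d` in the
cyclic order around the target of `d`. -/
def facePerm : Equiv.Perm (Dart E) :=
  (⟨Dart.rev, Dart.rev, fun d => by simp [Dart.rev], fun d => by simp [Dart.rev]⟩ :
    Equiv.Perm (Dart E)).trans R.rot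

/-- The faces of the embedding: the orbits of `facePerm`. -/
def Face : Type _ := Quotient (Equiv.Perm.SameCycle.setoid R.facePerm)

/-- The face whose boundary runs through the oriented edge `d`. -/
def faceOf (d : Dart E) : R.Face := Quotient.mk _ d

/-- The boundary walk of the face of `d`, starting with `d` and run through once. -/
noncomputable def faceWalk (d : Dart E) : List (Dart E) :=
  (List.range (Function.minimalPeriod R.facePerm d)).map fun k => (R.facePerm)^[k] d

/-- The surface in which the graph is embedded is a torus: it is connected and its Euler
characteristic `|V| - |E| + |F|` is zero (it is oriented by construction). -/
def IsTorus : Prop :=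
  G.IsConnected ∧ (Nat.card V : ℤ) - Nat.card E + Nat.card R.Face = 0

/-- An elementary free homotopy from `c` to `c'`: change of basepoint along the closed walk,
insertion of an edge followed by its reverse, or insertion of the boundary of a face. -/
inductive ElementaryHomotopy : G.ClosedWalk → G.ClosedWalk → Prop
  | rotate (c c' : G.ClosedWalk) (d : Dart E) (l : List (Dart E))
      (hc : c.darts = d :: l) (hc' : c'.darts = l ++ [d]) : ElementaryHomotopy c c'
  | spur (c c' : G.ClosedWalk) (d : Dart E) (l₁ l₂ : List (Dart E)) (hb : c.base = c'.base)
      (hc : c.darts = l₁ ++ l₂) (hc' : c'.darts = l₁ ++ [d, d.rev] ++ l₂) :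
      ElementaryHomotopy c c'
  | face (c c' : G.ClosedWalk) (d : Dart E) (l₁ l₂ : List (Dart E)) (hb : c.base = c'.base)
      (hc : c.darts = l₁ ++ l₂) (hc' : c'.darts = l₁ ++ R.faceWalk d ++ l₂) :
      ElementaryHomotopy c c'

/-- Free homotopy of closed walks on the surface: the equivalence relation generated by the
elementary homotopies. -/
def FreelyHomotopic : G.ClosedWalk → G.ClosedWalk → Prop :=
  Relation.EqvGen R.ElementaryHomotopy

/-- `r` is the value of the marked length spectrum at the free homotopy class of `c`: the length of
a shortest closed walk freely homotopic to `c`. -/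
def IsMarkedLength (w : E → ℝ) (c : G.ClosedWalk) (r : ℝ) : Prop :=
  IsLeast {ℓ : ℝ | ∃ c' : G.ClosedWalk, R.FreelyHomotopic c c' ∧ ℓ = c'.length w} r

lemma source_facePerm (d : Dart E) : G.source (R.facePerm d) = G.target d :=
  ((R.sameCycle_iff _ _).1 ⟨1, rfl⟩ : G.source d.rev = G.source (R.facePerm d)).symm

section Homology

/-- The boundary operator `∂₂ : C₂ → C₁`: a face is sent to the sum of the oriented edges on its
boundary, so that an edge gets the coefficient of the face on its one side minus the coefficient of
the face on its other side. -/
def boundary₂ (A : Type*) [CommRing A] : (R.Face → A) →ₗ[A] (E → A) where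
  toFun y e := y (R.faceOf (e, true)) - y (R.faceOf (e, false))
  map_add' x y := by ext; simp only [Pi.add_apply]; abel
  map_smul' a x := by ext; simp [mul_sub]

variable [Fintype E] (A : Type*) [CommRing A]

/-- The boundary of a boundary is zero. -/
lemma boundary₁_boundary₂ (y : R.Face → A) : G.boundary₁ A (R.boundary₂ A y) = 0 := by
  classical
  have key : ∑ d : Dart E, y (R.faceOf d) • (Pi.single (G.target d) (1 : A) : V → A) =
      ∑ d : Dart E, y (R.faceOf d) • (Pi.single (G.source d) (1 : A) : V → A) := by
    rw [← Equiv.sum_comp R.facePerm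
      fun d => y (R.faceOf d) • (Pi.single (G.source d) (1 : A) : V → A)]
    refine Finset.sum_congr rfl fun d _ => ?_
    have : R.faceOf (R.facePerm d) = R.faceOf d :=
      Quotient.sound (Equiv.Perm.SameCycle.symm ⟨1, rfl⟩)
    rw [this, source_facePerm]
  have h2 : G.boundary₁ A (R.boundary₂ A y) =
      ∑ d : Dart E, y (R.faceOf d) • (Pi.single (G.target d) (1 : A) : V → A) -
        ∑ d : Dart E, y (R.faceOf d) • (Pi.single (G.source d) (1 : A) : V → A) := by
    rw [← Finset.sum_sub_distrib, Fintype.sum_prod_type, boundary₁,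
      Fintype.linearCombination_apply]
    refine Finset.sum_congr rfl fun e _ => ?_
    ext v
    simp only [boundary₂, Fintype.sum_bool, target, source, Dart.rev, LinearMap.coe_mk,
      AddHom.coe_mk, Pi.smul_apply, Pi.sub_apply, Pi.add_apply, smul_eq_mul, Bool.not_true,
      Bool.not_false, if_true, Bool.false_eq_true, if_false]
    ring
  rw [h2, key, sub_self]

/-- The first homology group `H₁ = ker ∂₁ / im ∂₂` with coefficients in `A`. -/
abbrev H₁ : Type _ :=
  ↥(G.cycles A) ⧸ (LinearMap.range (R.boundary₂ A)).comap (G.cycles A).subtype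

/-- The homology class of a 1-cycle. -/
noncomputable abbrev cls (x : G.cycles A) : R.H₁ A := Submodule.Quotient.mk x

/-- Integral chains as real chains. -/
def castChain (X : Type*) : (X → ℤ) →ₛₗ[Int.castRingHom ℝ] (X → ℝ) where
  toFun x i := (x i : ℝ)
  map_add' x y := by ext; simp
  map_smul' n x := by ext; simp

lemma boundary₁_castChain (x : E → ℤ) :
    G.boundary₁ ℝ (castChain E x) = castChain V (G.boundary₁ ℤ x) := by
  classical
  ext v
  simp [boundary₁, castChain, Fintype.linearCombination_apply, Pi.single_apply]

/-- Integral cycles as real cycles. -/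
noncomputable def castCycle : G.cycles ℤ →ₛₗ[Int.castRingHom ℝ] G.cycles ℝ :=
  ((castChain E).comp (G.cycles ℤ).subtype).codRestrict (G.cycles ℝ) fun x => by
    have hx : G.boundary₁ ℤ x.1 = 0 := x.2
    simp [LinearMap.mem_ker, boundary₁_castChain, hx]

/-- The natural map `H₁(T; ℤ) → H₁(T; ℝ)`. -/
noncomputable def toReal : R.H₁ ℤ →ₛₗ[Int.castRingHom ℝ] R.H₁ ℝ :=
  Submodule.mapQ _ _ castCycle <| by
    rintro x ⟨y, hy⟩
    refine ⟨castChain R.Face y, ?_⟩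
    have hy' : R.boundary₂ ℤ y = x.1 := hy
    change R.boundary₂ ℝ (castChain R.Face y) = castChain E x.1
    rw [← hy']
    ext e
    simp [boundary₂, castChain]

/-- `bR` is the real basis of `H₁(T; ℝ)` given by an integral basis `bZ` of `H₁(T; ℤ)`. -/
def IsIntegralBasis (bZ : Module.Basis (Fin 2) ℤ (R.H₁ ℤ))
    (bR : Module.Basis (Fin 2) ℝ (R.H₁ ℝ)) : Prop :=
  ∀ i, bR i = R.toReal (bZ i)

/-- The vectors `[c] / w(c)` over all simple cycles `c`. -/
noncomputable def normalizedSimpleCycles (w : E → ℝ) : Set (R.H₁ ℝ) :=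
  {p | ∃ c : G.ClosedWalk, c.IsSimpleCycle ∧ p = (c.length w)⁻¹ • R.cls ℝ (c.cycle ℝ)}

end Homology

end RotationSystem

end Multigraph

/-! The norm is the stable norm: the infimum of the weights `∑ |x e| * w e` over the real cycles `x`
in a class. It is a quotient seminorm, and it is definite because a linear functional on cycles is
bounded by a multiple of the weight. The work lies in comparing real cycles with integral cycles,
closed walks and simple cycles.

Real to integral: a real cycle homologous to an integral one `x` has the form `x + ∂₂ y`. Rounding
`y` to `⌊y + t⌋` weakly keeps the sign of each coefficient, and each coefficient averages over `t`
to its old value, so some `t` does not increase the weight (`exists_int_potential`).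

Integral cycles to closed walks: every cycle splits without cancellation into simple cycles
(`cycle_induction`). The intersection form is nondegenerate on homology, which has rank two, so it
is a nonzero multiple of the determinant. If two of the simple cycles cross homologically, every
other one that is not null-homologous meets one of them, and all of these can be joined. If no two
cross, the nonzero classes, being primitive, agree up to sign, and a multiple of the shortest cycle
suffices (`IsTorus.exists_closedWalk_of_list`).

Homology to homotopy: the fundamental group of the torus is commutative. This is shown
combinatorially (`IsTorus.exists_gauge_commute`): a tree and a cotree leave at most two edges, whose
four orientations follow each other in the cyclic order `a b a⁻¹ b⁻¹`. Applied to words of oriented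
edges, it makes the word of a closed walk, up to conjugation, a function of its homology class.

Unit ball: the decomposition into simple cycles writes a real cycle as its weight times a convex
combination of points `[c] / w(c)`. Extreme points thus come from simple cycles, which have integral
classes and pairwise intersection numbers at most `|V|`. Modulo a prime `q` with `|V| < q ≤ 2|V|`,
extreme points of equal slope have intersection number zero and agree up to sign, so there are at
most `2(q + 1)` of them. -/

/-! ### Cycles of a permutation of a finite type -/

section Perm

/-- Every permutation of a finite type admits a representative of each cycle, and each element a
position on its cycle, counted from the representative. -/
lemma Equiv.Perm.exists_cycle_rank {D : Type*} [Finite D] (σ : Equiv.Perm D) :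
    ∃ (rep : D → D) (r : D → ℕ), (∀ a b, σ.SameCycle a b → rep a = rep b) ∧
      (∀ d, σ^[r d] (rep d) = d) ∧
      (∀ d, r d < Function.minimalPeriod σ (rep d)) ∧
      ∀ d, r (σ d) = r d + 1 ∨
        (r (σ d) = 0 ∧ r d + 1 = Function.minimalPeriod σ (rep d)) := by
  classical
  let s := Equiv.Perm.SameCycle.setoid σ
  let rep : D → D := fun d => (Quotient.mk s d).out
  have hrep : ∀ d, σ.SameCycle (rep d) d := fun d => Quotient.mk_out (s := s) d
  have hcongr : ∀ a b, σ.SameCycle a b → rep a = rep b := fun a b h => by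
    have : Quotient.mk s a = Quotient.mk s b := Quotient.sound h
    simp only [rep, this]
  have hex : ∀ d, ∃ k : ℕ, k < Function.minimalPeriod σ (rep d) ∧ σ^[k] (rep d) = d := by
    intro d
    obtain ⟨i, -, hi⟩ := (hrep d).exists_pow_eq'
    rw [Equiv.Perm.coe_pow] at hi
    refine ⟨i % Function.minimalPeriod σ (rep d), Nat.mod_lt _ ?_, ?_⟩
    · exact Function.minimalPeriod_pos_of_mem_periodicPts
        (σ.injective.mem_periodicPts _)
    · rw [Function.iterate_mod_minimalPeriod_eq, hi]
  choose r hr1 hr2 using hex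
  refine ⟨rep, r, hcongr, hr2, hr1, fun d => ?_⟩
  have hd : rep (σ d) = rep d := hcongr _ _ (Equiv.Perm.SameCycle.symm ⟨1, rfl⟩)
  have h1 : σ^[r d + 1] (rep d) = σ d := by rw [Function.iterate_succ_apply', hr2]
  have h2 : σ^[r (σ d)] (rep d) = σ d := by rw [← hd, hr2]
  have hlt := hr1 (σ d)
  rw [hd] at hlt
  by_cases hc : r d + 1 < Function.minimalPeriod σ (rep d)
  · left
    exact (Function.iterate_injOn_Iio_minimalPeriod (f := σ) (x := rep d)) hlt hc (h2.trans h1.symm)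
  · right
    have heq : r d + 1 = Function.minimalPeriod σ (rep d) := by have := hr1 d; omega
    refine ⟨?_, heq⟩
    have h3 : σ^[0] (rep d) = σ d := by
      rw [← h1, heq, Function.iterate_minimalPeriod]; rfl
    exact (Function.iterate_injOn_Iio_minimalPeriod (f := σ) (x := rep d)) hlt
      (show 0 < _ by omega) (h2.trans h3.symm)

/-- A group-valued function on a finite type whose products over the cycles of a permutation are
trivial is a difference of a potential. -/
lemma Equiv.Perm.exists_potential {D Γ : Type*} [Finite D] [Group Γ] (φ : Equiv.Perm D) (g : D → Γ)
    (hg : ∀ d, ((List.range (Function.minimalPeriod φ d)).map fun k => g (φ^[k] d)).prod = 1) :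
    ∃ h : D → Γ, ∀ d, h (φ d) = h d * g d := by
  obtain ⟨rep, r, h1, h2, h3, h4⟩ := φ.exists_cycle_rank
  refine ⟨fun d => ((List.range (r d)).map fun k => g (φ^[k] (rep d))).prod, fun d => ?_⟩
  have hd : rep (φ d) = rep d := h1 _ _ (Equiv.Perm.SameCycle.symm ⟨1, rfl⟩)
  have key : ((List.range (r d + 1)).map fun k => g (φ^[k] (rep d))).prod =
      ((List.range (r d)).map fun k => g (φ^[k] (rep d))).prod * g d := by
    rw [List.range_succ, List.map_append, List.prod_append]
    simp [h2]
  rcases h4 d with h | ⟨h, h'⟩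
  · simp only [hd, h, key]
  · simp only [h]
    rw [← key, h', hg]
    simp

lemma Equiv.Perm.apply_eq_of_sameCycle {D B : Type*} (σ : Equiv.Perm D) (f : D → B)
    (hf : ∀ d, f (σ d) = f d) {a b : D} (hab : σ.SameCycle a b) : f a = f b := by
  obtain ⟨i, rfl⟩ := hab
  have : ∀ n : ℕ, ∀ a, f ((σ ^ n) a) = f a := by
    intro n; induction n with
    | zero => intro a; rfl
    | succ n ih => intro a; rw [pow_succ', Equiv.Perm.mul_apply, hf, ih]
  obtain ⟨n, rfl | rfl⟩ := i.eq_nat_or_neg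
  · rw [zpow_natCast, this]
  · rw [zpow_neg, zpow_natCast, ← this n ((σ ^ n)⁻¹ a)]; simp

/-- Composing a permutation with the transposition of two elements of distinct cycles merges these
cycles. -/
lemma Equiv.Perm.sameCycle_mul_swap {D : Type*} [Finite D] [DecidableEq D] (π : Equiv.Perm D)
    {x y : D} (hxy : ¬ π.SameCycle x y) :
    (π * Equiv.swap x y).SameCycle x y ∧
      ∀ a b, π.SameCycle a b → (π * Equiv.swap x y).SameCycle a b := by
  set π' := π * Equiv.swap x y with hπ'
  have hne : ∀ a, a ≠ x → a ≠ y → π' a = π a := fun a h1 h2 => by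
    simp [hπ', Equiv.swap_apply_of_ne_of_ne h1 h2]
  have hstep : ∀ a, π'.SameCycle a (π' a) := fun a => ⟨1, rfl⟩
  -- Away from `x` and `y` the two permutations agree. A `π`-orbit followed until it first arrives
  -- at `x` cannot pass through `y`, so it is also a `π'`-orbit.
  have claim : ∀ (x y : D), ¬ π.SameCycle x y → (∀ a, a ≠ x → a ≠ y → π' a = π a) →
      ∀ (k : ℕ) (a : D), (π ^ k) a = x → π'.SameCycle a x := by
    intro x y hxy hne k
    induction k with
    | zero => intro a ha; have : a = x := ha; rw [this]
    | succ k ih =>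
      intro a ha
      by_cases hax : a = x
      · rw [hax]
      · have hay : a ≠ y := fun h => hxy (Equiv.Perm.SameCycle.symm ⟨(k + 1 : ℕ), by
          rw [zpow_natCast, ← h, ha]⟩)
        have h1 := hstep a
        rw [hne a hax hay] at h1
        exact h1.trans (ih (π a) (by rw [← ha, pow_succ]; rfl))
  have hx : ∀ a, π.SameCycle a x → π'.SameCycle a x := fun a h => by
    obtain ⟨i, -, hi⟩ := h.exists_pow_eq'
    exact claim x y hxy hne i a hi
  have hy : ∀ a, π.SameCycle a y → π'.SameCycle a y := fun a h => by
    obtain ⟨i, -, hi⟩ := h.exists_pow_eq'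
    exact claim y x (fun h => hxy h.symm) (fun a h1 h2 => hne a h2 h1) i a hi
  have hxy' : π'.SameCycle x y := by
    have h1 := hstep x
    -- From `x` the new permutation jumps into the old cycle of `y`, whose elements all lead to `y`.
    have h2 : π' x = π y := by simp [hπ']
    rw [h2] at h1
    exact h1.trans (hy _ (Equiv.Perm.SameCycle.symm ⟨1, rfl⟩))
  refine ⟨hxy', fun a b hab => ?_⟩
  by_cases hax : π.SameCycle a x
  · exact (hx a hax).trans (hx b (hab.symm.trans hax)).symm
  by_cases hay : π.SameCycle a y
  · exact (hy a hay).trans (hy b (hab.symm.trans hay)).symm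
  obtain ⟨i, -, hi⟩ := hab.exists_pow_eq'
  have : ∀ k : ℕ, π'.SameCycle a ((π ^ k) a) := by
    intro k
    induction k with
    | zero => exact Equiv.Perm.SameCycle.refl _ _
    | succ k ih =>
      refine ih.trans ?_
      have h1 := hstep ((π ^ k) a)
      rw [hne] at h1
      · rwa [pow_succ']
      · exact fun h => hax ⟨k, by simpa using h⟩
      · exact fun h => hay ⟨k, by simpa using h⟩
  rw [← hi]; exact this i

end Perm

/-! ### Coefficients of chains on oriented edges -/

namespace Dart

variable {E : Type*}

@[simp] lemma rev_rev (d : Dart E) : d.rev.rev = d := by simp [rev]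
@[simp] lemma rev_fst (d : Dart E) : d.rev.1 = d.1 := rfl
lemma rev_ne (d : Dart E) : d.rev ≠ d := by
  obtain ⟨e, b⟩ := d; cases b <;> simp [rev]
lemma rev_injective : Function.Injective (rev : Dart E → Dart E) :=
  Function.Involutive.injective rev_rev
lemma eq_or_eq_rev_of_fst_eq {a b : Dart E} (h : a.1 = b.1) : a = b ∨ a = b.rev := by
  obtain ⟨e, s⟩ := a; obtain ⟨e', s'⟩ := b
  obtain rfl : e = e' := h
  cases s <;> cases s' <;> simp [rev]

/-- The coefficient of a 1-chain on an oriented edge. -/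
def coeff {A : Type*} [CommRing A] (x : E → A) (d : Dart E) : A := if d.2 then x d.1 else - x d.1

section
variable {A : Type*} [CommRing A]

lemma coeff_rev (x : E → A) (d : Dart E) : coeff x d.rev = - coeff x d := by
  obtain ⟨e, b⟩ := d; cases b <;> simp [rev, coeff]
@[simp] lemma coeff_true (x : E → A) (e : E) : coeff x (e, true) = x e := rfl
@[simp] lemma coeff_false (x : E → A) (e : E) : coeff x (e, false) = - x e := rfl
@[simp] lemma coeff_add (x y : E → A) (d : Dart E) : coeff (x + y) d = coeff x d + coeff y d := by
  obtain ⟨e, b⟩ := d; cases b <;> simp [coeff]; ring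
@[simp] lemma coeff_sub (x y : E → A) (d : Dart E) : coeff (x - y) d = coeff x d - coeff y d := by
  obtain ⟨e, b⟩ := d; cases b
  · simp [coeff]; ring
  · simp [coeff]
@[simp] lemma coeff_smul (a : A) (y : E → A) (d : Dart E) : coeff (a • y) d = a * coeff y d := by
  obtain ⟨e, b⟩ := d; cases b <;> simp [coeff]
@[simp] lemma coeff_zero (d : Dart E) : coeff (0 : E → A) d = 0 := by simp [coeff]
lemma ext_coeff {x y : E → A} (h : ∀ d, coeff x d = coeff y d) : x = y := by
  ext e; simpa using h (e, true)
open Classical in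
lemma coeff_chain (d a : Dart E) :
    coeff (d.chain A) a = if a = d then 1 else if a = d.rev then -1 else 0 := by
  obtain ⟨e, b⟩ := d; obtain ⟨e', b'⟩ := a
  by_cases h : e' = e
  · subst h; cases b <;> cases b' <;> simp [coeff, chain, rev]
  · simp [coeff, chain, rev, h]
open Classical in
lemma coeff_sum_chain (l : List (Dart E)) (a : Dart E) :
    coeff ((l.map (chain A)).sum) a = (l.count a : A) - l.count a.rev := by
  induction l with
  | nil => simp
  | cons d l ih =>
    rw [List.map_cons, List.sum_cons, coeff_add, ih, coeff_chain, List.count_cons, List.count_cons]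
    by_cases h : a = d
    · subst h; simp [(rev_ne a).symm]; ring
    · by_cases h' : a = d.rev
      · subst h'; simp [rev_ne, (rev_ne d).symm]; ring
      · have h'' : ¬ d = a.rev := fun h'' => h' (by rw [h'', rev_rev])
        simp [h, h', h'', Ne.symm h]
lemma chain_rev (d : Dart E) : d.rev.chain A = - d.chain A := by
  obtain ⟨e, b⟩ := d; cases b <;> simp [chain, rev, Pi.single_neg]

lemma sum_dart [Fintype E] (f : Dart E → A) : ∑ d, f d = ∑ e, (f (e, true) + f (e, false)) := by
  simp [Fintype.sum_prod_type]
end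
end Dart

/-! ### Walks, cycles and corners of a rotation system -/

namespace Multigraph

variable {V E : Type*} (G : Multigraph V E)

@[simp] lemma source_rev (d : Dart E) : G.source d.rev = G.target d := rfl
@[simp] lemma target_rev (d : Dart E) : G.target d.rev = G.source d := by simp [target]

lemma isWalk_append {u v : V} {l₁ l₂ : List (Dart E)} :
    G.IsWalk u v (l₁ ++ l₂) ↔ ∃ m, G.IsWalk u m l₁ ∧ G.IsWalk m v l₂ := by
  induction l₁ generalizing u with
  | nil => simp [IsWalk]
  | cons d l ih => simp [IsWalk, ih, and_assoc]

lemma IsWalk.append {G : Multigraph V E} {u m v : V} {l₁ l₂ : List (Dart E)}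
    (h₁ : G.IsWalk u m l₁) (h₂ : G.IsWalk m v l₂) : G.IsWalk u v (l₁ ++ l₂) :=
  G.isWalk_append.2 ⟨m, h₁, h₂⟩

lemma isWalk_singleton (d : Dart E) : G.IsWalk (G.source d) (G.target d) [d] := ⟨rfl, rfl⟩

/-- The reverse of a walk. -/
def revWalk (l : List (Dart E)) : List (Dart E) := (l.map Dart.rev).reverse

@[simp] lemma revWalk_cons (d : Dart E) (l : List (Dart E)) :
    revWalk (d :: l) = revWalk l ++ [d.rev] := by simp [revWalk]
@[simp] lemma revWalk_nil : revWalk ([] : List (Dart E)) = [] := rfl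
@[simp] lemma revWalk_revWalk (l : List (Dart E)) : revWalk (revWalk l) = l := by
  simp [revWalk, Function.comp_def]

lemma IsWalk.rev {G : Multigraph V E} {u v : V} {l : List (Dart E)} (h : G.IsWalk u v l) :
    G.IsWalk v u (revWalk l) := by
  induction l generalizing u with
  | nil => exact Eq.symm h
  | cons d l ih =>
    obtain ⟨rfl, h2⟩ := h
    rw [revWalk_cons]
    exact (ih h2).append ⟨rfl, by simp [IsWalk]⟩

lemma sum_chain_revWalk (A : Type*) [CommRing A] (l : List (Dart E)) :
    ((revWalk l).map (Dart.chain A)).sum = - (l.map (Dart.chain A)).sum := by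
  induction l with
  | nil => simp
  | cons d l ih => simp [ih, Dart.chain_rev]

section
variable [Fintype E] {A : Type*} [CommRing A]

open Classical in
lemma boundary₁_apply (x : E → A) (v : V) :
    G.boundary₁ A x v = - ∑ d : Dart E, if G.source d = v then Dart.coeff x d else 0 := by
  rw [Fintype.sum_prod_type, boundary₁, Fintype.linearCombination_apply, Finset.sum_apply,
    ← Finset.sum_neg_distrib]
  refine Finset.sum_congr rfl fun e _ => ?_
  simp only [Fintype.sum_bool, source, Dart.coeff, Pi.smul_apply, Pi.sub_apply, Pi.single_apply,
    smul_eq_mul, if_true, Bool.false_eq_true, if_false, eq_comm (a := v)]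
  split_ifs <;> ring

open Classical in
lemma mem_cycles_iff (x : E → A) : x ∈ G.cycles A ↔
    ∀ v, (∑ d : Dart E, if G.source d = v then Dart.coeff x d else 0) = 0 := by
  rw [LinearMap.mem_ker, funext_iff]
  simp [boundary₁_apply]

/-- Functions of the source integrate to zero against a cycle. -/
lemma sum_coeff_mul_source {x : E → A} (hx : x ∈ G.cycles A) (h : V → A) :
    ∑ d : Dart E, Dart.coeff x d * h (G.source d) = 0 := by
  classical
  let s := Finset.univ.image (G.source)
  have : ∀ d : Dart E, Dart.coeff x d * h (G.source d) =
      ∑ v ∈ s, h v * if G.source d = v then Dart.coeff x d else 0 := fun d => by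
    rw [Finset.sum_eq_single (G.source d)]
    · simp [mul_comm]
    · intro b _ hb; simp [hb.symm]
    · intro hd; exact absurd (Finset.mem_image_of_mem _ (Finset.mem_univ d)) hd
  simp_rw [this]
  rw [Finset.sum_comm]
  refine Finset.sum_eq_zero fun v _ => ?_
  rw [← Finset.mul_sum, (G.mem_cycles_iff x).1 hx v, mul_zero]
end

/-- A walk chosen between two vertices of a connected graph. -/
noncomputable def IsConnected.path {G : Multigraph V E} (h : G.IsConnected) (u v : V) :
    List (Dart E) := (h.2 u v).choose
lemma IsConnected.isWalk_path {G : Multigraph V E} (h : G.IsConnected) (u v : V) :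
    G.IsWalk u v (h.path u v) := (h.2 u v).choose_spec

namespace RotationSystem
variable {G} (R : G.RotationSystem)

@[simp] lemma facePerm_apply (d : Dart E) : R.facePerm d = R.rot d.rev := rfl
lemma source_rot (d : Dart E) : G.source (R.rot d) = G.source d :=
  ((R.sameCycle_iff _ _).1 ⟨1, rfl⟩ : G.source d = G.source (R.rot d)).symm
lemma faceOf_facePerm (d : Dart E) : R.faceOf (R.facePerm d) = R.faceOf d :=
  Quotient.sound (Equiv.Perm.SameCycle.symm ⟨1, rfl⟩)
lemma faceOf_rot (d : Dart E) : R.faceOf (R.rot d) = R.faceOf d.rev := by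
  have := R.faceOf_facePerm d.rev
  simpa using this
lemma faceOf_eq_iff (d d' : Dart E) : R.faceOf d = R.faceOf d' ↔ R.facePerm.SameCycle d d' :=
  Quotient.eq (r := Equiv.Perm.SameCycle.setoid R.facePerm)
lemma faceOf_surjective : Function.Surjective R.faceOf := Quotient.mk_surjective

/-- The corner after `d` at its source lies in the face of `d.rev`. Hence the boundary of `y`
records the jumps of `y` between successive corners at a vertex. -/
lemma coeff_boundary₂ {A : Type*} [CommRing A] (y : R.Face → A) (d : Dart E) :
    Dart.coeff (R.boundary₂ A y) d = y (R.faceOf d) - y (R.faceOf (R.rot d)) := by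
  rw [faceOf_rot]
  obtain ⟨e, b⟩ := d
  cases b <;> simp [Dart.coeff, boundary₂, Dart.rev]

/-- A function on the darts of a connected map that is invariant under the rotation and under
reversal is constant. -/
lemma eq_of_invariant (hG : G.IsConnected) {B : Type*} (f : Dart E → B)
    (hrot : ∀ d, f (R.rot d) = f d) (hrev : ∀ d : Dart E, f d.rev = f d) (a b : Dart E) :
    f a = f b := by
  have hcyc : ∀ a b, G.source a = G.source b → f a = f b := by
    intro a b hab
    exact R.rot.apply_eq_of_sameCycle f hrot ((R.sameCycle_iff _ _).2 hab)
  have : ∀ (l : List (Dart E)) (a b : Dart E), G.IsWalk (G.source a) (G.source b) l → f a = f b := by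
    intro l
    induction l with
    | nil => intro a b h; exact hcyc a b h
    | cons d l ih =>
      rintro a b ⟨h1, h2⟩
      rw [hcyc a d h1.symm, ← hrev d]
      exact ih d.rev b h2
  exact this _ _ _ (hG.isWalk_path _ _)

end RotationSystem
end Multigraph

/-! ### Forests encoded by permutations -/

/-- First visits of a nonempty set by a transitive permutation. -/
lemma Equiv.Perm.exists_firstVisit {D : Type*} [Finite D] (τ : Equiv.Perm D)
    (hτ : ∀ a b, τ.SameCycle a b) (M : Set D) (hM : M.Nonempty) :
    ∃ m : D → D, (∀ d, m d ∈ M) ∧ (∀ d ∈ M, m d = d) ∧ ∀ d, d ∉ M → m (τ d) = m d := by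
  classical
  obtain ⟨x, hx⟩ := hM
  have hex : ∀ d, ∃ k : ℕ, (τ ^ k) d ∈ M := fun d => by
    obtain ⟨i, -, hi⟩ := (hτ d x).exists_pow_eq'
    exact ⟨i, hi ▸ hx⟩
  refine ⟨fun d => (τ ^ Nat.find (hex d)) d, fun d => Nat.find_spec (hex d), fun d hd => ?_,
    fun d hd => ?_⟩
  · have : Nat.find (hex d) = 0 := (Nat.find_eq_zero _).2 hd
    simp [this]
  · have : Nat.find (hex d) = Nat.find (hex (τ d)) + 1 := by
      rw [Nat.find_eq_iff]
      refine ⟨?_, fun n hn h => ?_⟩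
      · rw [pow_succ]; exact Nat.find_spec (hex (τ d))
      · cases n with
        | zero => exact hd h
        | succ n =>
          refine Nat.find_min (hex (τ d)) (m := n) (by omega) ?_
          rw [pow_succ] at h; exact h
    simp only [this, pow_succ, Equiv.Perm.mul_apply]

/-- If functions that agree on the ends of the edges of `S` are constant, then `S` has at least
`|X| - 1` edges. -/
lemma card_le_card_add_one_of_connected {X E : Type*} [Finite X] (p q : E → X) (S : Finset E)
    (h : ∀ f : X → ℝ, (∀ e ∈ S, f (p e) = f (q e)) → ∀ x y, f x = f y) :
    Nat.card X ≤ S.card + 1 := by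
  classical
  have := Fintype.ofFinite X
  let L : (X → ℝ) →ₗ[ℝ] (S → ℝ) :=
    { toFun := fun f e => f (p e) - f (q e)
      map_add' := fun f g => by ext; simp; ring
      map_smul' := fun a f => by ext; simp [mul_sub] }
  -- By hypothesis only constants have zero differences along `S`; rank-nullity then gives the
  -- bound.
  have hker : LinearMap.ker L ≤ Submodule.span ℝ {fun _ => (1 : ℝ)} := by
    intro f hf
    have hf' : ∀ e ∈ S, f (p e) = f (q e) := fun e he =>
      sub_eq_zero.1 (congrFun (LinearMap.mem_ker.1 hf) ⟨e, he⟩)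
    rcases isEmpty_or_nonempty X with hX | ⟨⟨x⟩⟩
    · rw [Subsingleton.elim f 0]; exact Submodule.zero_mem _
    · exact Submodule.mem_span_singleton.2 ⟨f x, by ext y; simpa using h f hf' x y⟩
  have h1 : Module.finrank ℝ (LinearMap.ker L) ≤ 1 :=
    (Submodule.finrank_mono hker).trans ((finrank_span_le_card _).trans (by simp))
  have h2 := L.finrank_range_add_finrank_ker
  have h3 : Module.finrank ℝ (LinearMap.range L) ≤ S.card := by
    simpa using Submodule.finrank_le (LinearMap.range L)
  rw [Module.finrank_fintype_fun_eq_card, ← Nat.card_eq_fintype_card] at h2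
  omega

namespace Dart
variable {E : Type*}

open Classical in
/-- Reversal of the oriented edges whose edge lies in `T`. -/
noncomputable def revOn (T : Finset E) : Equiv.Perm (Dart E) :=
  Function.Involutive.toPerm (fun d => if d.1 ∈ T then d.rev else d) (fun d => by
    by_cases h : d.1 ∈ T <;> simp [h])

lemma revOn_of_mem {T : Finset E} {d : Dart E} (h : d.1 ∈ T) : revOn T d = d.rev := if_pos h
lemma revOn_of_notMem {T : Finset E} {d : Dart E} (h : d.1 ∉ T) : revOn T d = d := if_neg h

-- Adding an edge multiplies by a transposition, the form in which `Equiv.Perm.sameCycle_mul_swap`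
-- merges two cycles.
open Classical in
lemma revOn_insert {T : Finset E} {d : Dart E} (h : d.1 ∉ T) :
    revOn (insert d.1 T) = revOn T * Equiv.swap d d.rev := by
  ext1 a
  rw [Equiv.Perm.mul_apply]
  by_cases h1 : a = d
  · subst h1; rw [Equiv.swap_apply_left, revOn_of_mem (by simp), revOn_of_notMem (by simpa)]
  by_cases h2 : a = d.rev
  · subst h2; rw [Equiv.swap_apply_right, revOn_of_mem (by simp), revOn_of_notMem h, rev_rev]
  rw [Equiv.swap_apply_of_ne_of_ne h1 h2]
  have h3 : a.1 ≠ d.1 := fun h3 => (eq_or_eq_rev_of_fst_eq h3).elim h1 h2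
  by_cases ha : a.1 ∈ T
  · rw [revOn_of_mem ha, revOn_of_mem (by simp [ha])]
  · rw [revOn_of_notMem ha, revOn_of_notMem (by simp [ha, h3])]

/-- A maximal forest in `U` of the graph whose vertices are the cycles of `σ`, together with a gauge
transformation that makes a given group-valued function trivial on the forest. The forest is
described by its effect on the permutation `σ`. -/
lemma exists_forest [Finite E] (σ : Equiv.Perm (Dart E)) (U : Finset E) {Γ : Type*} [Group Γ]
    (g : Dart E → Γ) (hg : ∀ d, g d.rev = (g d)⁻¹) :
    ∃ T ⊆ U, (∀ d : Dart E, d.1 ∈ U → (σ * revOn T).SameCycle d d.rev) ∧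
      ∃ t : Dart E → Γ, (∀ d, t (σ d) = t d) ∧
        ∀ d : Dart E, d.1 ∈ T → t d * g d * (t d.rev)⁻¹ = 1 := by
  classical
  -- For a forest `T`, the cycles of `σ * revOn T` walk around its components. Acyclicity is not
  -- recorded, as it is never needed: what is kept is that the two orientations of each edge of `T`
  -- share a cycle, and that `g` can be gauged away on `T`.
  let P : Finset E → Prop := fun T => T ⊆ U ∧
    (∀ d : Dart E, d.1 ∈ T → (σ * revOn T).SameCycle d d.rev) ∧
      ∃ t : Dart E → Γ, (∀ d, t (σ d) = t d) ∧
        ∀ d : Dart E, d.1 ∈ T → t d * g d * (t d.rev)⁻¹ = 1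
  have h0 : P ∅ := ⟨by simp, by simp, fun _ => 1, by simp, by simp⟩
  obtain ⟨T, hT⟩ := (Set.toFinite {T | P T}).exists_maximal ⟨∅, h0⟩
  obtain ⟨hTU, h1, t, ht1, ht2⟩ := hT.prop
  refine ⟨T, hTU, fun d hd => ?_, t, ht1, ht2⟩
  by_cases hdT : d.1 ∈ T
  · exact h1 d hdT
  by_contra hcon
  have hmerge := (σ * revOn T).sameCycle_mul_swap hcon
  rw [mul_assoc, ← revOn_insert hdT] at hmerge
  obtain ⟨hm1, hm2⟩ := hmerge
  have hins : P (insert d.1 T) := by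
    refine ⟨Finset.insert_subset hd hTU, fun a ha => ?_, ?_⟩
    · rcases Finset.mem_insert.1 ha with h | h
      · rcases eq_or_eq_rev_of_fst_eq h with rfl | rfl
        · exact hm1
        · rw [rev_rev]; exact hm1.symm
      · exact hm2 _ _ (h1 a h)
    -- The new edge joins two different cycles. Multiplying `t` by `γ` on the one that contains
    -- `d.rev` trivializes `g` on `d` and changes nothing on the edges of `T`, which do not leave
    -- their cycle. By `hσ` the result is still constant on the cycles of `σ`.
    · set γ := t d * g d * (t d.rev)⁻¹ with hγ
      have hσ : ∀ a, (σ * revOn T).SameCycle d.rev (σ a) ↔ (σ * revOn T).SameCycle d.rev a := by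
        intro a
        have : (σ * revOn T).SameCycle a (σ a) := by
          by_cases ha : a.1 ∈ T
          · refine (h1 a ha).trans ⟨1, ?_⟩
            rw [zpow_one, Equiv.Perm.mul_apply, revOn_of_mem (by simpa), rev_rev]
          · refine ⟨1, ?_⟩
            rw [zpow_one, Equiv.Perm.mul_apply, revOn_of_notMem ha]
        exact ⟨fun h => h.trans this.symm, fun h => h.trans this⟩
      refine ⟨fun a => if (σ * revOn T).SameCycle d.rev a then γ * t a else t a, fun a => ?_,
        fun a ha => ?_⟩
      · simp only [hσ, ht1]
      · have hd' : ¬ (σ * revOn T).SameCycle d.rev d := fun h => hcon h.symm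
        have hd'' : (σ * revOn T).SameCycle d.rev d.rev := Equiv.Perm.SameCycle.refl _ _
        rcases Finset.mem_insert.1 ha with h | h
        · rcases eq_or_eq_rev_of_fst_eq h with rfl | rfl
          · simp only [hd', hd'', if_true, if_false, hγ]; group
          · simp only [rev_rev, hd', hd'', if_true, if_false, hγ, hg]; group
        · have : (σ * revOn T).SameCycle d.rev a ↔ (σ * revOn T).SameCycle d.rev a.rev :=
            ⟨fun h' => h'.trans (h1 a h), fun h' => h'.trans (h1 a h).symm⟩
          by_cases hc : (σ * revOn T).SameCycle d.rev a
          · simp only [hc, this.1 hc, if_true]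
            have := ht2 a h
            calc γ * t a * g a * (γ * t a.rev)⁻¹ = γ * (t a * g a * (t a.rev)⁻¹) * γ⁻¹ := by group
              _ = 1 := by rw [this]; group
          · simp only [hc, (not_congr this).1 hc, if_false]
            exact ht2 a h
  exact hdT (hT.le_of_ge hins (Finset.subset_insert _ _) (Finset.mem_insert_self _ _))

end Dart

/-! ### Tree and cotree: flat connections on a torus commute -/

/-- A self-map of four points `a`, `a'`, `b`, `b'` without proper closed subset, which stays so when
it is composed with the exchange of `a`, `a'` and of `b`, `b'`, permutes the four points
cyclically with `a` opposite to `a'`. -/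
lemma cyclic_of_no_closed_subset {D : Type*} {a a' b b' : D} (haa : a ≠ a')
    (hab : a ≠ b) (hab' : a ≠ b') (ha'b : a' ≠ b) (ha'b' : a' ≠ b') (μ : D → D)
    (hμ : ∀ x, μ x = a ∨ μ x = a' ∨ μ x = b ∨ μ x = b')
    (h1 : ∀ Y : Set D, Y.Nonempty → Y ⊆ {a, a', b, b'} → (∀ y ∈ Y, μ y ∈ Y) → {a, a', b, b'} ⊆ Y)
    (h2 : μ a ≠ a' ∧ μ a' ≠ a ∧ μ b ≠ b' ∧ μ b' ≠ b) :
    (μ a = b ∧ μ b = a' ∧ μ a' = b' ∧ μ b' = a) ∨ (μ a = b' ∧ μ b' = a' ∧ μ a' = b ∧ μ b = a) := by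
  have k1 : ∀ x, (x = a ∨ x = a' ∨ x = b ∨ x = b') → μ x ≠ x := by
    intro x hx h
    have := h1 {x} ⟨x, rfl⟩ (by simpa using hx) (by simpa using h)
    have ha : a = x := this (by simp)
    have hb : b = x := this (by simp)
    exact hab (ha.trans hb.symm)
  have k2 : ∀ x y, (x = a ∨ x = a') → (y = b ∨ y = b') → μ x = y → μ y ≠ x := by
    intro x y hx hy hxy hyx
    have := h1 {x, y} ⟨x, by simp⟩ (by
        rintro z (rfl | rfl)
        · rcases hx with h | h <;> simp [h]
        · rcases hy with h | h <;> simp [h])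
      (by
        rintro z (rfl | rfl)
        · exact Or.inr hxy
        · exact Or.inl hyx)
    have ha : a = x ∨ a = y := this (by simp)
    have ha' : a' = x ∨ a' = y := this (by simp)
    clear this h1 hμ h2
    grind
  have m1 := k2 a b (Or.inl rfl) (Or.inl rfl)
  have m2 := k2 a b' (Or.inl rfl) (Or.inr rfl)
  have m3 := k2 a' b (Or.inr rfl) (Or.inl rfl)
  have m4 := k2 a' b' (Or.inr rfl) (Or.inr rfl)
  have e1 : μ a = b ∨ μ a = b' := by
    rcases hμ a with h | h | h | h
    exacts [absurd h (k1 a (by simp)), absurd h h2.1, Or.inl h, Or.inr h]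
  have e2 : μ a' = b ∨ μ a' = b' := by
    rcases hμ a' with h | h | h | h
    exacts [absurd h h2.2.1, absurd h (k1 a' (by simp)), Or.inl h, Or.inr h]
  have e3 : μ b = a ∨ μ b = a' := by
    rcases hμ b with h | h | h | h
    exacts [Or.inl h, Or.inr h, absurd h (k1 b (by simp)), absurd h h2.2.2.1]
  have e4 : μ b' = a ∨ μ b' = a' := by
    rcases hμ b' with h | h | h | h
    exacts [Or.inl h, Or.inr h, absurd h h2.2.2.2, absurd h (k1 b' (by simp))]
  clear h1 h2 hμ k1 k2
  rcases e1 with e1 | e1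
  · have e3' := e3.resolve_left (m1 e1)
    have e2' := e2.resolve_left (fun h => m3 h e3')
    exact Or.inl ⟨e1, e3', e2', e4.resolve_right (m4 e2')⟩
  · have e4' := e4.resolve_left (m2 e1)
    have e2' := e2.resolve_right (fun h => m4 h e4')
    exact Or.inr ⟨e1, e4', e2', e3.resolve_right (m3 e2')⟩

/-- To be used for the four values of a corner function on the orientations of the two edges outside
tree and cotree. -/
lemma commute_of_mem_four {Γ : Type*} [Group Γ] {x z : Γ} (h : Commute x z) {u v : Γ}
    (hu : u = 1 ∨ u = x ∨ u = x * z ∨ u = z) (hv : v = 1 ∨ v = x ∨ v = x * z ∨ v = z) :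
    Commute u v := by
  have key : ∀ w, Commute x w → Commute z w → Commute u w := by
    intro w h1 h2
    rcases hu with rfl | rfl | rfl | rfl
    exacts [Commute.one_left _, h1, h1.mul_left h2, h2]
  rcases hv with rfl | rfl | rfl | rfl
  · exact Commute.one_right _
  · exact key _ (Commute.refl _) h.symm
  · exact (key _ (Commute.refl _) h.symm).mul_right (key _ h (Commute.refl _))
  · exact key _ h (Commute.refl _)

namespace Multigraph.RotationSystem
open Dart
variable {V E : Type*} {G : Multigraph V E} (R : G.RotationSystem)

instance [Finite E] : Finite R.Face := inferInstanceAs (Finite (Quotient _))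

/-- Without edges the Euler characteristic would be at least `|V| > 0`. -/
lemma IsTorus.nonempty_edge [Finite V] [Finite E] {R : G.RotationSystem} (hT : R.IsTorus) :
    Nonempty E := by
  by_contra h
  rw [not_nonempty_iff] at h
  have := hT.1.1
  have h1 : Nat.card E = 0 := Nat.card_of_isEmpty
  have h2 : 0 < Nat.card V := Nat.card_pos
  have h3 := hT.2
  omega

lemma source_surjective (hG : G.IsConnected) [Nonempty E] : Function.Surjective G.source := by
  intro v
  obtain ⟨e⟩ := ‹Nonempty E›
  have h := hG.isWalk_path v (G.source (e, true))
  cases hl : hG.path v (G.source (e, true)) with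
  | nil => rw [hl] at h; exact ⟨_, Eq.symm h⟩
  | cons d l => rw [hl] at h; exact ⟨d, h.1⟩

/-- On a torus, after a gauge transformation the values of a flat connection commute. -/
theorem IsTorus.exists_gauge_commute [Finite V] [Finite E] {R : G.RotationSystem} (hT : R.IsTorus)
    {Γ : Type*} [Group Γ] (g : Dart E → Γ) (hg : ∀ d, g d.rev = (g d)⁻¹)
    (hflat : ∀ d, ((R.faceWalk d).map g).prod = 1) :
    ∃ t : V → Γ, ∀ d d' : Dart E, Commute (t (G.source d) * g d * (t (G.target d))⁻¹)
      (t (G.source d') * g d' * (t (G.target d'))⁻¹) := by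
  classical
  have := Fintype.ofFinite E
  have hE := hT.nonempty_edge
  set σ := R.rot with hσ
  set φ := R.facePerm with hφ
  have hφσ : ∀ d, φ d = σ d.rev := fun d => rfl
  -- Flatness turns `g` into the difference of a potential along each face.
  obtain ⟨h, hh⟩ := φ.exists_potential g (fun d => by
    have := hflat d
    rwa [faceWalk, List.map_map] at this)
  -- `T` plays the role of a spanning tree, and `τ` that of the walk around it, which meets every
  -- oriented edge (`hτ`).
  obtain ⟨T, -, hT1, t, ht1, ht2⟩ := exists_forest σ Finset.univ g hg
  set τ := σ * revOn T with hτdef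
  have hτT : ∀ d : Dart E, d.1 ∈ T → τ d = φ d := fun d hd => by
    rw [hτdef, Equiv.Perm.mul_apply, revOn_of_mem hd, hφσ]
  have hτN : ∀ d : Dart E, d.1 ∉ T → τ d = σ d := fun d hd => by
    rw [hτdef, Equiv.Perm.mul_apply, revOn_of_notMem hd]
  have hτ : ∀ a b, τ.SameCycle a b := by
    intro a b
    have := R.eq_of_invariant hT.1 (fun d => Quotient.mk (Equiv.Perm.SameCycle.setoid τ) d) ?_ ?_ a b
    · exact Quotient.exact this
    · intro d
      refine Quotient.sound ?_
      change τ.SameCycle (σ d) d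
      by_cases hd : d.1 ∈ T
      · refine Equiv.Perm.SameCycle.trans (Equiv.Perm.SameCycle.symm ⟨1, ?_⟩)
          (hT1 d (Finset.mem_univ _)).symm
        rw [zpow_one, hτT _ (by simpa), hφσ, rev_rev]
      · exact Equiv.Perm.SameCycle.symm ⟨1, by rw [zpow_one, hτN _ hd]⟩
    · intro d
      exact Quotient.sound (hT1 d (Finset.mem_univ _)).symm
  -- At each corner, compare the vertex gauge `t` with the face potential `h`. The variation of `K₀`
  -- along a face is the gauged connection, which is trivial on `T`.
  let K₀ : Dart E → Γ := fun d => t d * (h d)⁻¹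
  have hK₀ : ∀ d, K₀ d * (K₀ (φ d))⁻¹ = t d * g d * (t d.rev)⁻¹ := fun d => by
    simp only [K₀, hh]
    rw [hφσ, ht1]
    group
  have hquad₀ : ∀ d : Dart E, K₀ d * (K₀ (φ d))⁻¹ * (K₀ d.rev * (K₀ (σ d))⁻¹) = 1 := fun d => by
    have h1 := hK₀ d.rev
    rw [hφσ, rev_rev] at h1
    rw [hK₀, h1, hg]
    group
  -- The same construction in the dual graph, with the edges outside `T`: the vertices are now the
  -- cycles of `φ`, that is, the faces. The gauge `s` is constant on faces, so passing to `K` keeps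
  -- the variation along faces, while `K` also becomes invariant under `τ` on the edges of `C`.
  obtain ⟨C, hCT, hC1, s, hs1, hs2⟩ := exists_forest φ Tᶜ (fun d => (K₀ d)⁻¹ * K₀ (σ d)) (fun d => by
    have h1 := hquad₀ d
    rw [← hφσ]
    have h2 : K₀ d.rev = K₀ (φ d) * (K₀ d)⁻¹ * K₀ (σ d) := by
      rw [mul_eq_one_iff_eq_inv] at h1
      have h3 := congrArg (fun z => z⁻¹ * K₀ (σ d)) h1
      simp only [mul_inv_rev, inv_inv] at h3
      rw [h3]; group
    rw [h2]; group)
  have hCT' : ∀ e ∈ C, e ∉ T := fun e he => Finset.mem_compl.1 (hCT he)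
  let K : Dart E → Γ := fun d => K₀ d * (s d)⁻¹
  have hK : ∀ d, K d * (K (φ d))⁻¹ = t d * g d * (t d.rev)⁻¹ := fun d => by
    rw [← hK₀ d]; simp only [K]; rw [hs1]; group
  have hKτ : ∀ d : Dart E, (d.1 ∈ T ∨ d.1 ∈ C) → K (τ d) = K d := by
    rintro d (hd | hd)
    · have h1 := hK d
      rw [ht2 d hd] at h1
      rw [hτT d hd, mul_inv_eq_one.1 h1]
    · rw [hτN d (hCT' _ hd)]
      have h1 := hs2 d hd
      have h2 : s (σ d) = s d.rev := by rw [← hs1 d.rev, hφσ, rev_rev]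
      simp only [K, h2]
      rw [mul_inv_eq_one] at h1
      rw [← h1]
      group
  have hquad : ∀ d : Dart E, K d * (K (σ d.rev))⁻¹ * (K d.rev * (K (σ d))⁻¹) = 1 := fun d => by
    have h1 := hK d.rev
    rw [hφσ, rev_rev] at h1
    rw [← hφσ, hK, h1, hg]
    group
  -- The walk around the cotree. It agrees with `τ` on the edges of `T` and `C`, and with `τ` after
  -- reversal on the remaining ones.
  set τ' := φ * revOn C with hτ'def
  have hτ'C : ∀ d : Dart E, (d.1 ∈ T ∨ d.1 ∈ C) → τ' d = τ d := by
    rintro d (hd | hd)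
    · rw [hτT d hd, hτ'def, Equiv.Perm.mul_apply, revOn_of_notMem (fun h => hCT' _ h hd)]
    · rw [hτN d (hCT' _ hd), hτ'def, Equiv.Perm.mul_apply, revOn_of_mem hd, hφσ, rev_rev]
  have hτ'N : ∀ d : Dart E, d.1 ∉ T → d.1 ∉ C → τ' d = τ d.rev := fun d hd hd' => by
    rw [hτN _ (by simpa), hτ'def, Equiv.Perm.mul_apply, revOn_of_notMem hd', hφσ]
  have hτ' : ∀ a b, τ'.SameCycle a b := by
    intro a b
    refine Quotient.exact (s := Equiv.Perm.SameCycle.setoid τ')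
      (τ.apply_eq_of_sameCycle (fun d => Quotient.mk (Equiv.Perm.SameCycle.setoid τ') d) ?_ (hτ a b))
    intro d
    refine Quotient.sound ?_
    change τ'.SameCycle (τ d) d
    by_cases hd : d.1 ∈ T ∨ d.1 ∈ C
    · exact Equiv.Perm.SameCycle.symm ⟨1, by rw [zpow_one, hτ'C _ hd]⟩
    · push Not at hd
      refine Equiv.Perm.SameCycle.trans (Equiv.Perm.SameCycle.symm ⟨1, ?_⟩)
        (hC1 d (Finset.mem_compl.2 hd.1)).symm
      rw [zpow_one, hτ'N _ (by simpa using hd.1) (by simpa using hd.2), rev_rev]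
  have hcardT : Nat.card V ≤ T.card + 1 := by
    refine card_le_card_add_one_of_connected G.src G.tgt T fun f hf x y => ?_
    obtain ⟨a, rfl⟩ := source_surjective hT.1 x
    obtain ⟨b, rfl⟩ := source_surjective hT.1 y
    refine τ.apply_eq_of_sameCycle (fun d => f (G.source d)) (fun d => ?_) (hτ a b)
    by_cases hd : d.1 ∈ T
    · rw [hτT d hd]
      change f (G.source (R.facePerm d)) = _
      rw [source_facePerm]
      have := hf _ hd
      obtain ⟨e, b⟩ := d
      cases b
      · exact this
      · exact this.symm
    · rw [hτN d hd]
      change f (G.source (R.rot d)) = _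
      rw [source_rot]
  have hcardC : Nat.card R.Face ≤ C.card + 1 := by
    refine card_le_card_add_one_of_connected (fun e => R.faceOf (e, true))
      (fun e => R.faceOf (e, false)) C fun f hf x y => ?_
    obtain ⟨a, rfl⟩ := R.faceOf_surjective x
    obtain ⟨b, rfl⟩ := R.faceOf_surjective y
    refine τ'.apply_eq_of_sameCycle (fun d => f (R.faceOf d)) (fun d => ?_) (hτ' a b)
    have : ∀ d, f (R.faceOf (φ d)) = f (R.faceOf d) := fun d => by rw [hφ, faceOf_facePerm]
    rw [hτ'def, Equiv.Perm.mul_apply, this]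
    by_cases hd : d.1 ∈ C
    · rw [revOn_of_mem hd]
      have := hf _ hd
      obtain ⟨e, b⟩ := d
      cases b
      · exact this
      · exact this.symm
    · rw [revOn_of_notMem hd]
  set W : Finset E := (T ∪ C)ᶜ with hW
  have hWmem : ∀ e, e ∈ W ↔ e ∉ T ∧ e ∉ C := fun e => by simp [hW]
  -- Tree and cotree have at least `|V| - 1` and `|F| - 1` edges, and the Euler characteristic is
  -- zero.
  have hWcard : W.card ≤ 2 := by
    have h1 : (T ∪ C).card = T.card + C.card :=
      Finset.card_union_of_disjoint (Finset.disjoint_left.2 fun e h1 h2 => hCT' e h2 h1)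
    have h2 : W.card = Fintype.card E - (T ∪ C).card := Finset.card_compl _
    have h3 := hT.2
    rw [Nat.card_eq_fintype_card (α := E)] at h3
    omega
  -- it suffices to show that the normalized values of `K` commute
  suffices hcomm : ∃ k : Γ, ∀ d d', Commute (K d * k⁻¹) (K d' * k⁻¹) by
    obtain ⟨k, hk⟩ := hcomm
    have hsrc := source_surjective (G := G) hT.1
    have htv : ∀ d, t (Function.surjInv hsrc (G.source d)) = t d := fun d =>
      σ.apply_eq_of_sameCycle t ht1
        ((R.sameCycle_iff _ _).2 (Function.surjInv_eq hsrc (G.source d)))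
    refine ⟨fun v => t (Function.surjInv hsrc v), fun d d' => ?_⟩
    simp only [← source_rev, htv]
    rw [← hK, ← hK]
    -- The gauged connection is a quotient of two normalized values of `K`, so commutation of the
    -- latter is enough.
    have e : ∀ d, K d * (K (φ d))⁻¹ = (K d * k⁻¹) * (K (φ d) * k⁻¹)⁻¹ := fun d => by group
    rw [e, e]
    exact Commute.mul_left ((hk _ _).mul_right (hk _ _).inv_right)
      ((hk _ _).mul_right (hk _ _).inv_right).inv_left
  let M : Set (Dart E) := {d | d.1 ∈ W}
  have hKM : ∀ d, d ∉ M → K (τ d) = K d := fun d hd => hKτ d (by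
    have : d.1 ∉ W := hd
    rw [hWmem] at this; tauto)
  by_cases hMne : M.Nonempty
  swap
  · obtain ⟨e⟩ := hE
    have hconst : ∀ d d', K d = K d' := fun d d' =>
      τ.apply_eq_of_sameCycle K (fun d => hKM d fun h => hMne ⟨d, h⟩) (hτ d d')
    refine ⟨K (e, true), fun d d' => ?_⟩
    rw [hconst d (e, true), mul_inv_cancel]
    exact Commute.one_left _
  -- Along `τ`, `K` does not change until the next orientation of an edge of `W`. So all its values
  -- are attained on `M`, which has at most four elements.
  obtain ⟨m, hm1, hm2, hm3⟩ := τ.exists_firstVisit hτ M hMne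
  have hKm : ∀ d, K (m d) = K d := by
    intro d
    obtain ⟨x, hx⟩ := hMne
    obtain ⟨i, -, hi⟩ := (hτ d x).exists_pow_eq'
    induction i generalizing d with
    | zero => rw [show d = x from hi, hm2 x hx]
    | succ i ih =>
      by_cases hd : d ∈ M
      · rw [hm2 d hd]
      · rw [← hm3 d hd, ← hKM d hd]
        exact ih (τ d) (by rw [← hi, pow_succ]; rfl)
  -- The first return map of `τ` to `M`. Transitivity of `τ` and of `τ'` means that neither `μ` nor
  -- `μ` after reversal has a proper nonempty closed subset, and this determines the cyclic order of
  -- the four elements.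
  let μ : Dart E → Dart E := fun d => m (τ d)
  have hclosed : ∀ Y : Set (Dart E), Y.Nonempty → Y ⊆ M → (∀ y ∈ Y, μ y ∈ Y) → M ⊆ Y := by
    rintro Y ⟨y, hy⟩ hYM hY x hx
    obtain ⟨i, -, hi⟩ := (hτ y x).exists_pow_eq'
    have : ∀ i : ℕ, m ((τ ^ i) y) ∈ Y := by
      intro i
      induction i with
      | zero => simpa [hm2 y (hYM hy)] using hy
      | succ i ih =>
        rw [pow_succ', Equiv.Perm.mul_apply]
        by_cases hd : (τ ^ i) y ∈ M
        · rw [hm2 _ hd] at ih; exact hY _ ih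
        · rw [hm3 _ hd]; exact ih
    have h1 := this i
    rwa [hi, hm2 x hx] at h1
  have hclosed' : ∀ Y : Set (Dart E), Y.Nonempty → Y ⊆ M → (∀ y ∈ Y, μ y.rev ∈ Y) → M ⊆ Y := by
    rintro Y ⟨y, hy⟩ hYM hY x hx
    obtain ⟨i, -, hi⟩ := (hτ' y x).exists_pow_eq'
    have : ∀ i : ℕ, m ((τ' ^ i) y) ∈ Y := by
      intro i
      induction i with
      | zero => simpa [hm2 y (hYM hy)] using hy
      | succ i ih =>
        rw [pow_succ', Equiv.Perm.mul_apply]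
        by_cases hd : (τ' ^ i) y ∈ M
        · have hd' := (hWmem _).1 hd
          rw [hτ'N _ hd'.1 hd'.2]
          rw [hm2 _ hd] at ih; exact hY _ ih
        · have hd' : ¬ _ := fun h => hd ((hWmem _).2 h)
          rw [hτ'C _ (by tauto), hm3 _ hd]; exact ih
    have h1 := this i
    rwa [hi, hm2 x hx] at h1
  obtain ⟨a, haM⟩ := hMne
  by_cases hb : ∃ b : Dart E, b ∈ M ∧ b ≠ a ∧ b ≠ a.rev
  swap
  · push Not at hb
    refine ⟨K a, fun d d' => ?_⟩
    have key : ∀ d, K d = K a ∨ K d = K a.rev := fun d => by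
      rw [← hKm d]
      by_cases h : m d = a
      · left; rw [h]
      · right; rw [hb _ (hm1 d) h]
    rcases key d with h1 | h1 <;> rcases key d' with h2 | h2 <;> simp [h1, h2]
  obtain ⟨b, hbM, hba, hba'⟩ := hb
  have hMsub : M = {a, a.rev, b, b.rev} := by
    have hab : a.1 ≠ b.1 := fun h => (eq_or_eq_rev_of_fst_eq h.symm).elim hba hba'
    have hW2 : {a.1, b.1} = W := Finset.eq_of_subset_of_card_le
      (Finset.insert_subset haM (Finset.singleton_subset_iff.2 hbM))
      (by rw [Finset.card_pair hab]; exact hWcard)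
    ext d
    have : d ∈ M ↔ d.1 = a.1 ∨ d.1 = b.1 := by change d.1 ∈ W ↔ _; simp [← hW2]
    rw [this]
    constructor
    · rintro (h | h)
      · rcases eq_or_eq_rev_of_fst_eq h with rfl | rfl <;> simp
      · rcases eq_or_eq_rev_of_fst_eq h with rfl | rfl <;> simp
    · rintro (rfl | rfl | rfl | rfl) <;> simp
  have hfour : ∀ d, m d = a ∨ m d = a.rev ∨ m d = b ∨ m d = b.rev := fun d => by
    have := hm1 d; rw [hMsub] at this; exact this
  have hM4 : ∀ Y : Set (Dart E), M ⊆ Y → a ∈ Y ∧ a.rev ∈ Y ∧ b ∈ Y ∧ b.rev ∈ Y := fun Y hY =>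
    ⟨hY haM, hY haM, hY hbM, hY hbM⟩
  have hnr : ∀ x ∈ M, μ x ≠ x.rev := by
    intro x hx hcon
    have h1 := hclosed' {x.rev} ⟨_, rfl⟩ (Set.singleton_subset_iff.2 hx) (by simp [hcon])
    obtain ⟨h3, h4, -, -⟩ := hM4 _ h1
    exact rev_ne a (h4.trans (Eq.symm h3))
  have hcyc := cyclic_of_no_closed_subset (rev_ne a).symm hba.symm
    (fun h => hba' (by rw [h, rev_rev])) hba'.symm (fun h => hba (rev_injective h.symm)) μ
    (fun x => hfour _) (by rw [← hMsub]; exact hclosed)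
    ⟨hnr a haM, by simpa using hnr a.rev haM, hnr b hbM, by simpa using hnr b.rev hbM⟩
  have hrel : ∀ x ∈ M, K x * (K (μ x.rev))⁻¹ * (K x.rev * (K (μ x))⁻¹) = 1 := by
    intro x hx
    have h1 := hquad x
    have hx' := (hWmem _).1 hx
    rw [← hτN x hx'.1, ← hτN x.rev hx'.1, ← hKm (τ x), ← hKm (τ x.rev)] at h1
    exact h1
  -- the conclusion for the cyclic order `a`, `b`, `a.rev`, `b.rev`
  have final : ∀ b b' : Dart E, K a * (K b')⁻¹ * (K a.rev * (K b)⁻¹) = 1 →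
      K b * (K a)⁻¹ * (K b' * (K a.rev)⁻¹) = 1 →
      (∀ d, m d = a ∨ m d = a.rev ∨ m d = b ∨ m d = b') →
      ∃ k : Γ, ∀ d d', Commute (K d * k⁻¹) (K d' * k⁻¹) := by
    intro b b' r1 r2 hfour
    refine ⟨K a, fun d d' => ?_⟩
    -- With `X = K b * (K a)⁻¹` and `Z = K b' * (K a)⁻¹`, the relations at the two edges say that `K
    -- a.rev * (K a)⁻¹` equals both `X * Z` and `Z * X`: the commutator relation of the torus.
    have hy : K a.rev * (K a)⁻¹ = (K b * (K a)⁻¹) * (K b' * (K a)⁻¹) := by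
      have h1 : K a.rev = K b * (K a)⁻¹ * K b' := by
        rw [← mul_assoc, mul_inv_eq_one] at r2; exact r2.symm
      rw [h1]; group
    have hy' : K a.rev * (K a)⁻¹ = (K b' * (K a)⁻¹) * (K b * (K a)⁻¹) := by
      have h1 : K a.rev = K b' * (K a)⁻¹ * K b := by
        rw [← mul_assoc, mul_inv_eq_one] at r1; rw [← r1]; group
      rw [h1]; group
    have hvals : ∀ d, K d * (K a)⁻¹ = 1 ∨ K d * (K a)⁻¹ = K b * (K a)⁻¹ ∨
        K d * (K a)⁻¹ = (K b * (K a)⁻¹) * (K b' * (K a)⁻¹) ∨ K d * (K a)⁻¹ = K b' * (K a)⁻¹ := by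
      intro d
      rw [← hKm d]
      rcases hfour d with h | h | h | h <;> rw [h]
      · left; simp
      · right; right; left; exact hy
      · right; left; rfl
      · right; right; right; rfl
    exact commute_of_mem_four (hy.symm.trans hy') (hvals d) (hvals d')
  have ra := hrel a haM
  have rb := hrel b hbM
  have rb' := hrel b.rev hbM
  rw [rev_rev] at rb'
  rcases hcyc with ⟨e1, e2, e3, e4⟩ | ⟨e1, e2, e3, e4⟩
  · rw [e1, e3] at ra
    rw [e2, e4] at rb
    exact final b b.rev ra rb hfour
  · rw [e1, e3] at ra
    rw [e2, e4] at rb'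
    exact final b.rev b ra rb' (fun d => by have := hfour d; tauto)

end Multigraph.RotationSystem

/-! ### Free homotopy is determined by homology -/

namespace Multigraph
open Dart
variable {V E : Type*} {G : Multigraph V E}

lemma revWalk_append (l₁ l₂ : List (Dart E)) : revWalk (l₁ ++ l₂) = revWalk l₂ ++ revWalk l₁ := by
  simp [revWalk]

lemma IsWalk.of_spur {u v : V} {l₁ l₂ : List (Dart E)} {d : Dart E}
    (h : G.IsWalk u v (l₁ ++ [d, d.rev] ++ l₂)) : G.IsWalk u v (l₁ ++ l₂) := by
  rw [List.append_assoc, isWalk_append] at h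
  obtain ⟨m, h1, h2⟩ := h
  rw [List.cons_append, List.cons_append, List.nil_append] at h2
  obtain ⟨rfl, -, h4⟩ := h2
  rw [target_rev] at h4
  exact h1.append h4

namespace RotationSystem
variable (R : G.RotationSystem)

section FaceWalk

lemma nodup_faceWalk (d : Dart E) : (R.faceWalk d).Nodup := by
  rw [faceWalk]
  refine List.Nodup.map_on (fun x hx y hy hxy => ?_) List.nodup_range
  exact Function.iterate_injOn_Iio_minimalPeriod (List.mem_range.1 hx) (List.mem_range.1 hy) hxy

lemma mem_faceWalk_iff [Finite E] (d a : Dart E) : a ∈ R.faceWalk d ↔ R.faceOf a = R.faceOf d := by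
  rw [eq_comm, faceOf_eq_iff, faceWalk, List.mem_map]
  constructor
  · rintro ⟨k, -, rfl⟩
    exact ⟨k, by rw [zpow_natCast, Equiv.Perm.coe_pow]⟩
  · intro h
    obtain ⟨i, -, hi⟩ := h.exists_pow_eq'
    rw [Equiv.Perm.coe_pow] at hi
    refine ⟨i % Function.minimalPeriod R.facePerm d, List.mem_range.2 (Nat.mod_lt _
      (Function.minimalPeriod_pos_of_mem_periodicPts (R.facePerm.injective.mem_periodicPts _))), ?_⟩
    rw [Function.iterate_mod_minimalPeriod_eq, hi]

lemma isWalk_faceWalk (d : Dart E) : G.IsWalk (G.source d) (G.source d) (R.faceWalk d) := by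
  have : ∀ k, G.IsWalk (G.source d) (G.source (R.facePerm^[k] d))
      ((List.range k).map fun k => (R.facePerm)^[k] d) := by
    intro k
    induction k with
    | zero => exact rfl
    | succ k ih =>
      rw [List.range_succ, List.map_append]
      refine ih.append ⟨rfl, ?_⟩
      rw [Function.iterate_succ_apply', source_facePerm]
      exact rfl
  have h := this (Function.minimalPeriod R.facePerm d)
  rwa [Function.iterate_minimalPeriod] at h

-- The face walk meets each oriented edge of its face exactly once, so its multiplicities form the
-- indicator function of the face.
open Classical in
lemma boundary₂_single [Finite E] (A : Type*) [CommRing A] (d : Dart E) :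
    R.boundary₂ A (Pi.single (R.faceOf d) 1) = ((R.faceWalk d).map (Dart.chain A)).sum := by
  refine ext_coeff fun a => ?_
  have hc : ∀ a, (((R.faceWalk d).count a : ℕ) : A) =
      (Pi.single (R.faceOf d) 1 : R.Face → A) (R.faceOf a) := by
    intro a
    by_cases h : R.faceOf a = R.faceOf d
    · rw [List.count_eq_one_of_mem (R.nodup_faceWalk d) ((R.mem_faceWalk_iff d a).2 h), h]; simp
    · rw [List.count_eq_zero_of_not_mem (fun h' => h ((R.mem_faceWalk_iff d a).1 h'))]
      simp [h]
  rw [coeff_sum_chain, coeff_boundary₂, hc, hc, faceOf_rot]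

end FaceWalk

section Homologous
variable [Fintype E]

lemma cls_eq_iff {A : Type*} [CommRing A] (x y : G.cycles A) :
    R.cls A x = R.cls A y ↔ ∃ z : R.Face → A, R.boundary₂ A z = x.1 - y.1 := by
  rw [cls, cls, Submodule.Quotient.eq]
  simp

/-- Rotations and spurs do not change the 1-cycle, and inserting a face walk adds a boundary. -/
lemma cls_eq_of_freelyHomotopic (A : Type*) [CommRing A] {c c' : G.ClosedWalk}
    (h : R.FreelyHomotopic c c') : R.cls A (c.cycle A) = R.cls A (c'.cycle A) := by
  classical
  induction h with
  | rel c c' h =>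
    rw [cls_eq_iff]
    cases h with
    | rotate d l hc hc' =>
      refine ⟨0, ?_⟩
      simp only [ClosedWalk.cycle, hc, hc', List.map_cons, List.map_append, List.sum_cons,
        List.sum_append, List.map_nil, List.sum_nil, map_zero]
      abel
    | spur d l₁ l₂ hb hc hc' =>
      refine ⟨0, ?_⟩
      simp only [ClosedWalk.cycle, hc, hc', List.map_cons, List.map_append, List.sum_cons,
        List.sum_append, List.map_nil, List.sum_nil, map_zero, chain_rev]
      abel
    | face d l₁ l₂ hb hc hc' =>
      refine ⟨-Pi.single (R.faceOf d) 1, ?_⟩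
      rw [map_neg, boundary₂_single]
      simp only [ClosedWalk.cycle, hc, hc', List.map_append, List.sum_append]
      abel
  | refl c => rfl
  | symm c c' _ ih => exact ih.symm
  | trans c c' c'' _ _ ih1 ih2 => exact ih1.trans ih2

end Homologous

/-- Free homotopy of closed walks given by their basepoints and lists of oriented edges. -/
def HomotopicLists (u : V) (l : List (Dart E)) (v : V) (l' : List (Dart E)) : Prop :=
  ∃ (h : G.IsWalk u u l) (h' : G.IsWalk v v l'), R.FreelyHomotopic ⟨u, l, h⟩ ⟨v, l', h'⟩

variable {R}

lemma HomotopicLists.trans {u v w : V} {l l' l'' : List (Dart E)}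
    (h : R.HomotopicLists u l v l') (h' : R.HomotopicLists v l' w l'') :
    R.HomotopicLists u l w l'' := by
  obtain ⟨h1, h2, h3⟩ := h
  obtain ⟨h4, h5, h6⟩ := h'
  exact ⟨h1, h5, h3.trans _ _ _ h6⟩

lemma HomotopicLists.symm {u v : V} {l l' : List (Dart E)}
    (h : R.HomotopicLists u l v l') : R.HomotopicLists v l' u l := by
  obtain ⟨h1, h2, h3⟩ := h
  exact ⟨h2, h1, h3.symm _ _⟩

variable (R)

lemma HomotopicLists.refl {u : V} {l : List (Dart E)} (h : G.IsWalk u u l) :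
    R.HomotopicLists u l u l := ⟨h, h, Relation.EqvGen.refl _⟩

lemma homotopicLists_rotate {v : V} (l₁ : List (Dart E)) :
    ∀ {u : V} {l₂ : List (Dart E)}, G.IsWalk u v l₁ → G.IsWalk v u l₂ →
      R.HomotopicLists u (l₁ ++ l₂) v (l₂ ++ l₁) := by
  induction l₁ with
  | nil =>
    intro u l₂ h1 h2
    obtain rfl : u = v := h1
    rw [List.append_nil]
    exact .refl R h2
  | cons d l ih =>
    rintro u l₂ ⟨rfl, h1⟩ h2
    have h3 : G.IsWalk v (G.target d) (l₂ ++ [d]) := h2.append ⟨rfl, rfl⟩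
    have h4 := ih h1 h3
    rw [List.append_assoc, List.singleton_append] at h4
    refine HomotopicLists.trans ⟨IsWalk.append (m := v) ⟨rfl, h1⟩ h2, h1.append h3, ?_⟩ h4
    exact .rel _ _ (.rotate _ _ d (l ++ l₂) rfl (by simp))

/-- The last edge of `w` and the first one of its reverse form a spur; remove it and induct. -/
lemma homotopicLists_cancel {u : V} (l₁ w l₂ : List (Dart E)) :
    G.IsWalk u u (l₁ ++ w ++ revWalk w ++ l₂) →
      R.HomotopicLists u (l₁ ++ w ++ revWalk w ++ l₂) u (l₁ ++ l₂) := by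
  induction w using List.reverseRecOn with
  | nil => intro h; simp only [revWalk_nil, List.append_nil] at h ⊢; exact .refl R h
  | append_singleton w d ih =>
    intro h
    have e : l₁ ++ (w ++ [d]) ++ revWalk (w ++ [d]) ++ l₂ =
        (l₁ ++ w) ++ [d, d.rev] ++ (revWalk w ++ l₂) := by simp [revWalk_append]
    rw [e] at h ⊢
    have h' := h.of_spur
    rw [← List.append_assoc] at h'
    refine HomotopicLists.trans (HomotopicLists.symm ⟨h', h, ?_⟩) (ih h')
    exact .rel _ _ (.spur _ _ d (l₁ ++ w) (revWalk w ++ l₂) rfl (by simp) rfl)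

variable {R}

/-- A word of oriented edges as a closed walk at `v`, along chosen paths from `v` to the ends of each
of the oriented edges. -/
noncomputable def wordLoop (hG : G.IsConnected) (v : V) (l : List (Dart E)) : List (Dart E) :=
  l.flatMap fun d => hG.path v (G.source d) ++ [d] ++ revWalk (hG.path v (G.target d))

lemma wordLoop_append (hG : G.IsConnected) (v : V) (l l' : List (Dart E)) :
    wordLoop hG v (l ++ l') = wordLoop hG v l ++ wordLoop hG v l' := by simp [wordLoop]

lemma isWalk_wordLoop (hG : G.IsConnected) (v : V) (l : List (Dart E)) :
    G.IsWalk v v (wordLoop hG v l) := by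
  induction l with
  | nil => exact rfl
  | cons d l ih =>
    refine IsWalk.append ?_ ih
    exact ((hG.isWalk_path _ _).append (G.isWalk_singleton d)).append (hG.isWalk_path _ _).rev

variable (R)

/-- Between consecutive edges of a walk, the path back to `v` and the path out again cancel; only
the outer two paths survive. The walks `A` and `B` keep the induction inside a larger closed walk.
-/
lemma homotopicLists_wordLoop (hG : G.IsConnected) (v : V) (l : List (Dart E)) :
    ∀ {u u' : V} (A B : List (Dart E)), G.IsWalk u u' l → G.IsWalk v v A → G.IsWalk v v B →
      R.HomotopicLists v (A ++ wordLoop hG v l ++ B) v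
        (A ++ (hG.path v u ++ l ++ revWalk (hG.path v u')) ++ B) := by
  induction l with
  | nil =>
    intro u u' A B h hA hB
    obtain rfl : u = u' := h
    have := R.homotopicLists_cancel (u := v) A (hG.path v u) B
      (((hA.append (hG.isWalk_path _ _)).append (hG.isWalk_path _ _).rev).append hB)
    simpa [wordLoop] using this.symm
  | cons d l ih =>
    rintro u u' A B ⟨rfl, h⟩ hA hB
    have hd : G.IsWalk v (G.target d) (hG.path v (G.source d) ++ [d]) :=
      (hG.isWalk_path _ _).append (G.isWalk_singleton d)
    have hd' := hd.append (hG.isWalk_path v (G.target d)).rev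
    have h1 := ih (A ++ (hG.path v (G.source d) ++ [d] ++ revWalk (hG.path v (G.target d)))) B h
      (hA.append hd') hB
    have h2 := R.homotopicLists_cancel (u := v) (A ++ hG.path v (G.source d) ++ [d])
      (revWalk (hG.path v (G.target d))) (l ++ revWalk (hG.path v u') ++ B) (by
        have := (hA.append hd').append ((((hG.isWalk_path v _).append h).append
          (hG.isWalk_path v _).rev).append hB)
        simpa using this)
    rw [revWalk_revWalk] at h2
    have h3 := h1.trans (by simpa using h2)
    simpa [wordLoop] using h3

/-- The relations between words of oriented edges: an edge followed by its reverse, and the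
boundaries of the faces, are trivial. -/
inductive WordRel : FreeMonoid (Dart E) → FreeMonoid (Dart E) → Prop
  | spur (d : Dart E) : WordRel (FreeMonoid.ofList [d, d.rev]) 1
  | face (d : Dart E) : WordRel (FreeMonoid.ofList (R.faceWalk d)) 1

/-- Words of oriented edges up to the relations `WordRel`. -/
abbrev WordMonoid : Type _ := (conGen R.WordRel).Quotient

/-- An oriented edge as an invertible element of `WordMonoid`. -/
def wordUnit (d : Dart E) : (R.WordMonoid)ˣ where
  val := ((FreeMonoid.ofList [d] : FreeMonoid (Dart E)) : R.WordMonoid)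
  inv := ((FreeMonoid.ofList [d.rev] : FreeMonoid (Dart E)) : R.WordMonoid)
  val_inv := (Con.eq _).2 (ConGen.Rel.of _ _ (WordRel.spur d))
  inv_val := (Con.eq _).2 (ConGen.Rel.of _ _ (by
    have := WordRel.spur (R := R) d.rev
    rwa [rev_rev] at this))

lemma wordUnit_rev (d : Dart E) : R.wordUnit d.rev = (R.wordUnit d)⁻¹ := Units.ext rfl

lemma val_prod_wordUnit (l : List (Dart E)) : ((l.map R.wordUnit).prod : R.WordMonoid) =
    ((FreeMonoid.ofList l : FreeMonoid (Dart E)) : R.WordMonoid) := by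
  induction l with
  | nil => rfl
  | cons d l ih =>
    rw [List.map_cons, List.prod_cons, Units.val_mul, ih]
    rfl

lemma exists_word (x : R.WordMonoid) :
    ∃ l : List (Dart E), ((FreeMonoid.ofList l : FreeMonoid (Dart E)) : R.WordMonoid) = x := by
  obtain ⟨y, rfl⟩ := Con.mk'_surjective x
  exact ⟨y.toList, rfl⟩

/-- Equality of words is generated by the relations inside products, whence the arbitrary context
`A`, `B` in the induction. A spur becomes a loop followed by its reverse, and a face becomes its
face walk with a tail from `v`. -/
lemma homotopicLists_of_word_eq [Finite E] (hG : G.IsConnected) (v : V) {x y : FreeMonoid (Dart E)}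
    (h : (x : R.WordMonoid) = y) :
    R.HomotopicLists v (wordLoop hG v x.toList) v (wordLoop hG v y.toList) := by
  rw [Con.eq] at h
  suffices ∀ A B : List (Dart E), R.HomotopicLists v (wordLoop hG v (A ++ x.toList ++ B)) v
      (wordLoop hG v (A ++ y.toList ++ B)) by simpa using this [] []
  change ConGen.Rel _ x y at h
  induction h with
  | of x y hxy =>
    intro A B
    simp only [wordLoop_append]
    cases hxy with
    | spur d =>
      have h := R.homotopicLists_cancel (u := v) (wordLoop hG v A)
        (hG.path v (G.source d) ++ [d] ++ revWalk (hG.path v (G.target d))) (wordLoop hG v B) (by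
          have h1 := ((hG.isWalk_path v (G.source d)).append (G.isWalk_singleton d)).append
            (hG.isWalk_path v _).rev
          exact (((isWalk_wordLoop hG v A).append h1).append h1.rev).append
            (isWalk_wordLoop hG v B))
      simpa [wordLoop, revWalk_append] using h
    | face d =>
      have hw := R.isWalk_faceWalk d
      have h1 := R.homotopicLists_wordLoop hG v (R.faceWalk d) (wordLoop hG v A) (wordLoop hG v B)
        hw (isWalk_wordLoop hG v A) (isWalk_wordLoop hG v B)
      have hp := hG.isWalk_path v (G.source d)
      have h2 := R.homotopicLists_cancel (u := v) (wordLoop hG v A) (hG.path v (G.source d))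
        (wordLoop hG v B) ((((isWalk_wordLoop hG v A).append hp).append hp.rev).append
            (isWalk_wordLoop hG v B))
      have h3 : R.HomotopicLists v
          (wordLoop hG v A ++ hG.path v (G.source d) ++ (revWalk (hG.path v (G.source d)) ++
            wordLoop hG v B)) v
          (wordLoop hG v A ++ hG.path v (G.source d) ++ R.faceWalk d ++
            (revWalk (hG.path v (G.source d)) ++ wordLoop hG v B)) :=
        ⟨by simpa using h2.1,
          (((isWalk_wordLoop hG v A).append hp).append hw).append
            (hp.rev.append (isWalk_wordLoop hG v B)),
          .rel _ _ (.face _ _ d _ _ rfl rfl rfl)⟩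
      have h4 := h1.trans (HomotopicLists.trans (by simpa using h3.symm) h2)
      simpa [wordLoop] using h4
  | refl x => intro A B; exact .refl R (isWalk_wordLoop hG v _)
  | symm _ ih => intro A B; exact (ih A B).symm
  | trans _ _ ih1 ih2 => intro A B; exact (ih1 A B).trans (ih2 A B)
  | @mul w x y z _ _ ih1 ih2 =>
    intro A B
    have h1 := ih1 A (y.toList ++ B)
    have h2 := ih2 (A ++ x.toList) B
    simp only [FreeMonoid.toList_mul, List.append_assoc] at h1 h2 ⊢
    exact h1.trans h2

/-- A closed walk is freely homotopic to the loop of its word. -/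
lemma homotopicLists_wordLoop_self (hG : G.IsConnected) (v : V) (c : G.ClosedWalk) :
    R.HomotopicLists c.base c.darts v (wordLoop hG v c.darts) := by
  have h1 := R.homotopicLists_wordLoop hG v c.darts [] [] c.isWalk rfl rfl
  have hp := hG.isWalk_path v c.base
  have h2 := R.homotopicLists_rotate (hG.path v c.base)
    hp (c.isWalk.append hp.rev)
  have h3 := R.homotopicLists_cancel (u := c.base) c.darts (revWalk (hG.path v c.base)) [] (by
    simpa using c.isWalk.append (hp.rev.append hp))
  simp only [revWalk_revWalk, List.append_nil, List.nil_append, List.append_assoc] at h1 h2 h3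
  exact ((h1.trans h2).trans h3).symm

/-- Represent `s` and `s⁻¹` by words `l` and `l'`. Moving the basepoint past `l` leaves `l'`
followed by `l` at the end, which is trivial. -/
lemma freelyHomotopic_of_conj [Finite E] (hG : G.IsConnected) {c c' : G.ClosedWalk}
    (s : (R.WordMonoid)ˣ)
    (h : (c.darts.map R.wordUnit).prod = s * (c'.darts.map R.wordUnit).prod * s⁻¹) :
    R.FreelyHomotopic c c' := by
  obtain ⟨v⟩ := hG.1
  obtain ⟨l, hl⟩ := R.exists_word s
  obtain ⟨l', hl'⟩ := R.exists_word (s⁻¹ : (R.WordMonoid)ˣ)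
  have h1 : ((FreeMonoid.ofList c.darts : FreeMonoid (Dart E)) : R.WordMonoid) =
      ((FreeMonoid.ofList l * FreeMonoid.ofList c'.darts * FreeMonoid.ofList l' :
        FreeMonoid (Dart E)) : R.WordMonoid) := by
    rw [Con.coe_mul, Con.coe_mul, hl, hl', ← val_prod_wordUnit, ← val_prod_wordUnit, h]
    rfl
  have h2 : ((FreeMonoid.ofList c'.darts * (FreeMonoid.ofList l' * FreeMonoid.ofList l) :
        FreeMonoid (Dart E)) : R.WordMonoid) =
      ((FreeMonoid.ofList c'.darts : FreeMonoid (Dart E)) : R.WordMonoid) := by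
    rw [Con.coe_mul, Con.coe_mul, hl, hl', Units.inv_mul, mul_one]
  have k1 := R.homotopicLists_of_word_eq hG v h1
  have k2 := R.homotopicLists_of_word_eq hG v h2
  simp only [FreeMonoid.toList_mul, FreeMonoid.toList_ofList, wordLoop_append] at k1 k2
  have k3 := R.homotopicLists_rotate (wordLoop hG v l) (isWalk_wordLoop hG v l)
    ((isWalk_wordLoop hG v c'.darts).append (isWalk_wordLoop hG v l'))
  rw [← List.append_assoc, List.append_assoc (wordLoop hG v c'.darts)] at k3
  obtain ⟨_, _, h⟩ := (R.homotopicLists_wordLoop_self hG v c).trans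
    (((k1.trans k3).trans k2).trans (R.homotopicLists_wordLoop_self hG v c').symm)
  exact h

/-- The gauge factors telescope, so on closed walks a gauge transformation acts by conjugation. -/
lemma prod_gauge {Γ : Type*} [Group Γ] (t : V → Γ) (g : Dart E → Γ) (l : List (Dart E)) :
    ∀ {u v : V}, G.IsWalk u v l →
      (l.map fun d => t (G.source d) * g d * (t (G.target d))⁻¹).prod =
        t u * (l.map g).prod * (t v)⁻¹ := by
  induction l with
  | nil => intro u v h; rw [show u = v from h]; simp
  | cons d l ih =>
    rintro u v ⟨rfl, h⟩
    rw [List.map_cons, List.prod_cons, ih h, List.map_cons, List.prod_cons]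
    group

/-- On a torus, free homotopy classes of closed walks are determined by their homology classes. -/
theorem IsTorus.freelyHomotopic_of_cls_eq [Finite V] [Fintype E] {R : G.RotationSystem}
    (hT : R.IsTorus) {c c' : G.ClosedWalk}
    (h : R.cls ℤ (c.cycle ℤ) = R.cls ℤ (c'.cycle ℤ)) : R.FreelyHomotopic c c' := by
  classical
  have hface : ∀ d, ((R.faceWalk d).map R.wordUnit).prod = 1 := fun d => Units.ext (by
    rw [val_prod_wordUnit]
    exact (Con.eq _).2 (ConGen.Rel.of _ _ (WordRel.face d)))
  obtain ⟨t, ht⟩ := hT.exists_gauge_commute R.wordUnit R.wordUnit_rev hface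
  set γ : Dart E → (R.WordMonoid)ˣ := fun d =>
    t (G.source d) * R.wordUnit d * (t (G.target d))⁻¹ with hγ
  have : IsMulCommutative (Subgroup.closure (Set.range γ)) := Subgroup.isMulCommutative_closure (by
    rintro _ ⟨d, rfl⟩ _ ⟨d', rfl⟩
    exact ht d d')
  let : CommGroup (Subgroup.closure (Set.range γ)) :=
    { (inferInstance : Group (Subgroup.closure (Set.range γ))) with
      mul_comm := this.is_comm.comm }
  let γS : Dart E → Subgroup.closure (Set.range γ) := fun d =>
    ⟨γ d, Subgroup.subset_closure ⟨d, rfl⟩⟩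
  have hγrev : ∀ d, γS d.rev = (γS d)⁻¹ := fun d => Subtype.ext (by
    change γ d.rev = (γ d)⁻¹
    simp only [hγ, source_rev, target_rev, wordUnit_rev]
    group)
  -- Since the gauged letters commute, their product along a walk depends only on its 1-chain,
  -- through the linear map `θ`. The face relations make `θ` vanish on boundaries, hence closed
  -- walks in one homology class have equal gauged products.
  let θ : (E → ℤ) →ₗ[ℤ] Additive (Subgroup.closure (Set.range γ)) :=
    Fintype.linearCombination ℤ fun e => Additive.ofMul (γS (e, true))
  have hθ : ∀ d : Dart E, θ (d.chain ℤ) = Additive.ofMul (γS d) := by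
    rintro ⟨e, b⟩
    cases b
    · simp only [θ, Dart.chain, Fintype.linearCombination_apply_single]
      have hr : γS (e, false) = (γS (e, true))⁻¹ := hγrev (e, true)
      rw [hr]
      simp
    · simp only [θ, Dart.chain, Fintype.linearCombination_apply_single]
      simp
  have hθl : ∀ l : List (Dart E), θ ((l.map (Dart.chain ℤ)).sum) =
      Additive.ofMul ((l.map γS).prod) := by
    intro l
    induction l with
    | nil => simp
    | cons d l ih => simp [hθ, ih]
  have hval : ∀ l : List (Dart E), (((l.map γS).prod : Subgroup.closure (Set.range γ)) :
      (R.WordMonoid)ˣ) = (l.map γ).prod := by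
    intro l
    induction l with
    | nil => rfl
    | cons d l ih => rw [List.map_cons, List.prod_cons, List.map_cons, List.prod_cons, ← ih]; rfl
  have hboundary : θ ∘ₗ R.boundary₂ ℤ = 0 := by
    have := Fintype.ofFinite R.Face
    refine LinearMap.pi_ext' fun f => LinearMap.ext_ring ?_
    obtain ⟨d, rfl⟩ := R.faceOf_surjective f
    change θ (R.boundary₂ ℤ (Pi.single (R.faceOf d) 1)) = 0
    rw [boundary₂_single, hθl]
    refine congrArg Additive.ofMul (Subtype.ext ?_)
    rw [hval, hγ, prod_gauge t R.wordUnit _ (R.isWalk_faceWalk d), hface]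
    simp
  obtain ⟨z, hz⟩ := (R.cls_eq_iff _ _).1 h
  have h1 : θ (c.cycle ℤ).1 = θ (c'.cycle ℤ).1 := by
    rw [← sub_eq_zero, ← map_sub, ← hz]
    exact LinearMap.congr_fun hboundary z
  simp only [ClosedWalk.cycle, hθl] at h1
  have h2 := congrArg (Subtype.val) (Additive.ofMul.injective h1)
  rw [hval, hval, hγ, prod_gauge t R.wordUnit _ c.isWalk, prod_gauge t R.wordUnit _ c'.isWalk] at h2
  refine R.freelyHomotopic_of_conj hT.1 ((t c.base)⁻¹ * t c'.base) ?_
  rw [mul_inv_eq_iff_eq_mul] at h2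
  calc _ = (t c.base)⁻¹ * (t c.base * (c.darts.map R.wordUnit).prod) := by group
    _ = _ := by rw [h2]; group

end RotationSystem
end Multigraph

/-! ### The rank of homology and its closed walks -/

namespace Multigraph
open Dart
variable {V E : Type*} {G : Multigraph V E}

section Paths
variable [Fintype E] (A : Type*) [CommRing A]

/-- The 1-chain of a chosen path. -/
noncomputable def IsConnected.pathChain (hG : G.IsConnected) (v u : V) : E → A :=
  ((hG.path v u).map (Dart.chain A)).sum

/-- The closed walk at `v` that runs to an edge, through it, and back. -/
noncomputable def IsConnected.edgeLoop (hG : G.IsConnected) (v : V) (e : E) : G.ClosedWalk where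
  base := v
  darts := hG.path v (G.src e) ++ [(e, true)] ++ revWalk (hG.path v (G.tgt e))
  isWalk := ((hG.isWalk_path v (G.src e)).append (G.isWalk_singleton (e, true))).append
    (hG.isWalk_path v (G.tgt e)).rev

lemma IsConnected.cycle_edgeLoop (hG : G.IsConnected) (v : V) (e : E) :
    ((hG.edgeLoop v e).cycle A).1 = hG.pathChain A v (G.src e) + Dart.chain A (e, true) -
      hG.pathChain A v (G.tgt e) := by
  simp only [ClosedWalk.cycle, edgeLoop, List.map_append, List.sum_append, sum_chain_revWalk,
    pathChain, List.map_cons, List.map_nil, List.sum_cons, List.sum_nil]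
  abel

variable {A}

/-- Summation by parts: the differences of a vertex function form a coboundary, which vanishes on
cycles. -/
lemma sum_mul_src_sub_tgt {x : E → A} (hx : x ∈ G.cycles A) (h : V → A) :
    ∑ e, x e * (h (G.src e) - h (G.tgt e)) = 0 := by
  have := G.sum_coeff_mul_source hx h
  rw [sum_dart] at this
  rw [← this]
  refine Finset.sum_congr rfl fun e _ => ?_
  simp [source]
  ring

/-- Every cycle is a combination of the loops through the edges. -/
lemma IsConnected.eq_sum_edgeLoop (hG : G.IsConnected) (v : V) (x : G.cycles A) :
    x = ∑ e, x.1 e • (hG.edgeLoop v e).cycle A := by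
  classical
  refine Subtype.ext ?_
  ext e'
  have h := sum_mul_src_sub_tgt x.2 fun u => hG.pathChain A v u e'
  simp only [Submodule.coe_sum, Submodule.coe_smul, cycle_edgeLoop, Finset.sum_apply,
    Pi.smul_apply, Pi.add_apply, Pi.sub_apply, smul_eq_mul]
  have h2 : ∑ e, x.1 e * (Dart.chain A (e, true) : E → A) e' = x.1 e' := by
    simp [Dart.chain, Pi.single_apply]
  rw [← h2, ← zero_add (∑ e, _), ← h, ← Finset.sum_add_distrib]
  refine Finset.sum_congr rfl fun e _ => ?_
  ring

end Paths

section Rank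

lemma finrank_range_add_finrank_ker_of_isDomain {A M N : Type*} [CommRing A] [IsDomain A]
    [AddCommGroup M] [AddCommGroup N] [Module A M] [Module A N] [Module.Finite A M]
    (f : M →ₗ[A] N) : Module.finrank A (LinearMap.range f) + Module.finrank A (LinearMap.ker f) =
      Module.finrank A M := by
  rw [← f.quotKerEquivRange.finrank_eq]
  exact Submodule.finrank_quotient_add_finrank _

variable [Fintype E] (A : Type*) [CommRing A] [IsDomain A]

/-- The image is the kernel of the sum of coefficients: a 0-chain `z` of total zero bounds the
combination, with coefficients `z u`, of the paths from `v` to `u`. -/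
lemma IsConnected.finrank_range_boundary₁ [Fintype V] (hG : G.IsConnected) :
    Module.finrank A (LinearMap.range (G.boundary₁ A)) + 1 = Fintype.card V := by
  classical
  obtain ⟨v⟩ := hG.1
  let aug : (V → A) →ₗ[A] A := Fintype.linearCombination A fun _ => (1 : A)
  have haug : ∀ z, aug z = ∑ u, z u := fun z => by
    simp [aug, Fintype.linearCombination_apply]
  have hsurj : Function.Surjective aug := fun a => ⟨Pi.single v a, by rw [haug]; simp⟩
  have hrange : LinearMap.range (G.boundary₁ A) = LinearMap.ker aug := by
    apply le_antisymm
    · rintro _ ⟨x, rfl⟩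
      rw [LinearMap.mem_ker, haug]
      simp only [boundary₁, Fintype.linearCombination_apply, Finset.sum_apply, Pi.smul_apply,
        Pi.sub_apply, smul_eq_mul]
      rw [Finset.sum_comm]
      refine Finset.sum_eq_zero fun e _ => ?_
      rw [← Finset.mul_sum, Finset.sum_sub_distrib]
      simp
    · intro z hz
      rw [LinearMap.mem_ker, haug] at hz
      refine ⟨∑ u, z u • hG.pathChain A v u, ?_⟩
      rw [map_sum]
      have h : ∀ u, G.boundary₁ A (z u • hG.pathChain A v u) =
          z u • (Pi.single u (1 : A) : V → A) - z u • Pi.single v 1 := fun u => by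
        rw [map_smul, IsConnected.pathChain, G.boundary₁_walk A _ _ _ (hG.isWalk_path v u),
          smul_sub]
      simp_rw [h]
      rw [Finset.sum_sub_distrib, ← Finset.sum_smul, hz, zero_smul, sub_zero]
      ext u
      simp [Finset.sum_apply, Pi.single_apply]
  have h1 := finrank_range_add_finrank_ker_of_isDomain aug
  rw [LinearMap.range_eq_top.2 hsurj, finrank_top, Module.finrank_self,
    Module.finrank_fintype_fun_eq_card] at h1
  rw [hrange, add_comm, h1]

/-- A face function without boundary has equal values on the two sides of every edge, so by
connectedness it is constant: the kernel has rank one. -/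
lemma RotationSystem.finrank_range_boundary₂ (R : G.RotationSystem) (hG : G.IsConnected)
    [Nonempty E] :
    Module.finrank A (LinearMap.range (R.boundary₂ A)) + 1 = Nat.card R.Face := by
  classical
  have := Fintype.ofFinite R.Face
  obtain ⟨e⟩ := ‹Nonempty E›
  let f₀ := R.faceOf (e, true)
  have hconst : ∀ y ∈ LinearMap.ker (R.boundary₂ A), ∀ f, y f = y f₀ := by
    intro y hy f
    obtain ⟨d, rfl⟩ := R.faceOf_surjective f
    have h : ∀ d, y (R.faceOf (R.rot d)) = y (R.faceOf d) := fun d => by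
      have h := R.coeff_boundary₂ y d
      rw [LinearMap.mem_ker.1 hy, coeff_zero] at h
      exact (sub_eq_zero.1 h.symm).symm
    exact R.eq_of_invariant hG (fun d => y (R.faceOf d)) h
      (fun d => by rw [← faceOf_rot]; exact h d) d (e, true)
  let ev : LinearMap.ker (R.boundary₂ A) →ₗ[A] A :=
    (LinearMap.proj f₀).comp (LinearMap.ker (R.boundary₂ A)).subtype
  have hev : Function.Bijective ev := by
    constructor
    · rw [← LinearMap.ker_eq_bot, LinearMap.ker_eq_bot']
      intro y hy
      refine Subtype.ext (funext fun f => ?_)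
      rw [hconst y.1 y.2 f]
      exact hy
    · intro a
      refine ⟨⟨fun _ => a, ?_⟩, rfl⟩
      rw [LinearMap.mem_ker]
      ext e
      simp [boundary₂]
  have h1 := finrank_range_add_finrank_ker_of_isDomain (R.boundary₂ A)
  rw [(LinearEquiv.ofBijective ev hev).finrank_eq, Module.finrank_self,
    Module.finrank_fintype_fun_eq_card, ← Nat.card_eq_fintype_card] at h1
  exact h1

/-- The rank is `(|E| - (|V| - 1)) - (|F| - 1)`, which is `2` by Euler's formula. -/
theorem RotationSystem.IsTorus.finrank_H₁ [Fintype V] [IsNoetherianRing A] {R : G.RotationSystem} (hT : R.IsTorus) :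
    Module.finrank A (R.H₁ A) = 2 := by
  have := hT.nonempty_edge
  have h1 := hT.1.finrank_range_boundary₁ A
  have h2 := R.finrank_range_boundary₂ A hT.1
  have h3 := finrank_range_add_finrank_ker_of_isDomain (G.boundary₁ A)
  have hle : LinearMap.range (R.boundary₂ A) ≤ G.cycles A := by
    rintro _ ⟨y, rfl⟩
    exact R.boundary₁_boundary₂ A y
  have h4 := Submodule.finrank_quotient_add_finrank
    ((LinearMap.range (R.boundary₂ A)).comap (G.cycles A).subtype)
  rw [(Submodule.comapSubtypeEquivOfLe hle).finrank_eq] at h4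
  rw [Module.finrank_fintype_fun_eq_card] at h3
  have h5 := hT.2
  rw [Nat.card_eq_fintype_card (α := V), Nat.card_eq_fintype_card (α := E)] at h5
  change Module.finrank A (LinearMap.range (G.boundary₁ A)) + Module.finrank A (G.cycles A) = _ at h3
  change Module.finrank A (R.H₁ A) + _ = _ at h4
  omega

end Rank

section Concatenate

/-- Concatenation of closed walks with the same basepoint. -/
def ClosedWalk.append (c c' : G.ClosedWalk) (h : c.base = c'.base) : G.ClosedWalk where
  base := c.base
  darts := c.darts ++ c'.darts
  isWalk := c.isWalk.append (h ▸ c'.isWalk)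

/-- The reverse closed walk. -/
def ClosedWalk.reverse (c : G.ClosedWalk) : G.ClosedWalk where
  base := c.base
  darts := revWalk c.darts
  isWalk := c.isWalk.rev

/-- The closed walk without edges. -/
def ClosedWalk.nil (v : V) : G.ClosedWalk := ⟨v, [], rfl⟩

/-- A closed walk run through `n` times. -/
def ClosedWalk.repeat (c : G.ClosedWalk) (n : ℕ) : G.ClosedWalk where
  base := c.base
  darts := (List.replicate n c.darts).flatten
  isWalk := by
    induction n with
    | zero => exact rfl
    | succ n ih => rw [List.replicate_succ, List.flatten_cons]; exact c.isWalk.append ih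

lemma ClosedWalk.length_append (w : E → ℝ) (c c' : G.ClosedWalk) (h : c.base = c'.base) :
    (c.append c' h).length w = c.length w + c'.length w := by simp [append, length]

lemma ClosedWalk.length_reverse (w : E → ℝ) (c : G.ClosedWalk) :
    c.reverse.length w = c.length w := by
  simp only [reverse, length, revWalk, List.map_reverse, List.sum_reverse, List.map_map]
  rfl

lemma ClosedWalk.length_repeat (w : E → ℝ) (c : G.ClosedWalk) (n : ℕ) :
    (c.repeat n).length w = n * c.length w := by
  simp only [ClosedWalk.repeat, length]
  induction n with
  | zero => simp
  | succ n ih =>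
    rw [List.replicate_succ, List.flatten_cons, List.map_append, List.sum_append, ih]
    push_cast; ring

variable [Fintype E] (A : Type*) [CommRing A]

lemma ClosedWalk.cycle_append (c c' : G.ClosedWalk) (h : c.base = c'.base) :
    (c.append c' h).cycle A = c.cycle A + c'.cycle A :=
  Subtype.ext (by simp [append, cycle])

lemma ClosedWalk.cycle_reverse (c : G.ClosedWalk) : c.reverse.cycle A = - c.cycle A :=
  Subtype.ext (by simp [reverse, cycle, sum_chain_revWalk])

lemma ClosedWalk.cycle_repeat (c : G.ClosedWalk) (n : ℕ) :
    (c.repeat n).cycle A = n • c.cycle A := by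
  refine Subtype.ext ?_
  change _ = n • (c.cycle A).1
  simp only [ClosedWalk.repeat, cycle]
  induction n with
  | zero => simp
  | succ n ih =>
    rw [List.replicate_succ, List.flatten_cons, List.map_append, List.sum_append, ih, succ_nsmul']

lemma ClosedWalk.cycle_nil (v : V) : (ClosedWalk.nil (G := G) v).cycle A = 0 := Subtype.ext rfl

/-- Every homology class is the class of a closed walk. -/
theorem RotationSystem.exists_closedWalk_cls_eq (R : G.RotationSystem) (hG : G.IsConnected)
    (α : R.H₁ ℤ) : ∃ c : G.ClosedWalk, R.cls ℤ (c.cycle ℤ) = α := by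
  classical
  obtain ⟨x, rfl⟩ := Submodule.Quotient.mk_surjective _ α
  obtain ⟨v⟩ := hG.1
  -- The cycle itself is realized, not only its class: the loops at `v` through the edges generate
  -- all cycles, and closed walks at `v` can be concatenated, repeated and reversed.
  suffices h : ∃ c : G.ClosedWalk, c.base = v ∧ c.cycle ℤ = x by
    obtain ⟨c, -, rfl⟩ := h; exact ⟨c, rfl⟩
  have hint : ∀ (c : G.ClosedWalk), c.base = v → ∀ n : ℤ,
      ∃ c' : G.ClosedWalk, c'.base = v ∧ c'.cycle ℤ = n • c.cycle ℤ := by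
    intro c hc n
    obtain ⟨m, rfl | rfl⟩ := n.eq_nat_or_neg
    · exact ⟨c.repeat m, hc, by rw [ClosedWalk.cycle_repeat]; simp⟩
    · exact ⟨(c.repeat m).reverse, hc, by
        rw [ClosedWalk.cycle_reverse, ClosedWalk.cycle_repeat]; simp⟩
  have hsum : ∀ s : Finset E, ∃ c : G.ClosedWalk, c.base = v ∧
      c.cycle ℤ = ∑ e ∈ s, x.1 e • (hG.edgeLoop v e).cycle ℤ := by
    intro s
    induction s using Finset.induction_on with
    | empty => exact ⟨ClosedWalk.nil v, rfl, by rw [ClosedWalk.cycle_nil]; simp⟩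
    | insert e s hes ih =>
      obtain ⟨c, hc, hc'⟩ := ih
      obtain ⟨c₁, hc₁, hc₁'⟩ := hint (hG.edgeLoop v e) rfl (x.1 e)
      exact ⟨c₁.append c (hc₁.trans hc.symm), hc₁, by
        rw [ClosedWalk.cycle_append, hc', hc₁', Finset.sum_insert hes]⟩
  obtain ⟨c, hc, hc'⟩ := hsum Finset.univ
  exact ⟨c, hc, by rw [hc', ← hG.eq_sum_edgeLoop v x]⟩

end Concatenate

section Cast
variable [Fintype E]
open RotationSystem

lemma castCycle_cycle (c : G.ClosedWalk) : castCycle (c.cycle ℤ) = c.cycle ℝ := by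
  refine Subtype.ext ?_
  change castChain E (c.cycle ℤ).1 = _
  simp only [ClosedWalk.cycle]
  induction c.darts with
  | nil => simp
  | cons d l ih =>
    rw [List.map_cons, List.sum_cons, map_add, ih, List.map_cons, List.sum_cons]
    congr 1
    ext e
    obtain ⟨e', b⟩ := d
    cases b <;> by_cases h : e = e' <;> simp [castChain, Dart.chain, h]

lemma RotationSystem.toReal_cls (R : G.RotationSystem) (x : G.cycles ℤ) :
    R.toReal (R.cls ℤ x) = R.cls ℝ (castCycle x) := rfl

lemma RotationSystem.span_range_toReal (R : G.RotationSystem) (hG : G.IsConnected) :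
    Submodule.span ℝ (Set.range R.toReal) = ⊤ := by
  rw [eq_top_iff]
  rintro p -
  obtain ⟨x, rfl⟩ := Submodule.Quotient.mk_surjective _ p
  obtain ⟨v⟩ := hG.1
  rw [hG.eq_sum_edgeLoop v x]
  have : (Submodule.Quotient.mk (∑ e, x.1 e • (hG.edgeLoop v e).cycle ℝ) : R.H₁ ℝ) =
      ∑ e, x.1 e • R.toReal (R.cls ℤ ((hG.edgeLoop v e).cycle ℤ)) := by
    simp only [toReal_cls, castCycle_cycle]
    exact (map_sum (Submodule.mkQ _) _ _).trans (Finset.sum_congr rfl fun e _ => rfl)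
  rw [this]
  exact Submodule.sum_mem _ fun e _ => Submodule.smul_mem _ _ (Submodule.subset_span ⟨_, rfl⟩)

end Cast

end Multigraph

/-! ### The intersection form -/

namespace Multigraph
open Dart
variable {V E : Type*} {G : Multigraph V E}

namespace RotationSystem

section Position
variable [Finite E] (R : G.RotationSystem)

/-- The position of an oriented edge in a linear order of the oriented edges at its source that is
compatible with the rotation. -/
noncomputable def pos : Dart E → ℕ := R.rot.exists_cycle_rank.choose_spec.choose

lemma eq_of_pos_eq {a b : Dart E} (h : G.source a = G.source b) (hp : R.pos a = R.pos b) :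
    a = b := by
  obtain ⟨h1, h2, h3, h4⟩ := R.rot.exists_cycle_rank.choose_spec.choose_spec
  rw [← h2 a, ← h2 b, h1 a b ((R.sameCycle_iff _ _).2 h)]
  exact congrArg (fun n => R.rot^[n] _) hp

lemma pos_rot (a : Dart E) : R.pos (R.rot a) = R.pos a + 1 ∨
    (R.pos (R.rot a) = 0 ∧ ∀ b, G.source b = G.source a → R.pos b ≤ R.pos a) := by
  obtain ⟨h1, h2, h3, h4⟩ := R.rot.exists_cycle_rank.choose_spec.choose_spec
  refine (h4 a).imp id fun h => ⟨h.1, fun b hb => ?_⟩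
  have h5 := h3 b
  rw [h1 b a ((R.sameCycle_iff _ _).2 hb), ← h.2] at h5
  exact Nat.lt_succ_iff.1 h5

end Position

section Form
variable [Fintype E] (R : G.RotationSystem) {A : Type*} [CommRing A]

open Classical in
/-- The corner potential of a chain: the flow out of the oriented edges at the same vertex that do
not precede `a`. -/
noncomputable def cornerPot (y : E → A) (a : Dart E) : A :=
  ∑ b : Dart E, if G.source b = G.source a ∧ R.pos a ≤ R.pos b then coeff y b else 0

lemma cornerPot_add (y z : E → A) (a : Dart E) :
    R.cornerPot (y + z) a = R.cornerPot y a + R.cornerPot z a := by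
  classical
  rw [cornerPot, cornerPot, cornerPot, ← Finset.sum_add_distrib]
  refine Finset.sum_congr rfl fun b _ => ?_
  rw [coeff_add]; split_ifs <;> simp

lemma cornerPot_smul (r : A) (z : E → A) (a : Dart E) :
    R.cornerPot (r • z) a = r * R.cornerPot z a := by
  classical
  rw [cornerPot, cornerPot, Finset.mul_sum]
  refine Finset.sum_congr rfl fun b _ => ?_
  rw [coeff_smul]; split_ifs <;> simp

/-- Passing from `a` to `R.rot a` drops the term of `a`. Where the linear order closes up, the
potential restarts at the total flow out of the vertex, which is zero for a cycle. -/
lemma cornerPot_sub_rot {y : E → A} (hy : y ∈ G.cycles A) (a : Dart E) :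
    R.cornerPot y a - R.cornerPot y (R.rot a) = coeff y a := by
  classical
  have hsingle : coeff y a = ∑ b : Dart E, if b = a then coeff y b else 0 := by simp
  rcases R.pos_rot a with h | ⟨h, hmax⟩
  · rw [hsingle, cornerPot, cornerPot, ← Finset.sum_sub_distrib]
    refine Finset.sum_congr rfl fun b _ => ?_
    rw [source_rot, h]
    by_cases hb : G.source b = G.source a
    · by_cases hba : b = a
      · subst hba; simp
      · have : R.pos a ≤ R.pos b ↔ R.pos a + 1 ≤ R.pos b :=
          ⟨fun h' => lt_of_le_of_ne h' fun h'' => hba (R.eq_of_pos_eq hb h''.symm), fun h' => by omega⟩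
        simp [hba, hb, this]
    · have hba : b ≠ a := fun h' => hb (by rw [h'])
      simp [hb, hba]
  · have h0 : R.cornerPot y (R.rot a) = 0 := by
      refine Eq.trans ?_ ((G.mem_cycles_iff y).1 hy (G.source a))
      rw [cornerPot]
      refine Finset.sum_congr rfl fun b _ => ?_
      rw [source_rot, h]; simp
    rw [h0, sub_zero, hsingle, cornerPot]
    refine Finset.sum_congr rfl fun b _ => ?_
    by_cases hba : b = a
    · subst hba; simp
    · have : ¬ (G.source b = G.source a ∧ R.pos a ≤ R.pos b) := fun h' =>
        hba (R.eq_of_pos_eq h'.1 (le_antisymm (hmax b h'.1) h'.2))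
      simp [this, hba]

variable (A) in
/-- The intersection form on chains. -/
noncomputable def intForm : (E → A) →ₗ[A] (E → A) →ₗ[A] A :=
  LinearMap.mk₂ A
    -- The corners of `R.rot (e, true)` and `(e, false)` sit at the two ends of `e` in the same
    -- face, on one side of `e`. The corner potential of `y` is a primitive of `y` near each vertex,
    -- and the difference measures how the primitives at the two ends disagree.
    (fun x y => ∑ e, x e * (R.cornerPot y (R.rot (e, true)) - R.cornerPot y (e, false)))
    (fun x x' y => by rw [← Finset.sum_add_distrib]; simp [add_mul])
    (fun r x y => by rw [smul_eq_mul, Finset.mul_sum]; simp [mul_assoc])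
    (fun x y y' => by
      rw [← Finset.sum_add_distrib]
      refine Finset.sum_congr rfl fun e _ => ?_
      rw [cornerPot_add, cornerPot_add]; ring)
    (fun r x y => by
      rw [smul_eq_mul, Finset.mul_sum]
      refine Finset.sum_congr rfl fun e _ => ?_
      rw [cornerPot_smul, cornerPot_smul]; ring)

lemma intForm_apply (x y : E → A) : R.intForm A x y =
    ∑ e, x e * (R.cornerPot y (R.rot (e, true)) - R.cornerPot y (e, false)) := rfl

/-- For a boundary of `z`, the corner potential and `z` have the same jumps, so they differ by a
function of the vertex. Its differences sum to zero against the cycle `x`. -/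
lemma intForm_boundary₂ [Nonempty E] {x : E → A} (hx : x ∈ G.cycles A)
    (z : R.Face → A) : R.intForm A x (R.boundary₂ A z) = 0 := by
  have hz : R.boundary₂ A z ∈ G.cycles A := R.boundary₁_boundary₂ A z
  have hfac : (fun a => R.cornerPot (R.boundary₂ A z) a - z (R.faceOf a)).FactorsThrough
      G.source := fun a b hab =>
    R.rot.apply_eq_of_sameCycle (fun a => R.cornerPot (R.boundary₂ A z) a - z (R.faceOf a)) (fun d => by
      have h1 := R.cornerPot_sub_rot hz d
      rw [coeff_boundary₂] at h1
      linear_combination -h1) ((R.sameCycle_iff _ _).2 hab)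
  obtain ⟨h, hh⟩ := (Function.factorsThrough_iff _).1 hfac
  have hh' : ∀ a, R.cornerPot (R.boundary₂ A z) a = z (R.faceOf a) + h (G.source a) := fun a => by
    have := congrFun hh a
    simp only [Function.comp_apply] at this
    rw [← this]; ring
  rw [intForm_apply, ← sum_mul_src_sub_tgt hx h]
  refine Finset.sum_congr rfl fun e _ => ?_
  rw [hh', hh', faceOf_rot, source_rot]
  simp [Dart.rev, source]

/-- Twice the intersection number of two cycles, as a sum of local contributions at the vertices. -/
lemma two_mul_intForm [DecidableEq V] (x : E → A) {y : E → A} (hy : y ∈ G.cycles A) :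
    2 * R.intForm A x y = ∑ a : Dart E, ∑ b : Dart E, if G.source b = G.source a then
      ((Int.sign ((R.pos b : ℤ) - R.pos a) : ℤ) : A) * (coeff x a * coeff y b) else 0 := by
  classical
  -- Symmetrization over the two sides of an edge: `2 * P a - coeff y a` is the sum of the corner
  -- potential `P` at `a` and at `R.rot a`.
  have h1 : 2 * R.intForm A x y =
      ∑ a : Dart E, coeff x a * (2 * R.cornerPot y a - coeff y a) := by
    rw [intForm_apply, sum_dart, Finset.mul_sum]
    refine Finset.sum_congr rfl fun e _ => ?_
    have h1 := R.cornerPot_sub_rot hy (e, true)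
    simp only [coeff_true, coeff_false] at h1 ⊢
    linear_combination (-2 * x e) * h1
  rw [h1]
  refine Finset.sum_congr rfl fun a _ => ?_
  have h0 := (G.mem_cycles_iff y).1 hy (G.source a)
  have h2 : 2 * R.cornerPot y a - coeff y a = ∑ b : Dart E, if G.source b = G.source a then
      ((Int.sign ((R.pos b : ℤ) - R.pos a) : ℤ) : A) * coeff y b else 0 := by
    have hsingle : coeff y a = ∑ b : Dart E, if b = a then coeff y b else 0 := by simp
    rw [← sub_eq_zero]
    refine Eq.trans ?_ h0
    rw [hsingle, cornerPot, Finset.mul_sum, ← Finset.sum_sub_distrib, ← Finset.sum_sub_distrib]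
    refine Finset.sum_congr rfl fun b _ => ?_
    by_cases hb : G.source b = G.source a
    · rcases lt_trichotomy (R.pos a) (R.pos b) with h | h | h
      · have hba : b ≠ a := fun h' => by subst h'; omega
        have hs : Int.sign ((R.pos b : ℤ) - R.pos a) = 1 := Int.sign_eq_one_of_pos (by omega)
        simp [hb, h.le, hba, hs]; ring
      · have hba : b = a := R.eq_of_pos_eq hb h.symm
        subst hba; simp; ring
      · have hba : b ≠ a := fun h' => by subst h'; omega
        have hs : Int.sign ((R.pos b : ℤ) - R.pos a) = -1 := Int.sign_eq_neg_one_of_neg (by omega)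
        simp [hb, not_le.2 h, hba, hs]
    · have hba : b ≠ a := fun h' => hb (by rw [h'])
      simp [hb, hba]
  rw [h2, Finset.mul_sum]
  refine Finset.sum_congr rfl fun b _ => ?_
  split_ifs <;> ring

/-- The sign in the local formula for twice the form is antisymmetric. Over `ℤ` the factor two can
be cancelled. -/
lemma intForm_antisymm {x y : E → ℤ} (hx : x ∈ G.cycles ℤ) (hy : y ∈ G.cycles ℤ) :
    R.intForm ℤ x y = - R.intForm ℤ y x := by
  classical
  have h1 := R.two_mul_intForm x hy
  have h2 := R.two_mul_intForm y hx
  rw [Finset.sum_comm] at h2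
  have h3 : 2 * R.intForm ℤ x y + 2 * R.intForm ℤ y x = 0 := by
    rw [h1, h2, ← Finset.sum_add_distrib]
    refine Finset.sum_eq_zero fun a _ => ?_
    rw [← Finset.sum_add_distrib]
    refine Finset.sum_eq_zero fun b _ => ?_
    by_cases hb : G.source b = G.source a
    · have : Int.sign ((R.pos b : ℤ) - R.pos a) = - Int.sign ((R.pos a : ℤ) - R.pos b) := by
        rw [← Int.sign_neg]; congr 1; ring
      simp only [hb, if_true, this, Int.cast_id]
      ring
    · simp [hb, Ne.symm hb]
  omega

/-- The intersection form is nondegenerate modulo boundaries. -/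
lemma exists_boundary₂_of_intForm_eq_zero (hG : G.IsConnected) {y : E → A} (hy : y ∈ G.cycles A)
    (h : ∀ x ∈ G.cycles A, R.intForm A x y = 0) : ∃ z : R.Face → A, R.boundary₂ A z = y := by
  classical
  obtain ⟨v⟩ := hG.1
  -- Since `ψ` vanishes on all cycles, it is the coboundary of its integral `H` along paths.
  -- Corrected by `H`, the local primitives of `y` agree along faces and define the required face
  -- function.
  let ψ : E → A := fun e => R.cornerPot y (R.rot (e, true)) - R.cornerPot y (e, false)
  let H : V → A := fun u => ∑ e, hG.pathChain A v u e * ψ e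
  have hH : ∀ e, ψ e = H (G.tgt e) - H (G.src e) := by
    intro e
    have h1 := h _ ((hG.edgeLoop v e).cycle A).2
    rw [hG.cycle_edgeLoop A v e, intForm_apply] at h1
    have h2 : ∑ e', (Dart.chain A (e, true) : E → A) e' * ψ e' = ψ e := by
      simp [Dart.chain, Pi.single_apply]
    rw [← h2, eq_sub_iff_add_eq, ← sub_eq_zero, ← h1, ← Finset.sum_add_distrib,
      ← Finset.sum_sub_distrib]
    refine Finset.sum_congr rfl fun e' _ => ?_
    simp only [Pi.add_apply, Pi.sub_apply, ψ]
    ring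
  have hQ : ∀ a : Dart E, R.cornerPot y (R.rot a) + H (G.source a) =
      R.cornerPot y a.rev + H (G.source a.rev) := by
    rintro ⟨e, b⟩
    have h1 := hH e
    have h2 := R.cornerPot_sub_rot hy (e, true)
    have h3 := R.cornerPot_sub_rot hy (e, false)
    simp only [coeff_true, coeff_false, ψ] at h1 h2 h3
    cases b
    · simp only [source, Dart.rev, Bool.not_false, if_true, Bool.false_eq_true, if_false]
      linear_combination -h1 - h2 - h3
    · simp only [source, Dart.rev, Bool.not_true, if_true, Bool.false_eq_true, if_false]
      linear_combination h1
  let Q : Dart E → A := fun a => R.cornerPot y a + H (G.source a)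
  have hQ' : ∀ d, Q (R.facePerm d) = Q d := by
    intro d
    have := hQ d.rev
    rw [rev_rev] at this
    simp only [Q, facePerm_apply, source_rot]
    exact this
  let z : R.Face → A :=
    Quotient.lift Q fun a b hab => R.facePerm.apply_eq_of_sameCycle Q hQ' hab
  have hz : ∀ a, z (R.faceOf a) = Q a := fun a => rfl
  refine ⟨z, ext_coeff fun a => ?_⟩
  rw [coeff_boundary₂, hz, hz, ← R.cornerPot_sub_rot hy a]
  simp only [Q, source_rot]
  ring

end Form

section Integral
variable [Fintype E] {R : G.RotationSystem}

/-- The intersection form on integral homology, expressed by a determinant in a basis. -/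
theorem IsTorus.exists_intForm_eq_det [Finite V] (hT : R.IsTorus)
    (b : Module.Basis (Fin 2) ℤ (R.H₁ ℤ)) : ∃ D : ℤ, D ≠ 0 ∧ ∀ x y : G.cycles ℤ,
      R.intForm ℤ x.1 y.1 = D * (b.repr (R.cls ℤ x) 0 * b.repr (R.cls ℤ y) 1 -
        b.repr (R.cls ℤ x) 1 * b.repr (R.cls ℤ y) 0) := by
  have := hT.nonempty_edge
  have hzero : ∀ x y y' : G.cycles ℤ, R.cls ℤ y = R.cls ℤ y' →
      R.intForm ℤ x.1 y.1 = R.intForm ℤ x.1 y'.1 := by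
    intro x y y' hyy'
    obtain ⟨z, hz⟩ := (R.cls_eq_iff _ _).1 hyy'
    rw [← sub_eq_zero, ← map_sub, ← hz, R.intForm_boundary₂ x.2]
  have hzero' : ∀ x x' y : G.cycles ℤ, R.cls ℤ x = R.cls ℤ x' →
      R.intForm ℤ x.1 y.1 = R.intForm ℤ x'.1 y.1 := by
    intro x x' y hxx'
    rw [R.intForm_antisymm x.2 y.2, hzero y x x' hxx', ← R.intForm_antisymm x'.2 y.2]
  have hself : ∀ x : G.cycles ℤ, R.intForm ℤ x.1 x.1 = 0 := fun x => by
    have := R.intForm_antisymm x.2 x.2; omega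
  obtain ⟨z₀, hz₀⟩ := Submodule.Quotient.mk_surjective _ (b 0)
  obtain ⟨z₁, hz₁⟩ := Submodule.Quotient.mk_surjective _ (b 1)
  have hexp : ∀ x : G.cycles ℤ, R.cls ℤ x =
      R.cls ℤ (b.repr (R.cls ℤ x) 0 • z₀ + b.repr (R.cls ℤ x) 1 • z₁) := by
    intro x
    change _ = b.repr (R.cls ℤ x) 0 • R.cls ℤ z₀ + b.repr (R.cls ℤ x) 1 • R.cls ℤ z₁
    change R.cls ℤ z₀ = _ at hz₀
    change R.cls ℤ z₁ = _ at hz₁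
    rw [hz₀, hz₁]
    conv_lhs => rw [← b.sum_repr (R.cls ℤ x)]
    rw [Fin.sum_univ_two]
  have hformula : ∀ x y : G.cycles ℤ,
      R.intForm ℤ x.1 y.1 = R.intForm ℤ z₀.1 z₁.1 *
        (b.repr (R.cls ℤ x) 0 * b.repr (R.cls ℤ y) 1 -
          b.repr (R.cls ℤ x) 1 * b.repr (R.cls ℤ y) 0) := by
    intro x y
    rw [hzero x y _ (hexp y), hzero' x _ _ (hexp x)]
    simp only [Submodule.coe_add, Submodule.coe_smul, map_add, map_smul, LinearMap.add_apply,
      LinearMap.smul_apply, hself, smul_eq_mul]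
    rw [R.intForm_antisymm z₁.2 z₀.2]
    ring
  -- `D` is the intersection number of the two basis classes. If it were zero, the first would lie
  -- in the radical of the form and so be zero.
  refine ⟨_, fun hD => ?_, hformula⟩
  obtain ⟨z, hz⟩ := R.exists_boundary₂_of_intForm_eq_zero hT.1 z₀.2 (fun x hx => by
    have := hformula ⟨x, hx⟩ z₀
    rw [hD, zero_mul] at this; exact this)
  have h0 : R.cls ℤ z₀ = R.cls ℤ 0 := (R.cls_eq_iff _ _).2 ⟨z, by rw [hz]; simp⟩
  exact b.ne_zero 0 (hz₀.symm.trans h0)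

/-- If `n • y` is a boundary, then `n` times each intersection number with `y` is zero. These are
integers, so `y` is in the radical and is a boundary. -/
lemma eq_zero_of_smul_eq_zero (R : G.RotationSystem) [Nonempty E] (hG : G.IsConnected) (n : ℤ)
    (hn : n ≠ 0) (α : R.H₁ ℤ) (h : n • α = 0) : α = 0 := by
  obtain ⟨y, rfl⟩ := Submodule.Quotient.mk_surjective _ α
  have h1 : R.cls ℤ (n • y) = R.cls ℤ 0 := h
  obtain ⟨z, hz⟩ := (R.cls_eq_iff _ _).1 h1
  obtain ⟨z', hz'⟩ := R.exists_boundary₂_of_intForm_eq_zero hG y.2 (fun x hx => by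
    have h2 : n * R.intForm ℤ x y.1 = 0 := by
      have h3 := R.intForm_boundary₂ hx z
      rw [hz, show ((n • y : G.cycles ℤ) : E → ℤ) - (0 : G.cycles ℤ).1 = n • y.1 from sub_zero _,
        map_smul] at h3
      exact h3
    exact (mul_eq_zero.1 h2).resolve_left hn)
  exact (R.cls_eq_iff y 0).2 ⟨z', by rw [hz']; simp⟩

theorem IsTorus.exists_basis [Fintype V] (hT : R.IsTorus) :
    Nonempty (Module.Basis (Fin 2) ℤ (R.H₁ ℤ)) := by
  have := hT.nonempty_edge
  have : Module.IsTorsionFree ℤ (R.H₁ ℤ) := .of_smul_eq_zero fun n α h => by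
    by_cases hn : n = 0
    · exact Or.inl hn
    · exact Or.inr (eq_zero_of_smul_eq_zero R hT.1 n hn α h)
  have : Module.Free ℤ (R.H₁ ℤ) := Module.free_of_finite_type_torsion_free'
  exact ⟨Module.finBasisOfFinrankEq ℤ _ (hT.finrank_H₁ ℤ)⟩

theorem IsTorus.exists_realBasis [Fintype V] (hT : R.IsTorus)
    (bZ : Module.Basis (Fin 2) ℤ (R.H₁ ℤ)) : ∃ bR, R.IsIntegralBasis bZ bR := by
  have hspan : ⊤ ≤ Submodule.span ℝ (Set.range fun i => R.toReal (bZ i)) := by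
    rw [← R.span_range_toReal hT.1, Submodule.span_le]
    rintro _ ⟨α, rfl⟩
    rw [← bZ.sum_repr α, map_sum]
    refine Submodule.sum_mem _ fun i _ => ?_
    rw [LinearMap.map_smulₛₗ]
    exact Submodule.smul_mem _ _ (Submodule.subset_span ⟨i, rfl⟩)
  refine ⟨basisOfTopLeSpanOfCardEqFinrank _ hspan (by rw [hT.finrank_H₁ ℝ]; simp), fun i => ?_⟩
  simp

lemma IsIntegralBasis.repr_toReal {bZ : Module.Basis (Fin 2) ℤ (R.H₁ ℤ)}
    {bR : Module.Basis (Fin 2) ℝ (R.H₁ ℝ)} (hb : R.IsIntegralBasis bZ bR) (α : R.H₁ ℤ) (i : Fin 2) :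
    bR.repr (R.toReal α) i = (bZ.repr α i : ℝ) := by
  have : R.toReal α = ∑ i, ((bZ.repr α i : ℤ) : ℝ) • bR i := by
    conv_lhs => rw [← bZ.sum_repr α, map_sum]
    refine Finset.sum_congr rfl fun i _ => ?_
    rw [LinearMap.map_smulₛₗ, hb i]
    rfl
  rw [this, bR.repr_sum_self]

end Integral
end RotationSystem
end Multigraph

/-! ### Intersection numbers and homology classes of simple cycles -/

/-- Here `p`, `r` stand for the positions of the two ends of a simple cycle at a vertex, and `q`,
`u` for those of another. Independent signs could add up to `4`, but that would require `u < p < q <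
r < u` or the reverse. -/
lemma abs_sign_sub_le_two (p q r u : ℤ) :
    |Int.sign (q - p) - Int.sign (u - p) - Int.sign (q - r) + Int.sign (u - r)| ≤ 2 := by
  have key : ∀ z : ℤ, (0 < z ∧ Int.sign z = 1) ∨ (z = 0 ∧ Int.sign z = 0) ∨
      (z < 0 ∧ Int.sign z = -1) := by
    intro z
    rcases lt_trichotomy z 0 with h | h | h
    · exact Or.inr (Or.inr ⟨h, Int.sign_eq_neg_one_of_neg h⟩)
    · exact Or.inr (Or.inl ⟨h, by simp [h]⟩)
    · exact Or.inl ⟨h, Int.sign_eq_one_of_pos h⟩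
  have h1 := key (q - p)
  have h2 := key (u - p)
  have h3 := key (q - r)
  have h4 := key (u - r)
  rw [abs_le]
  omega

namespace Multigraph
open Dart
variable {V E : Type*} {G : Multigraph V E}

lemma IsWalk.cons_map_target {l : List (Dart E)} : ∀ {u v : V}, G.IsWalk u v l →
    u :: l.map G.target = l.map G.source ++ [v] := by
  induction l with
  | nil => intro u v h; simp [show u = v from h]
  | cons d l ih =>
    rintro u v ⟨rfl, h⟩
    rw [List.map_cons, List.map_cons, ih h, List.cons_append]

lemma ClosedWalk.perm_target (c : G.ClosedWalk) :
    (c.darts.map G.target).Perm (c.darts.map G.source) := by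
  refine (List.perm_cons c.base).1 ?_
  rw [c.isWalk.cons_map_target]
  exact List.perm_append_singleton _ _

/-- The vertices of a closed walk (with at least one edge). -/
def ClosedWalk.support (c : G.ClosedWalk) : Set V := {v | v ∈ c.darts.map G.source}

lemma ClosedWalk.source_mem_support {c : G.ClosedWalk} {d : Dart E} (h : d ∈ c.darts) :
    G.source d ∈ c.support := List.mem_map_of_mem h

lemma ClosedWalk.target_mem_support {c : G.ClosedWalk} {d : Dart E} (h : d ∈ c.darts) :
    G.target d ∈ c.support := c.perm_target.subset (List.mem_map_of_mem h)

section
variable [Fintype E] {A : Type*} [CommRing A]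

open Classical in
lemma ClosedWalk.coeff_cycle (c : G.ClosedWalk) (a : Dart E) :
    coeff (c.cycle A).1 a = (c.darts.count a : A) - c.darts.count a.rev :=
  coeff_sum_chain _ _

lemma ClosedWalk.coeff_cycle_of_notMem_support (c : G.ClosedWalk) {a : Dart E}
    (h : G.source a ∉ c.support) : coeff (c.cycle A).1 a = 0 := by
  classical
  have h1 : a ∉ c.darts := fun h' => h (ClosedWalk.source_mem_support h')
  have h2 : a.rev ∉ c.darts := fun h' => h (by
    have := ClosedWalk.target_mem_support h'
    rwa [target_rev] at this)
  rw [coeff_cycle, List.count_eq_zero_of_not_mem h1, List.count_eq_zero_of_not_mem h2]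
  simp
end

namespace ClosedWalk.IsSimpleCycle
variable {c : G.ClosedWalk}

lemma eq_of_source_eq (hc : c.IsSimpleCycle) {a b : Dart E} (ha : a ∈ c.darts) (hb : b ∈ c.darts)
    (h : G.source a = G.source b) : a = b := List.inj_on_of_nodup_map hc.2.1 ha hb h

lemma eq_of_target_eq (hc : c.IsSimpleCycle) {a b : Dart E} (ha : a ∈ c.darts) (hb : b ∈ c.darts)
    (h : G.target a = G.target b) : a = b :=
  List.inj_on_of_nodup_map (c.perm_target.nodup_iff.2 hc.2.1) ha hb h

lemma nodup_darts (hc : c.IsSimpleCycle) : c.darts.Nodup := hc.2.1.of_map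

lemma rev_notMem (hc : c.IsSimpleCycle) {a : Dart E} (ha : a ∈ c.darts) : a.rev ∉ c.darts := fun h =>
  rev_ne a (List.inj_on_of_nodup_map hc.2.2 h ha rfl)

variable [Fintype E] {A : Type*} [CommRing A]

open Classical in
lemma coeff_cycle (hc : c.IsSimpleCycle) (a : Dart E) : coeff (c.cycle A).1 a =
    (if a ∈ c.darts then 1 else 0) - (if a.rev ∈ c.darts then 1 else 0) := by
  have : ∀ a, ((c.darts.count a : ℕ) : A) = if a ∈ c.darts then 1 else 0 := fun a => by
    split_ifs with h
    · rw [List.count_eq_one_of_mem hc.nodup_darts h, Nat.cast_one]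
    · rw [List.count_eq_zero_of_not_mem h, Nat.cast_zero]
  rw [ClosedWalk.coeff_cycle, this, this]

open Classical in
/-- At each of its vertices, a simple cycle leaves through one oriented edge and enters through the
reverse of another one. -/
lemma exists_local (hc : c.IsSimpleCycle) {v : V} (hv : v ∈ c.support) : ∃ t s : Dart E, G.source t = v ∧
    G.source s = v ∧ ∀ a, G.source a = v →
      coeff (c.cycle A).1 a = (if a = t then 1 else 0) - (if a = s then 1 else 0) := by
  obtain ⟨t, ht, htv⟩ := List.mem_map.1 (show v ∈ c.darts.map G.source from hv)
  obtain ⟨s, hs, hsv⟩ := List.mem_map.1 (c.perm_target.mem_iff.2 hv)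
  refine ⟨t, s.rev, htv, hsv, fun a ha => ?_⟩
  · have h1 : a ∈ c.darts ↔ a = t :=
      ⟨fun h => hc.eq_of_source_eq h ht (ha.trans htv.symm), fun h => h ▸ ht⟩
    have h2 : a.rev ∈ c.darts ↔ a = s.rev :=
      ⟨fun h => by
        rw [← hc.eq_of_target_eq h hs (by rw [target_rev, ha, hsv]), rev_rev],
        fun h => by rw [h, rev_rev]; exact hs⟩
    simp only [hc.coeff_cycle, h1, h2]

end ClosedWalk.IsSimpleCycle

namespace RotationSystem
variable [Fintype E] (R : G.RotationSystem)

open Classical in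
/-- The local contribution at `v` to twice the intersection number. -/
noncomputable def localInt (x y : E → ℤ) (v : V) : ℤ :=
  ∑ a : Dart E, ∑ b : Dart E, if G.source a = v ∧ G.source b = v then
    Int.sign ((R.pos b : ℤ) - R.pos a) * (coeff x a * coeff y b) else 0

lemma two_mul_intForm_eq_sum_localInt [Fintype V] (x : E → ℤ) {y : E → ℤ}
    (hy : y ∈ G.cycles ℤ) : 2 * R.intForm ℤ x y = ∑ v, R.localInt x y v := by
  classical
  rw [R.two_mul_intForm x hy]
  simp only [localInt]
  symm
  rw [Finset.sum_comm]
  refine Finset.sum_congr rfl fun a _ => ?_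
  rw [Finset.sum_comm]
  refine Finset.sum_congr rfl fun b _ => ?_
  rw [Finset.sum_eq_single (G.source a)]
  · simp
  · intro v _ hv; simp [hv.symm]
  · simp

lemma localInt_eq_zero {c c' : G.ClosedWalk} {v : V} (h : v ∉ c.support ∨ v ∉ c'.support) :
    R.localInt (c.cycle ℤ).1 (c'.cycle ℤ).1 v = 0 := by
  rw [localInt]
  refine Finset.sum_eq_zero fun a _ => ?_
  refine Finset.sum_eq_zero fun b _ => ?_
  split_ifs with hab
  · rcases h with h | h
    · rw [c.coeff_cycle_of_notMem_support (hab.1 ▸ h)]; simp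
    · rw [c'.coeff_cycle_of_notMem_support (hab.2 ▸ h)]; simp
  · rfl

/-- Used in the contrapositive too: cycles with nonzero intersection number share a vertex, where
they can be joined. -/
lemma intForm_eq_zero_of_disjoint [Fintype V] {c c' : G.ClosedWalk}
    (h : Disjoint c.support c'.support) : R.intForm ℤ (c.cycle ℤ).1 (c'.cycle ℤ).1 = 0 := by
  have := R.two_mul_intForm_eq_sum_localInt (c.cycle ℤ).1 (c'.cycle ℤ).2
  rw [Finset.sum_eq_zero fun v _ => R.localInt_eq_zero (by
    by_contra hv
    push Not at hv
    exact Set.disjoint_left.1 h hv.1 hv.2)] at this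
  omega

lemma abs_localInt_le {c c' : G.ClosedWalk} (hc : c.IsSimpleCycle) (hc' : c'.IsSimpleCycle)
    (v : V) : |R.localInt (c.cycle ℤ).1 (c'.cycle ℤ).1 v| ≤ 2 := by
  classical
  by_cases hv : v ∉ c.support ∨ v ∉ c'.support
  · rw [R.localInt_eq_zero hv]; simp
  push Not at hv
  obtain ⟨t, s, ht, hs, hx⟩ := hc.exists_local (A := ℤ) hv.1
  obtain ⟨t', s', ht', hs', hy⟩ := hc'.exists_local (A := ℤ) hv.2
  have key : R.localInt (c.cycle ℤ).1 (c'.cycle ℤ).1 v =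
      ∑ a : Dart E, ∑ b : Dart E, Int.sign ((R.pos b : ℤ) - R.pos a) *
        (((if a = t then 1 else 0) - (if a = s then 1 else 0)) *
          ((if b = t' then 1 else 0) - (if b = s' then 1 else 0))) := by
    refine Finset.sum_congr rfl fun a _ => Finset.sum_congr rfl fun b _ => ?_
    by_cases ha : G.source a = v
    · by_cases hb : G.source b = v
      · rw [if_pos ⟨ha, hb⟩, hx a ha, hy b hb]
      · have h1 : b ≠ t' := fun h => hb (h ▸ ht')
        have h2 : b ≠ s' := fun h => hb (h ▸ hs')
        simp [hb, h1, h2]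
    · have h1 : a ≠ t := fun h => ha (h ▸ ht)
      have h2 : a ≠ s := fun h => ha (h ▸ hs)
      simp [ha, h1, h2]
  have hin : ∀ a, ∑ b : Dart E, Int.sign ((R.pos b : ℤ) - R.pos a) *
        (((if a = t then 1 else 0) - (if a = s then 1 else 0)) *
          ((if b = t' then 1 else 0) - (if b = s' then 1 else 0))) =
      ((if a = t then 1 else 0) - (if a = s then 1 else 0)) *
        (Int.sign ((R.pos t' : ℤ) - R.pos a) - Int.sign ((R.pos s' : ℤ) - R.pos a)) := by
    intro a
    have h1 : ∀ b : Dart E, Int.sign ((R.pos b : ℤ) - R.pos a) *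
        (((if a = t then 1 else 0) - (if a = s then 1 else 0)) *
          ((if b = t' then 1 else 0) - (if b = s' then 1 else 0))) =
        ((if a = t then 1 else 0) - (if a = s then 1 else 0)) *
          ((if b = t' then Int.sign ((R.pos b : ℤ) - R.pos a) else 0) -
            (if b = s' then Int.sign ((R.pos b : ℤ) - R.pos a) else 0)) := fun b => by
      split_ifs <;> ring
    simp_rw [h1]
    rw [← Finset.mul_sum, Finset.sum_sub_distrib]
    simp
  have hout : ∀ f : Dart E → ℤ, ∑ a : Dart E,
      ((if a = t then 1 else 0) - (if a = s then 1 else 0)) * f a = f t - f s := by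
    intro f
    simp [sub_mul]
  rw [key]
  simp_rw [hin]
  rw [hout]
  convert abs_sign_sub_le_two (R.pos t) (R.pos t') (R.pos s) (R.pos s') using 2
  ring

/-- Two simple cycles have intersection number at most the number of vertices. -/
lemma abs_intForm_le_card [Fintype V] {c c' : G.ClosedWalk} (hc : c.IsSimpleCycle)
    (hc' : c'.IsSimpleCycle) :
    |R.intForm ℤ (c.cycle ℤ).1 (c'.cycle ℤ).1| ≤ Fintype.card V := by
  have h1 := R.two_mul_intForm_eq_sum_localInt (c.cycle ℤ).1 (c'.cycle ℤ).2
  have h2 : |2 * R.intForm ℤ (c.cycle ℤ).1 (c'.cycle ℤ).1| ≤ ∑ _v : V, 2 := by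
    rw [h1]
    exact (Finset.abs_sum_le_sum_abs _ _).trans
      (Finset.sum_le_sum fun v _ => R.abs_localInt_le hc hc' v)
  rw [Finset.sum_const, Finset.card_univ, abs_mul] at h2
  simp only [nsmul_eq_mul, Nat.abs_ofNat] at h2
  linarith

/-- The homology class of a simple cycle is zero or primitive. -/
theorem cls_eq_zero_of_eq_smul {c : G.ClosedWalk} (hc : c.IsSimpleCycle) {k : ℕ} (hk : 2 ≤ k)
    {β : R.H₁ ℤ} (h : R.cls ℤ (c.cycle ℤ) = (k : ℤ) • β) : R.cls ℤ (c.cycle ℤ) = 0 := by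
  classical
  obtain ⟨z, rfl⟩ := Submodule.Quotient.mk_surjective _ β
  have h1 : R.cls ℤ (c.cycle ℤ) = R.cls ℤ ((k : ℤ) • z) := h
  obtain ⟨y, hy⟩ := (R.cls_eq_iff _ _).1 h1
  have : Fact (1 < k) := ⟨by omega⟩
  -- Modulo `k` the multiple of `z` disappears, and the cycle is the boundary of `Y`: `Y` jumps by
  -- one across the edges of `c` and nowhere else.
  let Y : Dart E → ZMod k := fun a => (y (R.faceOf a) : ZMod k)
  have hY : ∀ a, ((coeff (c.cycle ℤ).1 a : ℤ) : ZMod k) = Y a - Y (R.rot a) := by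
    intro a
    have h2 := R.coeff_boundary₂ y a
    rw [hy, coeff_sub, show ((k : ℤ) • z : G.cycles ℤ).1 = (k : ℤ) • z.1 from rfl, coeff_smul] at h2
    have h3 := congrArg (Int.cast : ℤ → ZMod k) h2
    push_cast at h3
    simpa using h3
  have hYrot : ∀ a, Y (R.rot a) = Y a.rev := fun a => by simp only [Y, faceOf_rot]
  -- At the vertex between consecutive edges `d` and `d'`, turning from `R.rot d.rev` to `d'` sweeps
  -- the corners on one side of `c`, and no edge of `c` separates them.
  have hcons : ∀ d ∈ c.darts, ∀ d' ∈ c.darts, G.target d = G.source d' → Y d = Y d' := by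
    intro d hd d' hd' hdd'
    have hloc : ∀ a, G.source a = G.source d' → a ≠ d' → a ≠ d.rev → Y (R.rot a) = Y a := by
      intro a ha h2 h3
      have h4 : a ∉ c.darts := fun h => h2 (hc.eq_of_source_eq h hd' ha)
      have h5 : a.rev ∉ c.darts := fun h => h3 (by
        rw [← hc.eq_of_target_eq h hd (by rw [target_rev, ha, hdd']), rev_rev])
      have h6 := hY a
      rw [hc.coeff_cycle, if_neg h4, if_neg h5] at h6
      simp only [sub_self, Int.cast_zero] at h6
      exact (sub_eq_zero.1 h6.symm).symm
    have hrec : ∀ (n : ℕ) (a : Dart E), G.source a = G.source d' → R.rot^[n] a = d' →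
        (∀ i < n, R.rot^[i] a ≠ d.rev) → Y a = Y d' := by
      intro n
      induction n with
      | zero => intro a _ h _; rw [show a = d' from h]
      | succ n ih =>
        intro a ha h hi
        by_cases had : a = d'
        · rw [had]
        · rw [← hloc a ha had (hi 0 (by omega))]
          exact ih _ (by rw [source_rot, ha]) h fun i hi' => hi (i + 1) (by omega)
    have hex : ∃ n, R.rot^[n] (R.rot d.rev) = d' := by
      have : R.rot.SameCycle (R.rot d.rev) d' :=
        (R.sameCycle_iff _ _).2 (by rw [source_rot, source_rev, hdd'])
      obtain ⟨i, -, hi⟩ := this.exists_pow_eq'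
      exact ⟨i, by rw [← hi, Equiv.Perm.coe_pow]⟩
    -- If `d.rev` were met before `d'`, the next element would again be `R.rot d.rev`, and `d'`
    -- would have been reached earlier.
    have h2 := hrec (Nat.find hex) (R.rot d.rev) (by rw [source_rot, source_rev, hdd'])
      (Nat.find_spec hex) (fun i hi h3 => by
        refine Nat.find_min hex (m := Nat.find hex - i - 1) (by omega) ?_
        have h4 := Nat.find_spec hex
        have h5 : Nat.find hex = (Nat.find hex - i - 1) + 1 + i := by omega
        rw [h5, Function.iterate_add_apply, h3, Function.iterate_succ_apply] at h4
        exact h4)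
    rw [← h2, hYrot, rev_rev]
  have hconst : ∀ (l : List (Dart E)) (d : Dart E) {u v : V}, (∀ a ∈ d :: l, a ∈ c.darts) →
      G.IsWalk u v (d :: l) → ∀ a ∈ d :: l, Y a = Y d := by
    intro l
    induction l with
    | nil =>
      intro d u v _ _ a ha
      rw [List.mem_singleton.1 ha]
    | cons d' l ih =>
      intro d u v hmem hw a ha
      rcases List.mem_cons.1 ha with rfl | ha
      · rfl
      · rw [ih d' (fun a ha => hmem a (List.mem_cons_of_mem _ ha)) hw.2 a ha]
        exact (hcons d (hmem d (by simp)) d' (hmem d' (by simp)) hw.2.1.symm).symm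
  obtain ⟨d₀, l₀, hl₀⟩ := List.exists_cons_of_ne_nil hc.1
  have hL : ∀ a ∈ c.darts, Y a = Y d₀ := by
    have hw := c.isWalk
    rw [hl₀] at hw ⊢
    exact hconst l₀ d₀ (fun a ha => hl₀ ▸ ha) hw
  -- The faces whose value modulo `k` is the one found along `c`. On the other side of `c` the value
  -- is smaller by one, hence different as `k ≥ 2`, so the integral boundary of this indicator is
  -- exactly `c`.
  let y' : R.Face → ℤ := fun f => if (y f : ZMod k) = Y d₀ then 1 else 0
  refine (R.cls_eq_iff (c.cycle ℤ) 0).2 ⟨y', ext_coeff fun a => ?_⟩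
  have hy' : ∀ a, y' (R.faceOf a) = if Y a = Y d₀ then 1 else 0 := fun a => rfl
  rw [coeff_boundary₂, hy', hy', show (c.cycle ℤ).1 - (0 : G.cycles ℤ).1 = (c.cycle ℤ).1 from
    sub_zero _, hc.coeff_cycle]
  have h6 := hY a
  rw [hc.coeff_cycle] at h6
  by_cases ha : a ∈ c.darts
  · have ha' := hc.rev_notMem ha
    simp only [ha, ha', if_true, if_false, sub_zero, Int.cast_one] at h6 ⊢
    have h7 : Y (R.rot a) ≠ Y d₀ := fun h => by
      rw [hL a ha, h, sub_self] at h6; exact one_ne_zero h6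
    rw [if_pos (hL a ha), if_neg h7, sub_zero]
  · by_cases ha' : a.rev ∈ c.darts
    · simp only [ha, ha', if_true, if_false, zero_sub, Int.cast_neg, Int.cast_one] at h6 ⊢
      have h8 : Y (R.rot a) = Y d₀ := by rw [hYrot, hL _ ha']
      have h7 : Y a ≠ Y d₀ := fun h => by
        rw [h8, h, sub_self, neg_eq_zero] at h6; exact one_ne_zero h6
      rw [if_neg h7, if_pos h8, zero_sub]
    · simp only [ha, ha', if_false, sub_self, Int.cast_zero] at h6 ⊢
      rw [sub_eq_zero.1 h6.symm, sub_self]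

end RotationSystem
end Multigraph

/-! ### Decomposition of cycles into simple cycles, and their weights -/

namespace Multigraph
open Dart
variable {V E : Type*} {G : Multigraph V E}

lemma exists_sublist_pair_of_not_nodup_map {α β : Type*} (f : α → β) {l : List α}
    (h : ¬ (l.map f).Nodup) : ∃ (l₁ : List α) (a : α) (l₂ : List α) (b : α) (l₃ : List α),
      l = l₁ ++ (a :: l₂) ++ (b :: l₃) ∧ f a = f b := by
  obtain ⟨x, hx⟩ := List.exists_duplicate_iff_not_nodup.2 h
  obtain ⟨l', hl', he⟩ := List.sublist_map_iff.1 (List.duplicate_iff_sublist.1 hx)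
  obtain ⟨a, l'', rfl, ha, he'⟩ := List.map_eq_cons_iff.1 he.symm
  obtain ⟨b, l''', rfl, hb, he''⟩ := List.map_eq_cons_iff.1 he'
  rw [List.map_eq_nil_iff.1 he''] at hl'
  obtain ⟨r₁, r₂, rfl, har, hbr⟩ := List.cons_sublist_iff.1 hl'
  obtain ⟨p, q, rfl⟩ := List.append_of_mem har
  obtain ⟨p', q', rfl⟩ := List.append_of_mem (List.singleton_sublist.1 hbr)
  exact ⟨p, a, q ++ p', b, q', by simp, ha.trans hb.symm⟩

lemma ClosedWalk.IsSimpleCycle.apply_cycle [Fintype E] {A : Type*} [CommRing A] {c : G.ClosedWalk} (hc : c.IsSimpleCycle) (e : E) :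
    (((e, true) ∈ c.darts) ∧ (c.cycle A).1 e = 1) ∨ (((e, false) ∈ c.darts) ∧ (c.cycle A).1 e = -1) ∨
      (((e, true) ∉ c.darts) ∧ ((e, false) ∉ c.darts) ∧ (c.cycle A).1 e = 0) := by
  classical
  have h := hc.coeff_cycle (A := A) (e, true)
  rw [coeff_true, show Dart.rev (e, true) = (e, false) from rfl] at h
  by_cases h1 : ((e, true) : Dart E) ∈ c.darts
  · have h2 : ((e, false) : Dart E) ∉ c.darts := hc.rev_notMem h1
    left; refine ⟨h1, ?_⟩; rw [h]; simp [h1, h2]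
  · by_cases h2 : ((e, false) : Dart E) ∈ c.darts
    · right; left; refine ⟨h2, ?_⟩; rw [h]; simp [h1, h2]
    · right; right; refine ⟨h1, h2, ?_⟩; rw [h]; simp [h1, h2]

section Positive
variable [Fintype E] {A : Type*} [CommRing A] [LinearOrder A] [IsStrictOrderedRing A]

/-- A nonzero cycle is positive along some simple cycle. -/
lemma exists_simpleCycle_pos {x : E → A} (hx : x ∈ G.cycles A) (h0 : x ≠ 0) :
    ∃ c : G.ClosedWalk, c.IsSimpleCycle ∧ ∀ d ∈ c.darts, 0 < coeff x d := by
  classical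
  -- Conservation at the target of `d`: the negative coefficient on `d.rev` must be balanced by a
  -- positive one, along which the walk continues.
  have hsucc : ∀ d : {d : Dart E // 0 < coeff x d}, ∃ d' : {d : Dart E // 0 < coeff x d},
      G.source d'.1 = G.target d.1 := by
    rintro ⟨d, hd⟩
    have h1 := (G.mem_cycles_iff x).1 hx (G.target d)
    rw [← Finset.sum_filter] at h1
    obtain ⟨a, ha, hpos⟩ := Finset.exists_pos_of_sum_zero_of_exists_nonzero _ h1
      ⟨d.rev, by simp, by rw [coeff_rev]; exact (neg_lt_zero.2 hd).ne⟩
    exact ⟨⟨a, hpos⟩, (Finset.mem_filter.1 ha).2⟩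
  choose f hf using hsucc
  obtain ⟨d₀⟩ : Nonempty {d : Dart E // 0 < coeff x d} := by
    obtain ⟨e, he⟩ := Function.ne_iff.1 h0
    rcases lt_or_gt_of_ne he with h | h
    · exact ⟨(e, false), by simpa using h⟩
    · exact ⟨(e, true), by simpa using h⟩
  have hwalk : ∀ n i : ℕ, G.IsWalk (G.source (f^[i] d₀).1) (G.source (f^[i + n] d₀).1)
      ((List.range n).map fun k => (f^[i + k] d₀).1) := by
    intro n i
    induction n with
    | zero => exact rfl
    | succ n ih =>
      rw [List.range_succ, List.map_append]
      refine ih.append ⟨rfl, ?_⟩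
      rw [← add_assoc, Function.iterate_succ_apply', hf]
      exact rfl
  -- Following successors in a finite set closes up. A closed walk of positive edges with the fewest
  -- edges repeats no vertex, since a repetition would cut out a shorter one.
  have hex : ∃ n, ∃ c : G.ClosedWalk, c.darts.length = n ∧ c.darts ≠ [] ∧
      ∀ d ∈ c.darts, 0 < coeff x d := by
    obtain ⟨i, j, hij, heq⟩ := Finite.exists_ne_map_eq_of_infinite fun n : ℕ => f^[n] d₀
    have hcase : ∀ i j : ℕ, i < j → f^[i] d₀ = f^[j] d₀ → ∃ n, ∃ c : G.ClosedWalk,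
        c.darts.length = n ∧ c.darts ≠ [] ∧ ∀ d ∈ c.darts, 0 < coeff x d := by
      intro i j hij heq
      have hw := hwalk (j - i) i
      rw [Nat.add_sub_cancel' hij.le, ← heq] at hw
      refine ⟨_, ⟨_, _, hw⟩, rfl, ?_, ?_⟩
      · simp; omega
      · intro d hd
        obtain ⟨k, -, rfl⟩ := List.mem_map.1 hd
        exact (f^[i + k] d₀).2
    rcases lt_or_gt_of_ne hij with h | h
    · exact hcase i j h heq
    · exact hcase j i h heq.symm
  obtain ⟨c, hlen, hne, hpos⟩ := Nat.find_spec hex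
  have hnodup : (c.darts.map G.source).Nodup := by
    by_contra hnd
    obtain ⟨l₁, a, l₂, b, l₃, hl, hab⟩ := exists_sublist_pair_of_not_nodup_map G.source hnd
    have hw := c.isWalk
    rw [hl, isWalk_append] at hw
    obtain ⟨m, hm1, hm2⟩ := hw
    obtain ⟨m', -, hm3⟩ := (G.isWalk_append).1 hm1
    have e1 : G.source a = m' := hm3.1
    have e2 : G.source b = m := hm2.1
    have e3 : m' = m := by rw [← e1, ← e2, hab]
    subst e3
    refine Nat.find_min hex (m := (a :: l₂).length) ?_ ⟨⟨m', a :: l₂, hm3⟩, rfl, by simp, ?_⟩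
    · rw [← hlen, hl]; simp; omega
    · intro d hd
      exact hpos d (by rw [hl]; simp only [List.mem_append]; exact Or.inl (Or.inr hd))
  refine ⟨c, ⟨hne, hnodup, ?_⟩, hpos⟩
  refine List.Nodup.map_on (fun a ha b hb hab => ?_) hnodup.of_map
  rcases eq_or_eq_rev_of_fst_eq hab with h | h
  · exact h
  · have h1 := hpos a ha
    rw [h, coeff_rev] at h1
    exact absurd (hpos b hb) (by linarith)

/-- Induction along a decomposition of cycles into simple cycles without cancellation. -/
theorem cycle_induction {P : G.cycles A → Prop} (h0 : P 0)
    (hadd : ∀ (x : G.cycles A) (r : A) (c : G.ClosedWalk), 0 < r → c.IsSimpleCycle →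
      (∀ e, |(x + r • c.cycle A).1 e| = |x.1 e| + r * |(c.cycle A).1 e|) →
        P x → P (x + r • c.cycle A)) (x : G.cycles A) : P x := by
  classical
  induction hn : (Finset.univ.filter fun e => x.1 e ≠ 0).card using Nat.strong_induction_on
    generalizing x with
  | _ n ih =>
  by_cases hx0 : x = 0
  · rw [hx0]; exact h0
  obtain ⟨c, hc, hpos⟩ := exists_simpleCycle_pos x.2 fun h => hx0 (Subtype.ext h)
  -- Subtracting `c` with the smallest coefficient along it reverses no sign and removes the edge of
  -- `d` from the support.
  obtain ⟨d, hd, hmin⟩ := Finset.exists_min_image c.darts.toFinset (fun d => coeff x.1 d)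
    (List.toFinset_nonempty_iff _ |>.2 hc.1)
  rw [List.mem_toFinset] at hd
  set r := coeff x.1 d with hr
  have hmin' : ∀ a ∈ c.darts, r ≤ coeff x.1 a := fun a ha => hmin a (List.mem_toFinset.2 ha)
  have hr0 : 0 < r := hpos d hd
  have hval : ∀ e, (x - r • c.cycle A).1 e = x.1 e - r * (c.cycle A).1 e := fun e => rfl
  have hx : x = (x - r • c.cycle A) + r • c.cycle A := by abel
  rw [hx]
  refine hadd _ r c hr0 hc (fun e => ?_) (ih _ ?_ _ rfl)
  · rw [← hx, hval]
    rcases hc.apply_cycle (A := A) e with ⟨h1, h2⟩ | ⟨h1, h2⟩ | ⟨h1, h1', h2⟩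
    · have h3 := hmin' _ h1
      rw [coeff_true] at h3
      rw [h2, abs_of_nonneg (by linarith : 0 ≤ x.1 e), abs_of_nonneg (by linarith), abs_one]; ring
    · have h3 := hmin' _ h1
      rw [coeff_false] at h3
      rw [h2, abs_of_nonpos (by linarith : x.1 e ≤ 0), abs_of_nonpos (by linarith), abs_neg,
        abs_one]; ring
    · rw [h2]; simp
  · rw [← hn]
    refine Finset.card_lt_card ⟨fun e he => ?_, fun hsub => ?_⟩
    · rw [Finset.mem_filter] at he ⊢
      refine ⟨he.1, fun h => he.2 ?_⟩
      rw [hval]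
      rcases hc.apply_cycle (A := A) e with ⟨h1, h2⟩ | ⟨h1, h2⟩ | ⟨h1, h1', h2⟩
      · have := hpos _ h1
        rw [coeff_true, h] at this; exact absurd this (lt_irrefl _)
      · have := hpos _ h1
        rw [coeff_false, h, neg_zero] at this; exact absurd this (lt_irrefl _)
      · rw [h, h2]; simp
    · have h1 : d.1 ∈ Finset.univ.filter fun e => x.1 e ≠ 0 := by
        rw [Finset.mem_filter]
        refine ⟨Finset.mem_univ _, fun h => hr0.ne' ?_⟩
        rw [hr]; simp [coeff, h]
      have h2 := (Finset.mem_filter.1 (hsub h1)).2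
      apply h2
      rw [hval]
      have h3 := hc.coeff_cycle (A := A) d
      rw [if_pos hd, if_neg (hc.rev_notMem hd), sub_zero] at h3
      have h4 : coeff (x.1 - r • (c.cycle A).1) d = 0 := by
        rw [coeff_sub, coeff_smul, h3, ← hr]; ring
      obtain ⟨e, b⟩ := d
      cases b
      · rw [coeff_false, neg_eq_zero] at h4; exact h4
      · exact h4

end Positive

section Weight

lemma ClosedWalk.length_pos {w : E → ℝ} (hw : ∀ e, 0 < w e) {c : G.ClosedWalk}
    (hc : c.darts ≠ []) : 0 < c.length w := by
  refine List.sum_pos _ ?_ (by simpa using hc)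
  intro x hx
  obtain ⟨d, -, rfl⟩ := List.mem_map.1 hx
  exact hw _

lemma ClosedWalk.length_nonneg {w : E → ℝ} (hw : ∀ e, 0 < w e) (c : G.ClosedWalk) :
    0 ≤ c.length w := by
  refine List.sum_nonneg ?_
  intro x hx
  obtain ⟨d, -, rfl⟩ := List.mem_map.1 hx
  exact (hw _).le

variable [Fintype E]

/-- The weight of a real 1-chain. -/
noncomputable def chainWeight (w : E → ℝ) (x : E → ℝ) : ℝ := ∑ e, |x e| * w e

lemma chainWeight_cycle_le {w : E → ℝ} (hw : ∀ e, 0 ≤ w e) (c : G.ClosedWalk) :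
    chainWeight w (c.cycle ℝ).1 ≤ c.length w := by
  classical
  simp only [ClosedWalk.cycle, ClosedWalk.length]
  induction c.darts with
  | nil => simp [chainWeight]
  | cons d l ih =>
    rw [List.map_cons, List.sum_cons, List.map_cons, List.sum_cons]
    refine le_trans ?_ (add_le_add_right ih (w d.1))
    have h1 : w d.1 = ∑ e, |Dart.chain ℝ d e| * w e := by
      rw [Finset.sum_eq_single d.1]
      · obtain ⟨e, b⟩ := d; cases b <;> simp [Dart.chain]
      · intro e _ he; simp [Dart.chain, he]
      · simp
    rw [h1, chainWeight, chainWeight, ← Finset.sum_add_distrib]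
    refine Finset.sum_le_sum fun e _ => ?_
    rw [← add_mul]
    exact mul_le_mul_of_nonneg_right (abs_add_le _ _) (hw e)

lemma ClosedWalk.IsSimpleCycle.chainWeight_cycle {c : G.ClosedWalk} (hc : c.IsSimpleCycle)
    (w : E → ℝ) : chainWeight w (c.cycle ℝ).1 = c.length w := by
  classical
  have h1 : c.length w = ∑ e ∈ (c.darts.map Prod.fst).toFinset, w e := by
    rw [List.sum_toFinset w hc.2.2, ClosedWalk.length, List.map_map]
    rfl
  rw [h1, chainWeight, ← Finset.sum_subset (Finset.subset_univ (c.darts.map Prod.fst).toFinset)]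
  · refine Finset.sum_congr rfl fun e he => ?_
    rcases hc.apply_cycle (A := ℝ) e with ⟨h1, h2⟩ | ⟨h1, h2⟩ | ⟨h1, h1', h2⟩
    · simp [h2]
    · simp [h2]
    · rw [List.mem_toFinset, List.mem_map] at he
      obtain ⟨⟨e', b⟩, hd, rfl⟩ := he
      cases b
      · exact absurd hd h1'
      · exact absurd hd h1
  · intro e _ he
    rcases hc.apply_cycle (A := ℝ) e with ⟨h1, h2⟩ | ⟨h1, h2⟩ | ⟨h1, h1', h2⟩
    · exact absurd (List.mem_toFinset.2 (List.mem_map.2 ⟨_, h1, rfl⟩)) he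
    · exact absurd (List.mem_toFinset.2 (List.mem_map.2 ⟨_, h1, rfl⟩)) he
    · simp [h2]

end Weight

end Multigraph

/-! ### Rounding real potentials to integral ones -/

section Rounding
open MeasureTheory intervalIntegral

lemma intervalIntegrable_floor_add (a : ℝ) :
    IntervalIntegrable (fun t : ℝ => ((⌊a + t⌋ : ℤ) : ℝ)) volume 0 1 :=
  Monotone.intervalIntegrable fun s t hst => by
    have : ⌊a + s⌋ ≤ ⌊a + t⌋ := Int.floor_mono (by linarith)
    exact_mod_cast this

/-- The average of `⌊a + t⌋` over a unit interval is `a`. -/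
lemma integral_floor_add (a : ℝ) : ∫ t in (0 : ℝ)..1, ((⌊a + t⌋ : ℤ) : ℝ) = a := by
  have h1 : ∫ t in (0 : ℝ)..1, Int.fract (a + t) = 1 / 2 := by
    have h2 : ∫ t in (0 : ℝ)..1, Int.fract (a + t) = ∫ t in a..(a + 1), Int.fract t := by
      rw [intervalIntegral.integral_comp_add_left (fun t => Int.fract t) a, add_zero]
    have hper : Function.Periodic (Int.fract : ℝ → ℝ) 1 := fun t => Int.fract_add_one t
    rw [h2, hper.intervalIntegral_add_eq a 0, zero_add]
    have h3 : ∫ t in (0 : ℝ)..1, Int.fract t = ∫ t in (0 : ℝ)..1, t := by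
      refine intervalIntegral.integral_congr_ae ?_
      have : ∀ᵐ t : ℝ ∂volume, t ≠ 1 := by
        rw [ae_iff]; simp
      filter_upwards [this] with t ht ht'
      rw [Set.uIoc_of_le zero_le_one] at ht'
      exact Int.fract_eq_self.2 ⟨ht'.1.le, lt_of_le_of_ne ht'.2 ht⟩
    rw [h3, integral_id]; norm_num
  have h2 : ∀ t : ℝ, Int.fract (a + t) = (a + t) - ((⌊a + t⌋ : ℤ) : ℝ) := fun t => rfl
  simp_rw [h2] at h1
  rw [intervalIntegral.integral_sub _ (intervalIntegrable_floor_add a),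
    intervalIntegral.integral_add (by simp) (by simp), integral_id] at h1
  · simp at h1; linarith
  · exact (continuous_const.add continuous_id).intervalIntegrable _ _

/-- Real potentials can be rounded to integral ones without increasing the weight. -/
lemma exists_int_potential {E F : Type*} [Fintype E] (w : E → ℝ) (x : E → ℤ)
    (l r : E → F) (y : F → ℝ) : ∃ z : F → ℤ,
      ∑ e, |((x e + (z (l e) - z (r e)) : ℤ) : ℝ)| * w e ≤
        ∑ e, |(x e : ℝ) + (y (l e) - y (r e))| * w e := by
  let z : ℝ → F → ℤ := fun t f => ⌊y f + t⌋
  -- The sign of each coefficient. Since `⌊·⌋` is monotone and commutes with integer translations,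
  -- rounding with a common shift `t` keeps it weakly (`hsz`). The rounded weight is therefore
  -- linear in the floors, and its average over `t` is the original weight.
  let s : E → ℝ := fun e => if 0 ≤ (x e : ℝ) + (y (l e) - y (r e)) then 1 else -1
  have hs : ∀ e, |(x e : ℝ) + (y (l e) - y (r e))| = s e * ((x e : ℝ) + (y (l e) - y (r e))) := by
    intro e
    simp only [s]
    split_ifs with h
    · rw [abs_of_nonneg h, one_mul]
    · rw [abs_of_neg (not_le.1 h), neg_one_mul]
  have hsz : ∀ t e, |((x e + (z t (l e) - z t (r e)) : ℤ) : ℝ)| =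
      s e * ((x e + (z t (l e) - z t (r e)) : ℤ) : ℝ) := by
    intro t e
    simp only [s, z]
    split_ifs with h
    · have h1 : ⌊y (r e) + t⌋ ≤ x e + ⌊y (l e) + t⌋ := by
        rw [add_comm (x e), ← Int.floor_add_intCast]
        exact Int.floor_mono (by linarith)
      rw [one_mul, abs_of_nonneg]
      exact_mod_cast (by linarith : 0 ≤ x e + (⌊y (l e) + t⌋ - ⌊y (r e) + t⌋))
    · have h1 : x e + ⌊y (l e) + t⌋ ≤ ⌊y (r e) + t⌋ := by
        rw [add_comm (x e), ← Int.floor_add_intCast]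
        exact Int.floor_mono (by linarith [not_le.1 h])
      rw [neg_one_mul, abs_of_nonpos]
      exact_mod_cast (by linarith : x e + (⌊y (l e) + t⌋ - ⌊y (r e) + t⌋) ≤ 0)
  by_contra hcon
  push Not at hcon
  set B := ∑ e, |(x e : ℝ) + (y (l e) - y (r e))| * w e with hB
  let g : E → ℝ → ℝ := fun e t =>
    s e * ((x e : ℝ) + ((⌊y (l e) + t⌋ : ℤ) - (⌊y (r e) + t⌋ : ℤ))) * w e
  have hgint : ∀ e, IntervalIntegrable (g e) volume 0 1 := fun e =>
    (((intervalIntegrable_const).add ((intervalIntegrable_floor_add _).sub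
      (intervalIntegrable_floor_add _))).const_mul _).mul_const _
  have hg : ∀ e, ∫ t in (0 : ℝ)..1, g e t = |(x e : ℝ) + (y (l e) - y (r e))| * w e := by
    intro e
    simp only [g]
    rw [intervalIntegral.integral_mul_const, intervalIntegral.integral_const_mul,
      intervalIntegral.integral_add intervalIntegrable_const
        ((intervalIntegrable_floor_add _).sub (intervalIntegrable_floor_add _)),
      intervalIntegral.integral_sub (intervalIntegrable_floor_add _)
        (intervalIntegrable_floor_add _), integral_floor_add, integral_floor_add, hs]
    simp
  have hsum : IntervalIntegrable (fun t => ∑ e, g e t) volume 0 1 := by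
    have := IntervalIntegrable.sum (μ := volume) (a := (0 : ℝ)) (b := 1) Finset.univ
      (f := g) fun e _ => hgint e
    rwa [show (∑ e, g e) = fun t => ∑ e, g e t from by ext t; simp] at this
  have hpos : 0 < ∫ t in (0 : ℝ)..1, ((∑ e, g e t) - B) := by
    refine intervalIntegral.intervalIntegral_pos_of_pos (hsum.sub intervalIntegrable_const)
      (fun t => ?_) one_pos
    have h1 := hcon (z t)
    simp only [hsz] at h1
    rw [sub_pos]
    refine h1.trans_le (le_of_eq (Finset.sum_congr rfl fun e _ => ?_))
    simp only [g, z]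
    push_cast
    ring
  rw [intervalIntegral.integral_sub hsum intervalIntegrable_const,
    intervalIntegral.integral_finsetSum fun e _ => hgint e] at hpos
  simp only [hg] at hpos
  simp at hpos
  linarith

end Rounding

/-! ### Joining simple cycles into one closed walk -/

/-- Coprimality makes corresponding coordinates divide each other, so they agree up to sign;
opposite choices of sign are possible only if a coordinate vanishes. -/
lemma Int.eq_or_eq_neg_of_isCoprime {a b a' b' : ℤ} (h : IsCoprime a b) (h' : IsCoprime a' b')
    (hd : a * b' = b * a') : (a = a' ∧ b = b') ∨ (a = -a' ∧ b = -b') := by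
  have h1 : a ∣ a' := h.dvd_of_dvd_mul_left (Dvd.intro _ hd)
  have h2 : a' ∣ a := h'.dvd_of_dvd_mul_right ⟨b, by rw [hd]; ring⟩
  have h3 : b ∣ b' := h.symm.dvd_of_dvd_mul_left (Dvd.intro _ hd.symm)
  have h4 : b' ∣ b := h'.symm.dvd_of_dvd_mul_right ⟨a, by rw [← hd]; ring⟩
  have h5 := Int.natAbs_eq_natAbs_iff.1 (Nat.dvd_antisymm (Int.natAbs_dvd_natAbs.2 h1)
    (Int.natAbs_dvd_natAbs.2 h2))
  have h6 := Int.natAbs_eq_natAbs_iff.1 (Nat.dvd_antisymm (Int.natAbs_dvd_natAbs.2 h3)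
    (Int.natAbs_dvd_natAbs.2 h4))
  rcases h5 with rfl | rfl <;> rcases h6 with rfl | rfl
  · exact Or.inl ⟨rfl, rfl⟩
  · have : a = 0 ∨ b' = 0 := by
      rcases eq_or_ne a 0 with h | h
      · exact Or.inl h
      · right
        have : a * (2 * b') = 0 := by linarith
        have := (mul_eq_zero.1 this).resolve_left h
        omega
    rcases this with rfl | rfl
    · exact Or.inr ⟨by simp, rfl⟩
    · exact Or.inl ⟨rfl, by simp⟩
  · have : a' = 0 ∨ b = 0 := by
      rcases eq_or_ne a' 0 with h | h
      · exact Or.inl h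
      · right
        have : a' * (2 * b) = 0 := by linarith
        have := (mul_eq_zero.1 this).resolve_left h
        omega
    rcases this with rfl | rfl
    · exact Or.inl ⟨by simp, rfl⟩
    · exact Or.inr ⟨rfl, by simp⟩
  · exact Or.inr ⟨rfl, rfl⟩

namespace Multigraph
open Dart
variable {V E : Type*} {G : Multigraph V E}

section Merge

lemma ClosedWalk.length_eq_of_perm {c c' : G.ClosedWalk} (w : E → ℝ)
    (h : c.darts.Perm c'.darts) : c.length w = c'.length w := (h.map _).sum_eq

lemma ClosedWalk.cycle_eq_of_perm [Fintype E] (A : Type*) [CommRing A] {c c' : G.ClosedWalk}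
    (h : c.darts.Perm c'.darts) : c.cycle A = c'.cycle A := Subtype.ext (h.map _).sum_eq

/-- A closed walk can be started at any of its vertices. -/
lemma ClosedWalk.exists_rebase (c : G.ClosedWalk) {v : V} (hv : v ∈ c.support) :
    ∃ c' : G.ClosedWalk, c'.base = v ∧ c'.darts.Perm c.darts := by
  obtain ⟨d, hd, rfl⟩ := List.mem_map.1 (show v ∈ c.darts.map G.source from hv)
  obtain ⟨p, q, hpq⟩ := List.append_of_mem hd
  have hw := c.isWalk
  rw [hpq, isWalk_append] at hw
  obtain ⟨m, h1, h2⟩ := hw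
  obtain rfl : G.source d = m := h2.1
  exact ⟨⟨G.source d, (d :: q) ++ p, h2.append h1⟩, rfl, by rw [hpq]; exact List.perm_append_comm⟩

end Merge

namespace RotationSystem
variable [Fintype E] {R : G.RotationSystem}

/-- Two closed walks through a common vertex can be joined. -/
lemma exists_merge (R : G.RotationSystem) (w : E → ℝ) (c c' : G.ClosedWalk) {v : V}
    (hv : v ∈ c.support) (hv' : v ∈ c'.support) :
    ∃ c'' : G.ClosedWalk, c.support ⊆ c''.support ∧ c'.support ⊆ c''.support ∧
      R.cls ℤ (c''.cycle ℤ) = R.cls ℤ (c.cycle ℤ) + R.cls ℤ (c'.cycle ℤ) ∧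
      c''.length w = c.length w + c'.length w := by
  obtain ⟨c₁, h1, h2⟩ := c.exists_rebase hv
  obtain ⟨c₂, h3, h4⟩ := c'.exists_rebase hv'
  refine ⟨c₁.append c₂ (h1.trans h3.symm), fun u hu => ?_, fun u hu => ?_, ?_, ?_⟩
  · have : u ∈ c₁.darts.map G.source := (h2.map _).mem_iff.2 hu
    change u ∈ (c₁.darts ++ c₂.darts).map G.source
    rw [List.map_append]; exact List.mem_append_left _ this
  · have : u ∈ c₂.darts.map G.source := (h4.map _).mem_iff.2 hu
    change u ∈ (c₁.darts ++ c₂.darts).map G.source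
    rw [List.map_append]; exact List.mem_append_right _ this
  · rw [ClosedWalk.cycle_append, ClosedWalk.cycle_eq_of_perm ℤ h2,
      ClosedWalk.cycle_eq_of_perm ℤ h4]
    rfl
  · rw [ClosedWalk.length_append, ClosedWalk.length_eq_of_perm w h2,
      ClosedWalk.length_eq_of_perm w h4]

/-- Closed walks that meet a given one, or are null-homologous, can be absorbed by it. -/
lemma exists_merge_list (R : G.RotationSystem) {w : E → ℝ} (hw : ∀ e, 0 < w e) (c₀ : G.ClosedWalk)
    (L : List G.ClosedWalk)
    (hL : ∀ c ∈ L, R.cls ℤ (c.cycle ℤ) = 0 ∨ ¬ Disjoint c₀.support c.support) :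
    ∃ c' : G.ClosedWalk, c₀.support ⊆ c'.support ∧
      R.cls ℤ (c'.cycle ℤ) =
        R.cls ℤ (c₀.cycle ℤ) + (L.map fun c => R.cls ℤ (c.cycle ℤ)).sum ∧
      c'.length w ≤ c₀.length w + (L.map fun c => c.length w).sum := by
  induction L with
  | nil => exact ⟨c₀, subset_rfl, by simp, by simp⟩
  | cons c L ih =>
    obtain ⟨c', h1, h2, h3⟩ := ih fun c hc => hL c (List.mem_cons_of_mem _ hc)
    simp only [List.map_cons, List.sum_cons]
    rcases hL c (by simp) with h | h
    · refine ⟨c', h1, by rw [h2, h, zero_add], ?_⟩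
      have := c.length_nonneg hw
      linarith
    · obtain ⟨v, hv, hv'⟩ := Set.not_disjoint_iff.1 h
      obtain ⟨c'', h4, -, h5, h6⟩ := R.exists_merge w c' c (h1 hv) hv'
      refine ⟨c'', h1.trans h4, ?_, ?_⟩
      · rw [h5, h2]; abel
      · rw [h6]; linarith

/-- A common divisor `k ≥ 2` of the coordinates would make the class a `k`-fold multiple, which
forces the class of a simple cycle to vanish. -/
lemma isCoprime_repr_of_isSimpleCycle (b : Module.Basis (Fin 2) ℤ (R.H₁ ℤ)) {c : G.ClosedWalk}
    (hc : c.IsSimpleCycle) (h0 : R.cls ℤ (c.cycle ℤ) ≠ 0) :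
    IsCoprime (b.repr (R.cls ℤ (c.cycle ℤ)) 0) (b.repr (R.cls ℤ (c.cycle ℤ)) 1) := by
  set α := R.cls ℤ (c.cycle ℤ) with hα
  rw [Int.isCoprime_iff_gcd_eq_one]
  by_contra hne
  set k := Int.gcd (b.repr α 0) (b.repr α 1) with hk
  have hk0 : k ≠ 0 := by
    intro h
    rw [hk, Int.gcd_eq_zero_iff] at h
    apply h0
    apply b.ext_elem
    intro i
    fin_cases i
    · simpa using h.1
    · simpa using h.2
  obtain ⟨p, hp⟩ := Int.gcd_dvd_left (b.repr α 0) (b.repr α 1)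
  obtain ⟨q, hq⟩ := Int.gcd_dvd_right (b.repr α 0) (b.repr α 1)
  refine h0 (R.cls_eq_zero_of_eq_smul hc (k := k) (by omega) (β := p • b 0 + q • b 1) ?_)
  rw [← hα]
  conv_lhs => rw [← b.sum_repr α]
  rw [← hk] at hp hq
  rw [Fin.sum_univ_two, hp, hq, smul_add, smul_smul, smul_smul]

/-- Homologically nontrivial simple cycles with intersection number zero have the same class up to
sign. -/
lemma IsTorus.cls_eq_or_eq_neg [Fintype V] (hT : R.IsTorus) {c c' : G.ClosedWalk}
    (hc : c.IsSimpleCycle) (hc' : c'.IsSimpleCycle) (h0 : R.cls ℤ (c.cycle ℤ) ≠ 0)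
    (h0' : R.cls ℤ (c'.cycle ℤ) ≠ 0) (h : R.intForm ℤ (c.cycle ℤ).1 (c'.cycle ℤ).1 = 0) :
    R.cls ℤ (c.cycle ℤ) = R.cls ℤ (c'.cycle ℤ) ∨ R.cls ℤ (c.cycle ℤ) = -R.cls ℤ (c'.cycle ℤ) := by
  obtain ⟨b⟩ := hT.exists_basis
  obtain ⟨D, hD, hdet⟩ := hT.exists_intForm_eq_det b
  rw [hdet] at h
  have h1 := (mul_eq_zero.1 h).resolve_left hD
  rcases Int.eq_or_eq_neg_of_isCoprime (isCoprime_repr_of_isSimpleCycle b hc h0)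
    (isCoprime_repr_of_isSimpleCycle b hc' h0') (sub_eq_zero.1 h1) with ⟨h2, h3⟩ | ⟨h2, h3⟩
  · left
    apply b.ext_elem
    intro i
    fin_cases i
    · exact h2
    · exact h3
  · right
    apply b.ext_elem
    intro i
    fin_cases i
    · simpa using h2
    · simpa using h3

/-- On a torus, a family of simple cycles can be replaced by a single closed walk in the same
homology class that is not longer. -/
theorem IsTorus.exists_closedWalk_of_list [Fintype V] (hT : R.IsTorus) {w : E → ℝ}
    (hw : ∀ e, 0 < w e) (L : List G.ClosedWalk) (hL : ∀ c ∈ L, c.IsSimpleCycle) :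
    ∃ c' : G.ClosedWalk, R.cls ℤ (c'.cycle ℤ) = (L.map fun c => R.cls ℤ (c.cycle ℤ)).sum ∧
      c'.length w ≤ (L.map fun c => c.length w).sum := by
  classical
  by_cases hcross : ∃ c₁ ∈ L, ∃ c₂ ∈ L, R.intForm ℤ (c₁.cycle ℤ).1 (c₂.cycle ℤ).1 ≠ 0
  · obtain ⟨c₁, h1, c₂, h2, h12⟩ := hcross
    have hne : c₂ ≠ c₁ := by
      rintro rfl
      have := R.intForm_antisymm (c₂.cycle ℤ).2 (c₂.cycle ℤ).2
      omega
    have hperm : L.Perm (c₁ :: c₂ :: (L.erase c₁).erase c₂) :=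
      (List.perm_cons_erase h1).trans
        ((List.perm_cons_erase ((List.mem_erase_of_ne hne).2 h2)).cons _)
    obtain ⟨v, hv1, hv2⟩ := Set.not_disjoint_iff.1
      fun h => h12 (R.intForm_eq_zero_of_disjoint h)
    obtain ⟨c₀, s1, s2, k1, k2⟩ := R.exists_merge w c₁ c₂ hv1 hv2
    obtain ⟨b⟩ := hT.exists_basis
    obtain ⟨D, hD, hdet⟩ := hT.exists_intForm_eq_det b
    -- The walk `c₀` contains the vertices of `c₁` and `c₂`, whose classes are linearly independent.
    -- A cycle disjoint from `c₀` pairs to zero with both, so it is null-homologous and can be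
    -- dropped.
    obtain ⟨c', -, k3, k4⟩ := R.exists_merge_list hw c₀ ((L.erase c₁).erase c₂) (by
      intro c _
      by_contra hcon
      push Not at hcon
      obtain ⟨h0, hdisj⟩ := hcon
      have d1 := R.intForm_eq_zero_of_disjoint (hdisj.mono_left s1)
      have d2 := R.intForm_eq_zero_of_disjoint (hdisj.mono_left s2)
      rw [hdet] at d1 d2 h12
      have e1 := (mul_eq_zero.1 d1).resolve_left hD
      have e2 := (mul_eq_zero.1 d2).resolve_left hD
      have e3 := (mul_ne_zero_iff.1 h12).2
      apply h0
      apply b.ext_elem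
      intro i
      simp only [map_zero, Finsupp.coe_zero, Pi.zero_apply]
      fin_cases i
      · refine (mul_eq_zero.1 ?_).resolve_left e3
        simp only [Fin.zero_eta]
        linear_combination
          (b.repr (R.cls ℤ (c₂.cycle ℤ)) 0) * e1 - (b.repr (R.cls ℤ (c₁.cycle ℤ)) 0) * e2
      · refine (mul_eq_zero.1 ?_).resolve_left e3
        simp only [Fin.mk_one]
        linear_combination
          (b.repr (R.cls ℤ (c₂.cycle ℤ)) 1) * e1 - (b.repr (R.cls ℤ (c₁.cycle ℤ)) 1) * e2)
    refine ⟨c', ?_, ?_⟩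
    · rw [k3, k1, (hperm.map _).sum_eq]
      simp only [List.map_cons, List.sum_cons]
      abel
    · rw [(hperm.map _).sum_eq]
      simp only [List.map_cons, List.sum_cons]
      linarith
  · push Not at hcross
    by_cases hzero : ∀ c ∈ L, R.cls ℤ (c.cycle ℤ) = 0
    · obtain ⟨v⟩ := hT.1.1
      refine ⟨ClosedWalk.nil v, ?_, ?_⟩
      · rw [ClosedWalk.cycle_nil]
        symm
        refine List.sum_eq_zero fun x hx => ?_
        obtain ⟨c, hc, rfl⟩ := List.mem_map.1 hx
        exact hzero c hc
      · refine le_trans (le_of_eq rfl) (List.sum_nonneg fun x hx => ?_)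
        obtain ⟨c, hc, rfl⟩ := List.mem_map.1 hx
        exact c.length_nonneg hw
    push Not at hzero
    -- Without crossings all nonzero classes agree up to sign, so the shortest cycle among them can
    -- replace each of the others; opposite signs only shorten the result.
    obtain ⟨c₀, hc₀, hmin⟩ := Finset.exists_min_image
      (L.toFinset.filter fun c => R.cls ℤ (c.cycle ℤ) ≠ 0) (fun c => c.length w) (by
        obtain ⟨c, hc, hc'⟩ := hzero
        exact ⟨c, Finset.mem_filter.2 ⟨List.mem_toFinset.2 hc, hc'⟩⟩)
    rw [Finset.mem_filter, List.mem_toFinset] at hc₀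
    have hsum : ∀ L' : List G.ClosedWalk, (∀ c ∈ L', c ∈ L) → ∃ k : ℤ,
        (L'.map fun c => R.cls ℤ (c.cycle ℤ)).sum = k • R.cls ℤ (c₀.cycle ℤ) ∧
        |(k : ℝ)| * c₀.length w ≤ (L'.map fun c => c.length w).sum := by
      intro L'
      induction L' with
      | nil => intro _; exact ⟨0, by simp, by simp⟩
      | cons c L' ih =>
        intro hsub
        obtain ⟨k, hk1, hk2⟩ := ih fun c hc => hsub c (List.mem_cons_of_mem _ hc)
        have hcL := hsub c (by simp)
        simp only [List.map_cons, List.sum_cons]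
        by_cases hc0 : R.cls ℤ (c.cycle ℤ) = 0
        · refine ⟨k, by rw [hc0, hk1, zero_add], ?_⟩
          have := c.length_nonneg hw
          linarith
        · have hlen := hmin c (Finset.mem_filter.2 ⟨List.mem_toFinset.2 hcL, hc0⟩)
          have hpos := c₀.length_nonneg hw
          have htri : ∀ ε : ℤ, |(ε : ℝ)| = 1 →
              |((ε + k : ℤ) : ℝ)| * c₀.length w ≤ c.length w + (L'.map fun c => c.length w).sum := by
            intro ε hε
            push_cast
            have := abs_add_le (ε : ℝ) k
            rw [hε] at this
            nlinarith
          rcases hT.cls_eq_or_eq_neg (hL c hcL) (hL c₀ hc₀.1) hc0 hc₀.2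
            (hcross c hcL c₀ hc₀.1) with h | h
          · exact ⟨1 + k, by rw [h, hk1, add_smul, one_smul], htri 1 (by simp)⟩
          · exact ⟨-1 + k, by rw [h, hk1, add_smul, neg_smul, one_smul], htri (-1) (by simp)⟩
    obtain ⟨k, hk1, hk2⟩ := hsum L fun c hc => hc
    rw [hk1]
    obtain ⟨m, rfl | rfl⟩ := k.eq_nat_or_neg
    · refine ⟨c₀.repeat m, ?_, ?_⟩
      · rw [ClosedWalk.cycle_repeat, natCast_zsmul]; rfl
      · rw [ClosedWalk.length_repeat]; simpa using hk2
    · refine ⟨(c₀.repeat m).reverse, ?_, ?_⟩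
      · rw [ClosedWalk.cycle_reverse, ClosedWalk.cycle_repeat, neg_smul, natCast_zsmul]; rfl
      · rw [ClosedWalk.length_reverse, ClosedWalk.length_repeat]; simpa using hk2

end RotationSystem
end Multigraph

/-! ### The stable norm and the marked length spectrum -/

namespace Multigraph
open Dart
variable {V E : Type*} {G : Multigraph V E}

section ChainWeight
variable [Fintype E] {w : E → ℝ}

lemma chainWeight_nonneg (hw : ∀ e, 0 < w e) (x : E → ℝ) : 0 ≤ chainWeight w x :=
  Finset.sum_nonneg fun e _ => mul_nonneg (abs_nonneg _) (hw e).le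

lemma chainWeight_add_le (hw : ∀ e, 0 < w e) (x y : E → ℝ) :
    chainWeight w (x + y) ≤ chainWeight w x + chainWeight w y := by
  rw [chainWeight, chainWeight, chainWeight, ← Finset.sum_add_distrib]
  refine Finset.sum_le_sum fun e _ => ?_
  rw [← add_mul]
  exact mul_le_mul_of_nonneg_right (abs_add_le _ _) (hw e).le

lemma chainWeight_smul (r : ℝ) (x : E → ℝ) : chainWeight w (r • x) = |r| * chainWeight w x := by
  rw [chainWeight, chainWeight, Finset.mul_sum]
  refine Finset.sum_congr rfl fun e _ => ?_
  rw [Pi.smul_apply, smul_eq_mul, abs_mul, mul_assoc]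

lemma chainWeight_zero : chainWeight w 0 = 0 := by simp [chainWeight]

lemma abs_mul_le_chainWeight (hw : ∀ e, 0 < w e) (x : E → ℝ) (e : E) :
    |x e| * w e ≤ chainWeight w x :=
  Finset.single_le_sum (f := fun e => |x e| * w e)
    (fun e _ => mul_nonneg (abs_nonneg _) (hw e).le) (Finset.mem_univ e)

/-- A linear functional on cycles is bounded by a multiple of the weight. -/
lemma exists_abs_le_mul_chainWeight (hw : ∀ e, 0 < w e) (f : G.cycles ℝ →ₗ[ℝ] ℝ) :
    ∃ C, 0 ≤ C ∧ ∀ x, |f x| ≤ C * chainWeight w x.1 := by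
  classical
  obtain ⟨g, hg⟩ := f.exists_extend
  refine ⟨∑ e, |g (Pi.single e 1)| / w e,
    Finset.sum_nonneg fun e _ => div_nonneg (abs_nonneg _) (hw e).le, fun x => ?_⟩
  have h1 : f x = ∑ e, x.1 e * g (Pi.single e 1) := by
    rw [← hg, LinearMap.comp_apply]
    conv_lhs => rw [show (G.cycles ℝ).subtype x = ∑ e, x.1 e • (Pi.single e (1 : ℝ) : E → ℝ) from by
      ext e'; simp [Finset.sum_apply, Pi.single_apply]]
    rw [map_sum]
    simp
  rw [h1, Finset.sum_mul]
  refine (Finset.abs_sum_le_sum_abs _ _).trans (Finset.sum_le_sum fun e _ => ?_)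
  have h2 := abs_mul_le_chainWeight hw x.1 e
  have h3 : |x.1 e * g (Pi.single e 1)| = |g (Pi.single e 1)| / w e * (|x.1 e| * w e) := by
    have := (hw e).ne'
    rw [abs_mul]; field_simp
  rw [h3]
  exact mul_le_mul_of_nonneg_left h2 (div_nonneg (abs_nonneg _) (hw e).le)

end ChainWeight

namespace RotationSystem

section Norm
variable [Fintype E] (R : G.RotationSystem) {w : E → ℝ}

/-- The weights of the real cycles in a homology class. -/
def classWeights (w : E → ℝ) (p : R.H₁ ℝ) : Set ℝ :=
  {r | ∃ x : G.cycles ℝ, R.cls ℝ x = p ∧ r = chainWeight w x.1}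

lemma classWeights_nonempty (w : E → ℝ) (p : R.H₁ ℝ) : (R.classWeights w p).Nonempty := by
  obtain ⟨x, hx⟩ := Submodule.Quotient.mk_surjective _ p
  exact ⟨_, x, hx, rfl⟩

lemma bddBelow_classWeights (hw : ∀ e, 0 < w e) (p : R.H₁ ℝ) :
    BddBelow (R.classWeights w p) :=
  ⟨0, by rintro _ ⟨x, -, rfl⟩; exact chainWeight_nonneg hw _⟩

lemma sInf_classWeights_le (hw : ∀ e, 0 < w e) (x : G.cycles ℝ) :
    sInf (R.classWeights w (R.cls ℝ x)) ≤ chainWeight w x.1 :=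
  csInf_le (R.bddBelow_classWeights hw _) ⟨x, rfl, rfl⟩

/-- The norm on homology: the infimum of the weights of the real cycles in a class. -/
noncomputable def stableNorm (hw : ∀ e, 0 < w e) : Seminorm ℝ (R.H₁ ℝ) :=
  Seminorm.ofSMulLE (fun p => sInf (R.classWeights w p))
    (le_antisymm (by
      have := R.sInf_classWeights_le hw 0
      rwa [show (0 : G.cycles ℝ).1 = 0 from rfl, chainWeight_zero] at this)
      (le_csInf (R.classWeights_nonempty w _) (by
        rintro _ ⟨x, -, rfl⟩; exact chainWeight_nonneg hw _)))
    (fun p q => by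
      rw [← sub_le_iff_le_add']
      refine le_csInf (R.classWeights_nonempty w _) ?_
      rintro _ ⟨y, rfl, rfl⟩
      rw [sub_le_iff_le_add', ← sub_le_iff_le_add]
      refine le_csInf (R.classWeights_nonempty w _) ?_
      rintro _ ⟨x, rfl, rfl⟩
      rw [sub_le_iff_le_add]
      exact (R.sInf_classWeights_le hw (x + y)).trans (chainWeight_add_le hw x.1 y.1))
    (fun r p => by
      rcases eq_or_ne r 0 with rfl | hr
      · have := R.sInf_classWeights_le hw 0
        rw [show (0 : G.cycles ℝ).1 = 0 from rfl, chainWeight_zero] at this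
        rw [zero_smul, norm_zero, zero_mul]
        exact this
      · rw [Real.norm_eq_abs, mul_comm, ← div_le_iff₀ (abs_pos.2 hr)]
        refine le_csInf (R.classWeights_nonempty w _) ?_
        rintro _ ⟨x, rfl, rfl⟩
        rw [div_le_iff₀ (abs_pos.2 hr), mul_comm, ← chainWeight_smul]
        exact R.sInf_classWeights_le hw (r • x))

lemma stableNorm_cls_le (hw : ∀ e, 0 < w e) (x : G.cycles ℝ) :
    R.stableNorm hw (R.cls ℝ x) ≤ chainWeight w x.1 := R.sInf_classWeights_le hw x

lemma exists_chainWeight_lt (hw : ∀ e, 0 < w e) {p : R.H₁ ℝ} {s : ℝ}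
    (h : R.stableNorm hw p < s) : ∃ x : G.cycles ℝ, R.cls ℝ x = p ∧ chainWeight w x.1 < s := by
  obtain ⟨_, ⟨x, hx, rfl⟩, hlt⟩ := exists_lt_of_csInf_lt (R.classWeights_nonempty w p) h
  exact ⟨x, hx, hlt⟩

/-- It is not necessary that the infimum be attained: a functional on homology is bounded by `C`
times the weight of any representative, so it vanishes on `p`, and functionals separate points. -/
lemma eq_zero_of_stableNorm_eq_zero (hw : ∀ e, 0 < w e) {p : R.H₁ ℝ}
    (h : R.stableNorm hw p = 0) : p = 0 := by
  rw [← Module.forall_dual_apply_eq_zero_iff ℝ]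
  intro f
  obtain ⟨C, hC, hbound⟩ := exists_abs_le_mul_chainWeight hw (f.comp (Submodule.mkQ _))
  rw [← abs_eq_zero]
  refine le_antisymm (le_of_forall_pos_le_add fun ε hε => ?_) (abs_nonneg _)
  -- The denominator is `C + 1` because `C` may be zero.
  obtain ⟨x, rfl, hx⟩ := R.exists_chainWeight_lt hw (p := p) (s := ε / (C + 1)) (by
    rw [h]; positivity)
  rw [zero_add]
  refine (hbound x).trans ?_
  have h1 : C * chainWeight w x.1 ≤ (C + 1) * (ε / (C + 1)) :=
    mul_le_mul (by linarith) hx.le (chainWeight_nonneg hw _) (by linarith)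
  rwa [mul_div_cancel₀ _ (by linarith : C + 1 ≠ 0)] at h1

/-- The least weight of an integral cycle in a class is attained. -/
lemma exists_min_intCycle (hw : ∀ e, 0 < w e) (α : R.H₁ ℤ) : ∃ x : G.cycles ℤ, R.cls ℤ x = α ∧
    ∀ y : G.cycles ℤ, R.cls ℤ y = α →
      chainWeight w (castCycle x).1 ≤ chainWeight w (castCycle y).1 := by
  obtain ⟨x₀, hx₀⟩ := Submodule.Quotient.mk_surjective _ α
  set W := chainWeight w (castCycle x₀).1 with hW
  let S : Set (G.cycles ℤ) := {x | R.cls ℤ x = α ∧ chainWeight w (castCycle x).1 ≤ W}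
  -- As the weights are positive, a bound on the total weight bounds every integral coefficient.
  have hfin : S.Finite := by
    have h1 : (Set.univ.pi fun e : E => Set.Icc (-⌈W / w e⌉) ⌈W / w e⌉).Finite :=
      Set.Finite.pi fun e => Set.finite_Icc _ _
    refine (h1.preimage (Subtype.val_injective.injOn (s := Set.univ)
      |>.mono (Set.subset_univ _))).subset ?_
    intro x hx e _
    have h2 := (abs_mul_le_chainWeight hw (castCycle x).1 e).trans hx.2
    rw [← le_div_iff₀ (hw e)] at h2
    have h3 : |((x.1 e : ℤ) : ℝ)| ≤ ((⌈W / w e⌉ : ℤ) : ℝ) := le_trans h2 (Int.le_ceil _)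
    rw [Set.mem_Icc, ← abs_le]
    exact_mod_cast h3
  obtain ⟨x, hx, hmin⟩ := Set.exists_min_image S (fun x => chainWeight w (castCycle x).1) hfin
    ⟨x₀, hx₀, le_rfl⟩
  refine ⟨x, hx.1, fun y hy => ?_⟩
  by_cases h : chainWeight w (castCycle y).1 ≤ W
  · exact hmin y ⟨hy, h⟩
  · exact hx.2.trans (not_le.1 h).le

/-- On integral classes the norm is the least weight of an integral cycle. -/
theorem isLeast_stableNorm_toReal (hw : ∀ e, 0 < w e) (α : R.H₁ ℤ) :
    IsLeast {r : ℝ | ∃ x : G.cycles ℤ, R.cls ℤ x = α ∧ r = ∑ e, |(x.1 e : ℝ)| * w e}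
      (R.stableNorm hw (R.toReal α)) := by
  obtain ⟨x, rfl, hmin⟩ := R.exists_min_intCycle hw α
  have hlow : ∀ y : G.cycles ℤ, R.cls ℤ y = R.cls ℤ x →
      R.stableNorm hw (R.toReal (R.cls ℤ x)) ≤ chainWeight w (castCycle y).1 := by
    intro y hy
    rw [← hy]
    exact R.stableNorm_cls_le hw _
  refine ⟨⟨x, rfl, le_antisymm (hlow x rfl) ?_⟩, ?_⟩
  · refine le_csInf (R.classWeights_nonempty w _) ?_
    rintro _ ⟨u, hu, rfl⟩
    -- A real competitor `u` is `x` plus the boundary of a real `y`. Rounding `y` gives an integral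
    -- competitor that is not heavier, to which the minimality of `x` applies.
    obtain ⟨y, hy⟩ := (R.cls_eq_iff u (castCycle x)).1 hu
    obtain ⟨z, hz⟩ := exists_int_potential w x.1 (fun e => R.faceOf (e, true))
      (fun e => R.faceOf (e, false)) y
    have hx' : x.1 + R.boundary₂ ℤ z ∈ G.cycles ℤ :=
      Submodule.add_mem _ x.2 (R.boundary₁_boundary₂ ℤ z)
    refine (hmin ⟨_, hx'⟩ ((R.cls_eq_iff _ _).2 ⟨z, by simp⟩)).trans (le_trans hz (le_of_eq ?_))
    refine Finset.sum_congr rfl fun e _ => ?_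
    have h1 := congrFun hy e
    change y (R.faceOf (e, true)) - y (R.faceOf (e, false)) = u.1 e - (x.1 e : ℝ) at h1
    rw [h1, add_sub_cancel]
  · rintro _ ⟨y, hy, rfl⟩
    exact hlow y hy

/-- An integral cycle is homologous to a family of simple cycles of the same total length. -/
lemma exists_list_simpleCycle (w : E → ℝ) (x : G.cycles ℤ) :
    ∃ L : List G.ClosedWalk, (∀ c ∈ L, c.IsSimpleCycle) ∧
      (L.map fun c => R.cls ℤ (c.cycle ℤ)).sum = R.cls ℤ x ∧
      (L.map fun c => c.length w).sum = chainWeight w (castCycle x).1 := by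
  induction x using cycle_induction with
  | h0 =>
    refine ⟨[], by simp, rfl, ?_⟩
    rw [map_zero]
    exact chainWeight_zero.symm
  | hadd x r c hr hc habs ih =>
    obtain ⟨L, h1, h2, h3⟩ := ih
    obtain ⟨m, rfl⟩ := Int.eq_ofNat_of_zero_le hr.le
    refine ⟨List.replicate m c ++ L, ?_, ?_, ?_⟩
    · intro c' hc'
      rcases List.mem_append.1 hc' with h | h
      · rw [List.eq_of_mem_replicate h]; exact hc
      · exact h1 c' h
    · rw [List.map_append, List.sum_append, h2, List.map_replicate, List.sum_replicate, add_comm,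
        ← natCast_zsmul]
      rfl
    · rw [List.map_append, List.sum_append, h3, List.map_replicate, List.sum_replicate,
        ← hc.chainWeight_cycle w, ← castCycle_cycle, nsmul_eq_mul, chainWeight, chainWeight,
        chainWeight, Finset.mul_sum, ← Finset.sum_add_distrib]
      refine Finset.sum_congr rfl fun e _ => ?_
      change (m : ℝ) * (|((c.cycle ℤ).1 e : ℝ)| * w e) + |(x.1 e : ℝ)| * w e =
        |(((x + (m : ℤ) • c.cycle ℤ).1 e : ℤ) : ℝ)| * w e
      simp only [← Int.cast_abs]
      rw [habs e]
      push_cast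
      ring

variable {R}

/-- The norm extends the marked length spectrum. -/
theorem IsTorus.isMarkedLength_stableNorm [Fintype V] (hT : R.IsTorus) (hw : ∀ e, 0 < w e)
    (c : G.ClosedWalk) :
    R.IsMarkedLength w c (R.stableNorm hw (R.toReal (R.cls ℤ (c.cycle ℤ)))) := by
  have hlow : ∀ c' : G.ClosedWalk, R.cls ℤ (c'.cycle ℤ) = R.cls ℤ (c.cycle ℤ) →
      R.stableNorm hw (R.toReal (R.cls ℤ (c.cycle ℤ))) ≤ c'.length w := by
    intro c' hc'
    rw [← hc', toReal_cls, castCycle_cycle]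
    exact (R.stableNorm_cls_le hw _).trans (chainWeight_cycle_le (fun e => (hw e).le) c')
  obtain ⟨x, hx, hmin⟩ := (R.isLeast_stableNorm_toReal hw (R.cls ℤ (c.cycle ℤ))).1
  obtain ⟨L, h1, h2, h3⟩ := R.exists_list_simpleCycle w x
  obtain ⟨c', h4, h5⟩ := hT.exists_closedWalk_of_list hw L h1
  have h6 : R.cls ℤ (c'.cycle ℤ) = R.cls ℤ (c.cycle ℤ) := by rw [h4, h2, hx]
  refine ⟨⟨c', hT.freelyHomotopic_of_cls_eq h6.symm, le_antisymm (hlow c' h6) ?_⟩, ?_⟩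
  · rw [hmin]; exact h5.trans (le_of_eq h3)
  · rintro _ ⟨c'', h, rfl⟩
    exact hlow c'' (R.cls_eq_of_freelyHomotopic ℤ h).symm

end Norm

end RotationSystem
end Multigraph

/-! ### The unit ball and its extreme points -/

/-- An extreme point of the unit ball of a norm has norm one. -/
lemma Seminorm.eq_one_of_mem_extremePoints {X : Type*} [AddCommGroup X] [Module ℝ X] [Nontrivial X]
    (N : Seminorm ℝ X) (hN : ∀ p, N p = 0 → p = 0) {p : X}
    (hp : p ∈ Set.extremePoints ℝ {p | N p ≤ 1}) : N p = 1 := by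
  obtain ⟨v, hv⟩ := exists_ne (0 : X)
  have hv' : 0 < N v := lt_of_le_of_ne (apply_nonneg N v) fun h => hv (hN v h.symm)
  by_contra hne
  have hlt : N p < 1 := lt_of_le_of_ne hp.1 hne
  -- Scaled so that `N (ε • v)` is `1 - N p`: a segment centred at `p` then stays in the ball.
  set ε := (1 - N p) / N v with hε
  have hε' : 0 < ε := div_pos (by linarith) hv'
  have h0 : N (ε • v) = 1 - N p := by
    rw [map_smul_eq_mul, Real.norm_eq_abs, abs_of_pos hε', hε, div_mul_cancel₀ _ hv'.ne']
  have h1 : N (p - ε • v) ≤ 1 := (map_sub_le_add N _ _).trans (by rw [h0]; linarith)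
  have h2 : N (p + ε • v) ≤ 1 := (map_add_le_add N _ _).trans (by rw [h0]; linarith)
  have h3 := (mem_extremePoints.1 hp).2 _ h1 _ h2
    ⟨1 / 2, 1 / 2, by norm_num, by norm_num, by norm_num, by module⟩
  have h4 : ε • v = 0 := by simpa using h3.1
  rcases smul_eq_zero.1 h4 with h | h
  · exact hε'.ne' h
  · exact hv h

namespace Multigraph
open Dart
variable {V E : Type*} {G : Multigraph V E}

lemma ClosedWalk.IsSimpleCycle.reverse {c : G.ClosedWalk} (hc : c.IsSimpleCycle) :
    c.reverse.IsSimpleCycle := by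
  refine ⟨?_, ?_, ?_⟩
  · simpa [ClosedWalk.reverse, revWalk] using hc.1
  · have h : c.reverse.darts.map G.source = (c.darts.map G.target).reverse := by
      simp [ClosedWalk.reverse, revWalk, Function.comp_def]
    rw [h, List.nodup_reverse]
    exact c.perm_target.nodup_iff.2 hc.2.1
  · have h : c.reverse.darts.map Prod.fst = (c.darts.map Prod.fst).reverse := by
      simp [ClosedWalk.reverse, revWalk, Function.comp_def]
    rw [h, List.nodup_reverse]
    exact hc.2.2

namespace RotationSystem
variable [Fintype E] (R : G.RotationSystem) {w : E → ℝ}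

lemma neg_mem_normalizedSimpleCycles {p : R.H₁ ℝ} (hp : p ∈ R.normalizedSimpleCycles w) :
    -p ∈ R.normalizedSimpleCycles w := by
  obtain ⟨c, hc, rfl⟩ := hp
  refine ⟨c.reverse, hc.reverse, ?_⟩
  rw [ClosedWalk.length_reverse, ClosedWalk.cycle_reverse, show R.cls ℝ (-c.cycle ℝ) = -R.cls ℝ (c.cycle ℝ) from rfl,
    smul_neg]

/-- The point depends only on the list of oriented edges, and a finite type has finitely many lists
without repetition. -/
lemma finite_normalizedSimpleCycles (w : E → ℝ) : (R.normalizedSimpleCycles w).Finite := by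
  classical
  let f : {l : List (Dart E) // l.Nodup} → R.H₁ ℝ := fun l =>
    if h : ∃ c : G.ClosedWalk, c.darts = l.1 then
      (h.choose.length w)⁻¹ • R.cls ℝ (h.choose.cycle ℝ) else 0
  refine (Set.finite_range f).subset ?_
  rintro _ ⟨c, hc, rfl⟩
  have h : ∃ c' : G.ClosedWalk, c'.darts = c.darts := ⟨c, rfl⟩
  refine ⟨⟨c.darts, hc.nodup_darts⟩, ?_⟩
  have hperm : h.choose.darts.Perm c.darts := by rw [h.choose_spec]
  simp only [f, dif_pos h]
  rw [ClosedWalk.length_eq_of_perm w hperm, ClosedWalk.cycle_eq_of_perm ℝ hperm]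

lemma stableNorm_le_one_of_mem (hw : ∀ e, 0 < w e) {p : R.H₁ ℝ}
    (hp : p ∈ R.normalizedSimpleCycles w) : R.stableNorm hw p ≤ 1 := by
  obtain ⟨c, hc, rfl⟩ := hp
  have hpos := ClosedWalk.length_pos hw hc.1
  rw [map_smul_eq_mul, Real.norm_eq_abs, abs_of_pos (inv_pos.2 hpos), inv_mul_le_iff₀ hpos, mul_one,
    ← hc.chainWeight_cycle w]
  exact R.stableNorm_cls_le hw _

variable {R}

lemma IsTorus.nontrivial_H₁ [Fintype V] (hT : R.IsTorus) : Nontrivial (R.H₁ ℝ) :=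
  Module.nontrivial_of_finrank_pos (R := ℝ) (by rw [hT.finrank_H₁ ℝ]; norm_num)

/-- Nonzero homology provides a simple cycle; the origin is the midpoint of its point and that of
its reverse. -/
lemma IsTorus.zero_mem_convexHull [Fintype V] (hT : R.IsTorus) (w : E → ℝ) :
    0 ∈ convexHull ℝ (R.normalizedSimpleCycles w) := by
  have := hT.nontrivial_H₁
  obtain ⟨p, hp⟩ := exists_ne (0 : R.H₁ ℝ)
  obtain ⟨x, rfl⟩ := Submodule.Quotient.mk_surjective _ p
  have hx : x.1 ≠ 0 := fun h => hp (by
    rw [show x = 0 from Subtype.ext h]; rfl)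
  obtain ⟨c, hc, -⟩ := exists_simpleCycle_pos x.2 hx
  have h1 : (c.length w)⁻¹ • R.cls ℝ (c.cycle ℝ) ∈ R.normalizedSimpleCycles w := ⟨c, hc, rfl⟩
  have h2 := convex_convexHull ℝ (R.normalizedSimpleCycles w) (subset_convexHull ℝ _ h1)
    (subset_convexHull ℝ _ (R.neg_mem_normalizedSimpleCycles h1)) (a := 1 / 2) (b := 1 / 2)
    (by norm_num) (by norm_num) (by norm_num)
  rwa [smul_neg, add_neg_cancel] at h2

/-- The class of a real cycle is its weight times a point of the hull. -/
lemma IsTorus.exists_mem_convexHull_smul [Fintype V] (hT : R.IsTorus) (hw : ∀ e, 0 < w e)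
    (x : G.cycles ℝ) : ∃ q ∈ convexHull ℝ (R.normalizedSimpleCycles w),
      R.cls ℝ x = chainWeight w x.1 • q := by
  induction x using cycle_induction with
  | h0 => exact ⟨0, hT.zero_mem_convexHull w, by rw [smul_zero]; rfl⟩
  | hadd x r c hr hc habs ih =>
    obtain ⟨q, hq, hxq⟩ := ih
    have hpos := ClosedWalk.length_pos hw hc.1
    have hadd : chainWeight w (x + r • c.cycle ℝ).1 = chainWeight w x.1 + r * c.length w := by
      rw [← hc.chainWeight_cycle w, chainWeight, chainWeight, chainWeight, Finset.mul_sum,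
        ← Finset.sum_add_distrib]
      refine Finset.sum_congr rfl fun e _ => ?_
      rw [habs e]; ring
    have hx0 := chainWeight_nonneg hw x.1
    have hr' : 0 < r * c.length w := mul_pos hr hpos
    have hs : 0 < chainWeight w x.1 + r * c.length w := by linarith
    refine ⟨(chainWeight w x.1 / (chainWeight w x.1 + r * c.length w)) • q +
      (r * c.length w / (chainWeight w x.1 + r * c.length w)) •
        ((c.length w)⁻¹ • R.cls ℝ (c.cycle ℝ)),
      convex_convexHull ℝ _ hq (subset_convexHull ℝ _ ⟨c, hc, rfl⟩) (div_nonneg hx0 hs.le)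
        (div_nonneg hr'.le hs.le) (by rw [← add_div, div_self hs.ne']), ?_⟩
    rw [hadd, smul_add, smul_smul, smul_smul, smul_smul, mul_div_cancel₀ _ hs.ne',
      mul_div_cancel₀ _ hs.ne', mul_inv_cancel_right₀ hpos.ne', ← hxq]
    rfl

/-- Strict inequality supplies a representative of weight below one although the infimum may not be
attained. The points of norm one follow because the hull is closed. -/
lemma IsTorus.mem_convexHull [Fintype V] (hT : R.IsTorus) (hw : ∀ e, 0 < w e) {p : R.H₁ ℝ}
    (hp : R.stableNorm hw p < 1) : p ∈ convexHull ℝ (R.normalizedSimpleCycles w) := by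
  obtain ⟨x, rfl, hx⟩ := R.exists_chainWeight_lt hw hp
  obtain ⟨q, hq, h⟩ := hT.exists_mem_convexHull_smul hw x
  rw [h]
  exact (convex_convexHull ℝ _).smul_mem_of_zero_mem (hT.zero_mem_convexHull w) hq
    ⟨chainWeight_nonneg hw _, hx.le⟩

/-- The unit ball is the convex hull of the normalized simple cycles. -/
theorem IsTorus.ball_eq_convexHull [Fintype V] (hT : R.IsTorus) (hw : ∀ e, 0 < w e) :
    {p | R.stableNorm hw p ≤ 1} = convexHull ℝ (R.normalizedSimpleCycles w) := by
  have := hT.nontrivial_H₁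
  refine Set.Subset.antisymm (fun p hp => ?_) (convexHull_min
    (fun p hp => R.stableNorm_le_one_of_mem hw hp) ?_)
  · obtain ⟨bZ⟩ := hT.exists_basis
    obtain ⟨bR, -⟩ := hT.exists_realBasis bZ
    set S := R.normalizedSimpleCycles w with hS
    -- In coordinates the hull of finitely many points is closed, and `p` is the limit of its
    -- multiples by `1 - 1 / (n + 1)`, which have norm below one.
    let φ : R.H₁ ℝ →ₗ[ℝ] (Fin 2 → ℝ) := bR.equivFun
    have hclosed : IsClosed (φ '' convexHull ℝ S) := by
      rw [LinearMap.image_convexHull]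
      exact ((R.finite_normalizedSimpleCycles w).image _).isClosed_convexHull ℝ
    have hmem : φ p ∈ φ '' convexHull ℝ S := by
      have hlim : Filter.Tendsto (fun n : ℕ => ((1 : ℝ) - 1 / ((n : ℝ) + 1)) • φ p) Filter.atTop
          (nhds (φ p)) := by
        have h1 := (tendsto_one_div_add_atTop_nhds_zero_nat (𝕜 := ℝ)).const_sub 1
        simpa using h1.smul_const (φ p)
      refine hclosed.mem_of_tendsto hlim (Filter.Eventually.of_forall fun n => ?_)
      rw [← map_smul]
      refine Set.mem_image_of_mem _ (hT.mem_convexHull hw ?_)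
      have h2 : 0 < 1 / ((n : ℝ) + 1) := by positivity
      have h3 : 1 / ((n : ℝ) + 1) ≤ 1 := by
        rw [div_le_one (by positivity)]
        linarith [(Nat.cast_nonneg n : (0 : ℝ) ≤ n)]
      rw [map_smul_eq_mul, Real.norm_eq_abs, abs_of_nonneg (by linarith)]
      have h4 := mul_le_mul_of_nonneg_left hp (by linarith : 0 ≤ 1 - 1 / ((n : ℝ) + 1))
      linarith
    obtain ⟨q, hq, hqp⟩ := hmem
    rwa [← bR.equivFun.injective hqp]
  · have := (R.stableNorm hw).convex_closedBall 0 1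
    rwa [Seminorm.closedBall_zero_eq] at this

/-- Extreme points of the unit ball coming from simple cycles with intersection number zero
agree up to sign. -/
lemma IsTorus.eq_or_eq_neg_of_intForm_eq_zero [Fintype V] (hT : R.IsTorus) (hw : ∀ e, 0 < w e)
    {c c' : G.ClosedWalk} (hc : c.IsSimpleCycle) (hc' : c'.IsSimpleCycle)
    (h : R.stableNorm hw ((c.length w)⁻¹ • R.cls ℝ (c.cycle ℝ)) = 1)
    (h' : R.stableNorm hw ((c'.length w)⁻¹ • R.cls ℝ (c'.cycle ℝ)) = 1)
    (hi : R.intForm ℤ (c.cycle ℤ).1 (c'.cycle ℤ).1 = 0) :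
    (c.length w)⁻¹ • R.cls ℝ (c.cycle ℝ) = (c'.length w)⁻¹ • R.cls ℝ (c'.cycle ℝ) ∨
    (c.length w)⁻¹ • R.cls ℝ (c.cycle ℝ) = -((c'.length w)⁻¹ • R.cls ℝ (c'.cycle ℝ)) := by
  have hl := ClosedWalk.length_pos hw hc.1
  have hl' := ClosedWalk.length_pos hw hc'.1
  have hreal : ∀ c : G.ClosedWalk, R.cls ℝ (c.cycle ℝ) = R.toReal (R.cls ℤ (c.cycle ℤ)) :=
    fun c => by rw [toReal_cls, castCycle_cycle]
  have hne : ∀ c : G.ClosedWalk, R.stableNorm hw ((c.length w)⁻¹ • R.cls ℝ (c.cycle ℝ)) = 1 →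
      R.cls ℤ (c.cycle ℤ) ≠ 0 := fun c h h0 => by
    rw [hreal, h0, map_zero, smul_zero, map_zero] at h
    exact zero_ne_one h
  have hlen : ∀ c : G.ClosedWalk, 0 < c.length w →
      R.stableNorm hw ((c.length w)⁻¹ • R.cls ℝ (c.cycle ℝ)) = 1 →
      R.stableNorm hw (R.cls ℝ (c.cycle ℝ)) = c.length w := fun c hl h => by
    rwa [map_smul_eq_mul, Real.norm_eq_abs, abs_of_pos (inv_pos.2 hl), inv_mul_eq_one₀ hl.ne',
      eq_comm] at h
  rcases hT.cls_eq_or_eq_neg hc hc' (hne c h) (hne c' h') hi with h1 | h1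
  · have h2 : R.cls ℝ (c.cycle ℝ) = R.cls ℝ (c'.cycle ℝ) := by rw [hreal, hreal, h1]
    left
    rw [← hlen c hl h, ← hlen c' hl' h', h2]
  · have h2 : R.cls ℝ (c.cycle ℝ) = -R.cls ℝ (c'.cycle ℝ) := by rw [hreal, hreal, h1, map_neg]
    right
    rw [← hlen c hl h, ← hlen c' hl' h', h2, map_neg_eq_map, smul_neg]

/-- The unit ball has at most `4 |V| + 2` extreme points. -/
theorem IsTorus.encard_extremePoints_le [Fintype V] (hT : R.IsTorus) (hw : ∀ e, 0 < w e) :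
    (Set.extremePoints ℝ {p | R.stableNorm hw p ≤ 1}).encard ≤ 4 * Fintype.card V + 2 := by
  classical
  have := hT.nontrivial_H₁
  have := hT.1.1
  obtain ⟨b⟩ := hT.exists_basis
  obtain ⟨D, -, hdet⟩ := hT.exists_intForm_eq_det b
  -- Bertrand's postulate: `q` exceeds every intersection number of simple cycles, yet `2 * (q + 1)
  -- ≤ 4 * |V| + 2`.
  obtain ⟨q, hq, hnq, hqn⟩ := Nat.exists_prime_lt_and_le_two_mul (Fintype.card V)
    Fintype.card_ne_zero
  have : Fact q.Prime := ⟨hq⟩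
  set X := Set.extremePoints ℝ {p | R.stableNorm hw p ≤ 1} with hX
  have hsub : X ⊆ R.normalizedSimpleCycles w := by
    rw [hX, hT.ball_eq_convexHull hw]
    exact extremePoints_convexHull_subset
  have hfin : X.Finite := (R.finite_normalizedSimpleCycles w).subset hsub
  have hone : ∀ p ∈ X, R.stableNorm hw p = 1 := fun p hp =>
    (R.stableNorm hw).eq_one_of_mem_extremePoints (fun p => R.eq_zero_of_stableNorm_eq_zero hw) hp
  have hcyc : ∀ p : X, ∃ c : G.ClosedWalk, c.IsSimpleCycle ∧
      p.1 = (c.length w)⁻¹ • R.cls ℝ (c.cycle ℝ) := fun p => hsub p.2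
  choose c hc hpc using hcyc
  let coord : X → Fin 2 → ZMod q := fun p i => (b.repr (R.cls ℤ ((c p).cycle ℤ)) i : ZMod q)
  -- A point of the projective line over `ZMod q`, with `none` at infinity: `q + 1` values. That the
  -- coordinates do not both vanish modulo `q` is not needed.
  let slope : X → Option (ZMod q) := fun p =>
    if coord p 1 = 0 then none else some (coord p 0 / coord p 1)
  have hslope : ∀ p p' : X, slope p = slope p' →
      coord p 0 * coord p' 1 = coord p 1 * coord p' 0 := by
    intro p p' h
    simp only [slope] at h
    split_ifs at h with h1 h2 h2
    · rw [h1, h2]; ring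
    · rw [Option.some.injEq, div_eq_div_iff h1 h2] at h
      rw [h]; ring
  -- With equal slopes, `q` divides the determinant and hence the intersection number. The latter is
  -- smaller than `q` in absolute value, so it is zero.
  have hpm : ∀ p p' : X, slope p = slope p' → p.1 = p'.1 ∨ p.1 = -p'.1 := by
    intro p p' h
    rw [hpc p, hpc p']
    refine hT.eq_or_eq_neg_of_intForm_eq_zero hw (hc p) (hc p') (hpc p ▸ hone p p.2)
      (hpc p' ▸ hone p' p'.2) (Int.eq_zero_of_abs_lt_dvd (m := q) ?_ ?_)
    · rw [hdet]
      refine Dvd.dvd.mul_left ((ZMod.intCast_zmod_eq_zero_iff_dvd _ _).1 ?_) _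
      push_cast
      exact sub_eq_zero.2 (hslope p p' h)
    · exact (R.abs_intForm_le_card (hc p) (hc p')).trans_lt (by exact_mod_cast hnq)
  have := hfin.fintype
  have hcard : Fintype.card X ≤ 2 * (q + 1) := by
    refine (Finset.card_le_mul_card_image (f := slope) Finset.univ 2 ?_).trans
      (Nat.mul_le_mul_left 2 ((Finset.card_le_univ _).trans (by rw [Fintype.card_option, ZMod.card])))
    intro s hs
    obtain ⟨p₀, -, rfl⟩ := Finset.mem_image.1 hs
    refine (Finset.card_le_card_of_injOn (t := {p₀.1, -p₀.1}) Subtype.val ?_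
      Subtype.val_injective.injOn).trans Finset.card_le_two
    intro p hp
    simpa using hpm p p₀ (by simpa using hp)
  rw [← hfin.cast_ncard_eq, ← Nat.card_coe_set_eq, Nat.card_eq_fintype_card]
  have : Fintype.card X ≤ 4 * Fintype.card V + 2 := by omega
  exact_mod_cast this

/-- The normalized simple cycles have rational slope in every integral basis. -/
lemma exists_rational_ratio {bZ : Module.Basis (Fin 2) ℤ (R.H₁ ℤ)}
    {bR : Module.Basis (Fin 2) ℝ (R.H₁ ℝ)} (hb : R.IsIntegralBasis bZ bR) {p : R.H₁ ℝ}
    (hp : p ∈ R.normalizedSimpleCycles w) :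
    ∃ m n : ℤ, (m ≠ 0 ∨ n ≠ 0) ∧ (m : ℝ) * bR.repr p 0 = n * bR.repr p 1 := by
  obtain ⟨c, -, rfl⟩ := hp
  have h : ∀ i, bR.repr ((c.length w)⁻¹ • R.cls ℝ (c.cycle ℝ)) i =
      (c.length w)⁻¹ * (bZ.repr (R.cls ℤ (c.cycle ℤ)) i : ℝ) := fun i => by
    rw [← hb.repr_toReal, toReal_cls, castCycle_cycle, map_smul]
    rfl
  rw [h, h]
  -- The class of a simple cycle may be zero; its point is then the origin, which satisfies every
  -- relation.
  by_cases h0 : bZ.repr (R.cls ℤ (c.cycle ℤ)) 1 = 0 ∧ bZ.repr (R.cls ℤ (c.cycle ℤ)) 0 = 0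
  · exact ⟨1, 0, Or.inl one_ne_zero, by simp [h0]⟩
  · exact ⟨bZ.repr (R.cls ℤ (c.cycle ℤ)) 1, bZ.repr (R.cls ℤ (c.cycle ℤ)) 0,
      not_and_or.1 h0, by ring⟩

end RotationSystem
end Multigraph

theorem theorem1 {V E : Type*} [Fintype V] [Fintype E] (G : Multigraph V E)
    (R : G.RotationSystem) (hT : R.IsTorus) (w : E → ℝ) (hw : ∀ e, 0 < w e) :
    -- `H₁(T; ℤ)` is a lattice of rank two in the plane `H₁(T; ℝ)`
    (∃ bZ bR, R.IsIntegralBasis bZ bR) ∧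
    -- free homotopy classes of closed walks are the elements of `H₁(T; ℤ)`
    (∀ c c' : G.ClosedWalk,
      R.FreelyHomotopic c c' ↔ R.cls ℤ (c.cycle ℤ) = R.cls ℤ (c'.cycle ℤ)) ∧
    (∀ α : R.H₁ ℤ, ∃ c : G.ClosedWalk, R.cls ℤ (c.cycle ℤ) = α) ∧
    ∃ N : Seminorm ℝ (R.H₁ ℝ),
      -- `N` is a norm
      (∀ p, N p = 0 → p = 0) ∧
      -- `N` extends the marked length spectrum
      (∀ c : G.ClosedWalk, R.IsMarkedLength w c (N (R.toReal (R.cls ℤ (c.cycle ℤ))))) ∧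
      -- on integral classes, `N` is the least weight of an integral cycle in the class
      (∀ α : R.H₁ ℤ,
        IsLeast {r : ℝ | ∃ x : G.cycles ℤ, R.cls ℤ x = α ∧ r = ∑ e, |(x.1 e : ℝ)| * w e}
          (N (R.toReal α))) ∧
      -- the unit ball is the convex hull of the finite set of the vectors `[c] / w(c)`
      (R.normalizedSimpleCycles w).Finite ∧
      {p | N p ≤ 1} = convexHull ℝ (R.normalizedSimpleCycles w) ∧
      -- number of extremal points
      (Set.extremePoints ℝ {p | N p ≤ 1}).encard ≤ 4 * Fintype.card V + 5 ∧
      -- in every integral basis, the two coordinates of an extremal point have a rational ratio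
      (∀ bZ bR, R.IsIntegralBasis bZ bR → ∀ p ∈ Set.extremePoints ℝ {p | N p ≤ 1},
        ∃ m n : ℤ, (m ≠ 0 ∨ n ≠ 0) ∧ (m : ℝ) * bR.repr p 0 = n * bR.repr p 1) := by

  obtain ⟨bZ⟩ := hT.exists_basis
  obtain ⟨bR, hb⟩ := hT.exists_realBasis bZ
  refine ⟨⟨bZ, bR, hb⟩, fun c c' => ⟨R.cls_eq_of_freelyHomotopic ℤ, hT.freelyHomotopic_of_cls_eq⟩,
    R.exists_closedWalk_cls_eq hT.1, R.stableNorm hw,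
    fun p => R.eq_zero_of_stableNorm_eq_zero hw, hT.isMarkedLength_stableNorm hw,
    R.isLeast_stableNorm_toReal hw, R.finite_normalizedSimpleCycles w, hT.ball_eq_convexHull hw,
    (hT.encard_extremePoints_le hw).trans ?_, fun bZ bR hb p hp => ?_⟩
  · gcongr; norm_num
  · rw [hT.ball_eq_convexHull hw] at hp
    exact Multigraph.RotationSystem.exists_rational_ratio hb (extremePoints_convexHull_subset hp)
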